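/- Let $R$ be a complete discrete valuation ring with uniformizer $\pi$ and algebraically closed residue field $k$ of characteristic $0$. Let $A$ be the localization of $R[u,v]/(uv-\pi)$ at $\mathfrak m=(u,v,\pi)$, put $\mathfrak p=(v)$, and let $B=A^{\mathrm{sh}}_{\mathfrak m}$ be the strict Henselization of $A$, that is, the filtered colimit of the étale $A$-algebras $E$ equipped with an $A$-homomorphism from $E$ to a fixed separable closure of the residue field of $A$. Let $f\in A[y]$ be a polynomial that splits completely over $B$ and whose leading coefficient is invertible in $B$, and let $h_{\mathfrak m},h_{\mathfrak p}\ge 0$ be integers. A pair $(r_{\mathfrak m},r_{\mathfrak p})$ of elements of $B$ is an $(\mathfrak m,\mathfrak p)$-adic approximation of height $(h_{\mathfrak m},h_{\mathfrak p})$ of a root $\alpha\in B$ of $f$ if $\alpha-r_{\mathfrak p}\in(v^{h_{\mathfrak p}})$ and $\alpha-r_{\mathfrak m}\in(u^{h_{\mathfrak m}},v^{h_{\mathfrak p}})$. Étale lifts. Let $A'$ be a domain with fraction field $K(A')$, let $\mathfrak p'\subset\mathfrak m'$ be primes of $A'$, and let $\overline g\in k(\mathfrak p')[y]$ be irreducible.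 An $\mathfrak m'$-integral étale lift of $\overline g$ is a polynomial $g\in A'_{\mathfrak p'}[y]$ that reduces to $\overline g$, has the same degree, is irreducible over $K(A')$, and is such that the normalization of $A'$ in $K(A')[y]/(g)$ has a prime $\mathfrak q$ over $\mathfrak m'$ at which it is étale over $A'$ and for which $y \bmod g$ lies in the local ring at $\mathfrak q$. The mixed Newton-Puiseux algorithm. Fix a ring-theoretic section $s:k\to R$ of the residue map, and a lifting map $\sigma:B/(v)\to B$, i.e. a ring-theoretic section of the reduction map with $\sigma(u)=u$ and $\sigma|_k=s$. A state consists of a polynomial $F\in B[y]$, a finite set of adjoined roots $\Gamma\subset B$, a precision $N$, and $r_{\mathfrak p},r_{\mathfrak m}\in B$; initially $F=f$, $\Gamma=\emptyset$, $N=0$, $r_{\mathfrak p}=r_{\mathfrak m}=0$. Let $A'\subset B$ be the normalization of $A$ in $K(A)(\Gamma)$, with primes $\mathfrak p'=A'\cap(v)$ and $\mathfrak m'=A'\cap(u,v)$. One pass of the algorithm is as follows. (1) Choose a line segment of the $v$-adic Newton polygon of $F$; its slope is the valuation $e$ of the corresponding roots, and we require $e>0$, or $e\ge0$ on the first pass.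 If $e=\infty$ (that is, $F(0)=0$) or $N+e\ge h_{\mathfrak p}$, stop and return $(r_{\mathfrak m},r_{\mathfrak p})$. (2) Otherwise let $F_1=v^{-m}F(v^ey)$, with $m$ such that $F_1$ is not divisible by $v$. (3) Choose a monic irreducible factor $\overline g$ of $\overline F_1$ over the residue field $k(\mathfrak p')$. (4) Lift $\overline g$ to the polynomial $g=\sigma(\overline g)$, and adjoin a root $\gamma\in B$ of $g$. (5) Compute with the discrete Newton-Puiseux algorithm (the same procedure over the discrete valuation ring $B/(v)$, with uniformizer $u$, residue field $k$ and lifts of elements of $k$ through $s$), applied to $\overline g$, the expansion $r'=\sum_{i<h_{\mathfrak m}}d_iu^i$ of the root $\overline\gamma$ of $\overline g$, so that $\overline\gamma-r'\in(u^{h_{\mathfrak m}})$. (6) Replace $F$ by $F_1(y+\gamma)$, $N$ by $N+e$, $\Gamma$ by $\Gamma\cup\{\gamma\}$, $r_{\mathfrak p}$ by $r_{\mathfrak p}+\gamma v^{N+e}$ and $r_{\mathfrak m}$ by $r_{\mathfrak m}+\sigma(r')v^{N+e}$, where $N$ denotes the old precision, and return to (1). Theorem. The ring $B$ is a domain in which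 $(v)$ and $(u,v)$ are prime, a section $s$ exists, and for each $s$ a lifting map $\sigma$ exists. For every such $s$ and $\sigma$, the algorithm correctly computes the $(\mathfrak m,\mathfrak p)$-adic approximations of the roots of $f$ up to height $(h_{\mathfrak m},h_{\mathfrak p})$. That is: every pair returned is an $(\mathfrak m,\mathfrak p)$-adic approximation of height $(h_{\mathfrak m},h_{\mathfrak p})$ of a root of $f$, and every root of $f$ has such an approximation among the pairs returned; there is no infinite sequence of passes, and there are only finitely many continuations at each stage; no step ever fails (for non-constant $f$ there is always a line segment to choose in (1), the finite slopes that occur are integers, $F_1$ exists, $\overline F_1$ has coefficients in $k(\mathfrak p')$ and has an irreducible factor, $\overline g$ has coefficients in $B/(v)$ and $\sigma(\overline g)$ has coefficients in $A'_{\mathfrak p'}$, $g$ has a root in $B$, and for every such root $\gamma$ the discrete algorithm finds the expansion of $\overline\gamma$). Moreover, each lift $g$ used is an $\mathfrak m'$-integral étale lift of $\overline g$, and $A'$ is étale over $A$ at $\mathfrak m'$ at every stage. -/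

import Mathlib

open Polynomial

namespace MixedNP

universe u v w

/-! ### The local ring of an ordinary double point -/

section Node

variable {R : Type u} [CommRing R]

/-- The ring `R[u, v] / (u v - π)`. -/
abbrev Node (π : R) : Type u :=
  MvPolynomial (Fin 2) R ⧸
    (Ideal.span {MvPolynomial.X 0 * MvPolynomial.X 1 - MvPolynomial.C π} :
      Ideal (MvPolynomial (Fin 2) R))

/-- The class of `u`. -/
noncomputable def nodeU (π : R) : Node π := Ideal.Quotient.mk _ (MvPolynomial.X 0)

/-- The class of `v`. -/
noncomputable def nodeV (π : R) : Node π := Ideal.Quotient.mk _ (MvPolynomial.X 1)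

/-- The ideal `𝔪 = (u, v, π)`. -/
noncomputable def nodeIdeal (π : R) : Ideal (Node π) :=
  Ideal.span {nodeU π, nodeV π, algebraMap R (Node π) π}

variable [IsDomain R] [IsDiscreteValuationRing R]

/-- Evaluation at `u = v = 0` in the residue field of `R`; used only to show that `𝔪` is prime. -/
noncomputable def nodeEval (π : R) (hπ : Irreducible π) :
    Node π →+* IsLocalRing.ResidueField R :=
  Ideal.Quotient.lift _
    (MvPolynomial.eval₂Hom (IsLocalRing.residue R) (fun _ => 0)) (by
      intro a ha
      have hle : Ideal.span {MvPolynomial.X 0 * MvPolynomial.X 1 - MvPolynomial.C π} ≤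
          RingHom.ker (MvPolynomial.eval₂Hom (IsLocalRing.residue R)
            (fun _ : Fin 2 => (0 : IsLocalRing.ResidueField R))) := by
        rw [Ideal.span_singleton_le_iff_mem, RingHom.mem_ker]
        have h0 : IsLocalRing.residue R π = 0 := by
          rw [IsLocalRing.residue_eq_zero_iff]
          exact (IsLocalRing.mem_maximalIdeal _).2 hπ.not_isUnit
        simp [h0]
      exact hle ha)

theorem nodeIdeal_eq_ker (π : R) (hπ : Irreducible π) :
    nodeIdeal π = RingHom.ker (nodeEval π hπ) := by
  have h0 : IsLocalRing.residue R π = 0 := by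
    rw [IsLocalRing.residue_eq_zero_iff]
    exact (IsLocalRing.mem_maximalIdeal _).2 hπ.not_isUnit
  have hC : ∀ r : R, nodeEval π hπ (algebraMap R (Node π) r) = IsLocalRing.residue R r := by
    intro r
    change MvPolynomial.eval₂Hom (IsLocalRing.residue R) (fun _ => 0) (MvPolynomial.C r) = _
    simp
  apply le_antisymm
  · unfold nodeIdeal
    rw [Ideal.span_le]
    rintro x (rfl | rfl | rfl)
    · simp [RingHom.mem_ker, nodeEval, nodeU]
    · simp [RingHom.mem_ker, nodeEval, nodeV]
    · simp only [SetLike.mem_coe, RingHom.mem_ker]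
      rw [hC, h0]
  · intro x hx
    obtain ⟨p, rfl⟩ := Ideal.Quotient.mk_surjective x
    have key : ∀ q : MvPolynomial (Fin 2) R,
        (Ideal.Quotient.mk _ q : Node π) -
          algebraMap R (Node π) (MvPolynomial.constantCoeff q) ∈ nodeIdeal π := by
      intro q
      induction q using MvPolynomial.induction_on with
      | C a =>
        have : (Ideal.Quotient.mk _ (MvPolynomial.C a) : Node π) = algebraMap R (Node π) a := rfl
        simp [this]
      | add p q hp hq =>
        have := Ideal.add_mem _ hp hq
        simp only [map_add]
        convert this using 1
        ring
      | mul_X p i _ =>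
        have hX : (Ideal.Quotient.mk _ (MvPolynomial.X i) : Node π) ∈ nodeIdeal π := by
          unfold nodeIdeal
          fin_cases i
          · exact Ideal.subset_span (Or.inl rfl)
          · exact Ideal.subset_span (Or.inr (Or.inl rfl))
        simp only [map_mul, MvPolynomial.constantCoeff_X, mul_zero, map_zero, sub_zero]
        exact Ideal.mul_mem_left _ _ hX
    have hc : algebraMap R (Node π) (MvPolynomial.constantCoeff p) ∈ nodeIdeal π := by
      have h1 : nodeEval π hπ (algebraMap R (Node π) (MvPolynomial.constantCoeff p)) = 0 := by
        have hx' : nodeEval π hπ (Ideal.Quotient.mk _ p) = 0 := hx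
        rw [hC, ← hx']
        change _ = MvPolynomial.eval₂Hom (IsLocalRing.residue R) (fun _ => 0) p
        exact (MvPolynomial.eval₂Hom_zero_apply _ _).symm
      rw [hC, IsLocalRing.residue_eq_zero_iff, hπ.maximalIdeal_eq,
        Ideal.mem_span_singleton] at h1
      obtain ⟨c, hc⟩ := h1
      rw [hc, map_mul]
      exact Ideal.mul_mem_right _ _ (Ideal.subset_span (by simp))
    have := Ideal.add_mem _ (key p) hc
    simpa using this

instance nodeIdeal_isPrime (π : R) [hπ : Fact (Irreducible π)] : (nodeIdeal π).IsPrime := by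
  rw [nodeIdeal_eq_ker π hπ.out]
  exact RingHom.ker_isPrime _

/-- The local ring `A` of `R[u, v] / (u v - π)` at `𝔪 = (u, v, π)`. -/
abbrev NodeLocal (π : R) [Fact (Irreducible π)] : Type u :=
  Localization.AtPrime (nodeIdeal π)

end Node

/-! ### Strict Henselization -/

/-- `B` is a strict Henselization of the local ring `A`: the filtered colimit of the étale
`A`-algebras `E` equipped with an `A`-homomorphism `α` from `E` to a fixed separable closure of the
residue field of `A`. Such an `α` is the same as a prime of `E` over the maximal ideal of `A`
together with an embedding of its residue field into the separable closure. -/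
def IsStrictHenselization (A : Type u) (B : Type v) [CommRing A] [IsLocalRing A] [CommRing B]
    [Algebra A B] : Prop :=
  ∃ ι : ∀ (E : Type u) [CommRing E] [Algebra A E] [Algebra.Etale A E],
      (E →ₐ[A] SeparableClosure (IsLocalRing.ResidueField A)) → (E →ₐ[A] B),
    -- the maps to `B` form a cocone
    (∀ (E E' : Type u) [CommRing E] [Algebra A E] [Algebra.Etale A E]
        [CommRing E'] [Algebra A E'] [Algebra.Etale A E']
        (α' : E' →ₐ[A] SeparableClosure (IsLocalRing.ResidueField A)) (φ : E →ₐ[A] E'),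
        (ι E' α').comp φ = ι E (α'.comp φ)) ∧
    -- every element of `B` comes from some étale algebra
    (∀ b : B, ∃ (E : Type u) (_ : CommRing E) (_ : Algebra A E) (_ : Algebra.Etale A E)
        (α : E →ₐ[A] SeparableClosure (IsLocalRing.ResidueField A)) (x : E), ι E α x = b) ∧
    -- an element that vanishes in `B` already vanishes in some further étale algebra
    (∀ (E : Type u) [CommRing E] [Algebra A E] [Algebra.Etale A E]
        (α : E →ₐ[A] SeparableClosure (IsLocalRing.ResidueField A)) (x : E), ι E α x = 0 →
        ∃ (E' : Type u) (_ : CommRing E') (_ : Algebra A E') (_ : Algebra.Etale A E')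
          (α' : E' →ₐ[A] SeparableClosure (IsLocalRing.ResidueField A)) (φ : E →ₐ[A] E'),
          α'.comp φ = α ∧ φ x = 0)

/-! ### Newton polygons -/

section Newton

variable {O : Type w} [CommRing O]

/-- The Newton polygon of `f` with respect to `ϖ`, that is, the lower convex hull of the points
`(i, ord_ϖ (a_i))`, has a line segment belonging to roots of valuation `k` (the line segment is
said to have slope `k`): some line `y = c - k x` lies on or below all the points and passes through
at least two of them. -/
def HasSlope (ϖ : O) (f : O[X]) (k : ℚ) : Prop :=
  ∃ i j a b : ℕ, i < j ∧ emultiplicity ϖ (f.coeff i) = a ∧ emultiplicity ϖ (f.coeff j) = b ∧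
    (a : ℚ) + k * i = b + k * j ∧
    ∀ l c : ℕ, emultiplicity ϖ (f.coeff l) = c → (a : ℚ) + k * i ≤ c + k * l

/-- A line segment of infinite slope: `0` is a root of `f`. -/
def HasInfiniteSlope (f : O[X]) : Prop := f.coeff 0 = 0

/-- The slopes that may be chosen: the positive ones, and on the first pass also `0`, which belongs
to the roots that are not divisible by `ϖ`. -/
def Admissible (first : Bool) (k : ℚ) : Prop := 0 < k ∨ (first = true ∧ k = 0)

/-- `f₁ = ϖ⁻ᵐ f (ϖᵏ y)`, where `m` is such that `f₁` is primitive with respect to `ϖ`. -/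
def IsRescaling (ϖ : O) (k : ℕ) (f f₁ : O[X]) : Prop :=
  ∃ m : ℕ, C (ϖ ^ m) * f₁ = f.comp (C (ϖ ^ k) * X) ∧ ¬ C ϖ ∣ f₁

end Newton

/-! ### The discrete Newton-Puiseux algorithm

This is the algorithm for a polynomial over a discrete valuation ring `O` with uniformizer `ϖ` and
algebraically closed residue field `k`, over which the polynomial splits (so that no roots of `ϖ`
are adjoined and the irreducible factors over `k` are linear); elements of `k` are lifted through
a ring homomorphism `ι : k → O`. -/

section Discrete

variable {k : Type v} {O : Type w} [Field k] [CommRing O]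

/-- A state of the discrete algorithm: the roots of the original polynomial that are being
approximated are `r + ϖ ^ prec * β`, where `β` is a root of `f`. -/
structure DiscreteState (O : Type w) [CommRing O] where
  first : Bool
  f : O[X]
  prec : ℕ
  r : O

/-- One pass of the discrete algorithm with target height `h`. -/
def DiscreteStep (ι : k →+* O) (ϖ : O) (h : ℕ) (S T : DiscreteState O) : Prop :=
  ∃ (e : ℕ) (f₁ : O[X]) (d : k),
    -- choose a line segment of slope `e`, without reaching the target height
    Admissible S.first e ∧ HasSlope ϖ S.f e ∧ S.prec + e < h ∧
    -- rescale
    IsRescaling ϖ e S.f f₁ ∧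
    -- choose an irreducible factor `y - d` of the reduction of `f₁`
    ϖ ∣ f₁.eval (ι d) ∧
    -- translate over the lift of `d` and update the power series
    T = { first := false
          f := f₁.comp (X + C (ι d))
          prec := S.prec + e
          r := S.r + ι d * ϖ ^ (S.prec + e) }

/-- The algorithm stops for a line segment of infinite slope, or when the precision reaches the
target height. -/
def DiscreteHalts (ϖ : O) (h : ℕ) (S : DiscreteState O) : Prop :=
  HasInfiniteSlope S.f ∨
    ∃ e : ℚ, Admissible S.first e ∧ HasSlope ϖ S.f e ∧ (h : ℚ) ≤ S.prec + e

/-- `r` is one of the approximations, up to height `h`, returned by the discrete algorithm. -/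
def DiscreteOutput (ι : k →+* O) (ϖ : O) (h : ℕ) (f : O[X]) (r : O) : Prop :=
  ∃ S : DiscreteState O,
    Relation.ReflTransGen (DiscreteStep ι ϖ h) ⟨true, f, 0, 0⟩ S ∧ DiscreteHalts ϖ h S ∧ S.r = r

end Discrete

/-! ### Étale lifts -/

/-- Let `A` be a domain, `p` and `m` ideals of `A` with `p` prime, and `gbar` a polynomial over the
residue field of `p`. The polynomial `g` over `A_p` is an `m`-integral étale lift of `gbar`: it
reduces to `gbar`, it has the same degree, it induces a field extension `K(A)[y]/(g)` of the
fraction field `K(A)` of `A`, and the normalization of `A` in this field has a prime `q` over `m`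
at which it is étale over `A` and for which `y mod g` lies in the local ring at `q`. -/
structure IsIntegralEtaleLift {A : Type u} [CommRing A] [IsDomain A] (p m : Ideal A) [p.IsPrime]
    (gbar : p.ResidueField[X]) (g : (Localization.AtPrime p)[X]) : Prop where
  map_eq : g.map (algebraMap (Localization.AtPrime p) p.ResidueField) = gbar
  natDegree_eq : g.natDegree = gbar.natDegree
  irreducible : Irreducible
    (g.map (algebraMap (Localization.AtPrime p) (FractionRing (Localization.AtPrime p))))
  exists_prime :
    ∃ (q : Ideal (integralClosure A (AdjoinRoot
        (g.map (algebraMap (Localization.AtPrime p) (FractionRing (Localization.AtPrime p)))))))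
      (_ : q.IsPrime),
      q.under A = m ∧ Algebra.IsEtaleAt A q ∧
      ∃ a t : integralClosure A (AdjoinRoot
          (g.map (algebraMap (Localization.AtPrime p) (FractionRing (Localization.AtPrime p))))),
        t ∉ q ∧ t.1 * AdjoinRoot.root _ = a.1

/-! ### The mixed Newton-Puiseux algorithm -/

/-- `(rm, rp)` is an `(𝔪, 𝔭)`-adic approximation of height `(hm, hp)` of `α`. -/
def IsApproximation {B : Type v} [CommRing B] (u v : B) (hm hp : ℕ) (α rm rp : B) : Prop :=
  α - rp ∈ Ideal.span {v ^ hp} ∧ α - rm ∈ Ideal.span {u ^ hm, v ^ hp}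

/-- The canonical lifting map: a ring-theoretic section `σ` of the reduction map `B → B/(v)` that
extends the map `k[u] → R[u] → B` coming from a map `ι : k → B` on constants. -/
structure IsLiftingMap {k : Type w} {B : Type v} [Field k] [CommRing B] (u v : B) (ι : k →+* B)
    (σ : B ⧸ Ideal.span {v} →+* B) : Prop where
  mk_apply : ∀ c, Ideal.Quotient.mk (Ideal.span {v}) (σ c) = c
  apply_const : ∀ a, σ (Ideal.Quotient.mk _ (ι a)) = ι a
  apply_u : σ (Ideal.Quotient.mk _ u) = u

section Mixed

variable (A : Type u) {B : Type v} {k : Type w} [CommRing A] [CommRing B] [IsDomain B]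
  [Algebra A B] [Field k]

/-- The field `K(A)(γ : γ ∈ Γ)` inside the fraction field of `B`. -/
noncomputable def adjoinedField (Γ : Set B) : Subfield (FractionRing B) :=
  Subfield.closure (algebraMap B (FractionRing B) '' (Set.range (algebraMap A B) ∪ Γ))

/-- The normalization `A'` of `A` in the field `K(A)(γ : γ ∈ Γ)`, as a subring of the normal
domain `B`. -/
noncomputable def normalizationIn (Γ : Set B) : Subalgebra A B :=
  integralClosure A B ⊓
    { (adjoinedField A Γ).toSubring.comap (algebraMap B (FractionRing B)) with
      algebraMap_mem' := fun a =>
        Subfield.subset_closure (Set.mem_image_of_mem _ (Or.inl ⟨a, rfl⟩)) }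

/-- The prime `𝔭' = A' ∩ (v)` of `A'`. -/
noncomputable def primeP (v : B) (Γ : Set B) : Ideal (normalizationIn A Γ) :=
  (Ideal.span {v}).comap (normalizationIn A Γ).val.toRingHom

/-- The prime `𝔪' = A' ∩ (u, v)` of `A'`. -/
noncomputable def primeM (u v : B) (Γ : Set B) : Ideal (normalizationIn A Γ) :=
  (Ideal.span {u, v}).comap (normalizationIn A Γ).val.toRingHom

instance primeP_isPrime (v : B) [(Ideal.span {v}).IsPrime] (Γ : Set B) :
    (primeP A v Γ).IsPrime := by
  unfold primeP; infer_instance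

instance primeM_isPrime (u v : B) [(Ideal.span {u, v}).IsPrime] (Γ : Set B) :
    (primeM A u v Γ).IsPrime := by
  unfold primeM; infer_instance

/-- The inclusion of local rings `A'_{𝔭'} → B_{(v)}`. -/
noncomputable def localMap (v : B) [(Ideal.span {v}).IsPrime] (Γ : Set B) :
    Localization.AtPrime (primeP A v Γ) →+* Localization.AtPrime (Ideal.span {v}) :=
  Localization.localRingHom (primeP A v Γ) (Ideal.span {v}) (normalizationIn A Γ).val.toRingHom rfl

/-- The inclusion of residue fields `k(𝔭') → k((v))`. -/
noncomputable def residueMap (v : B) [(Ideal.span {v}).IsPrime] (Γ : Set B) :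
    (primeP A v Γ).ResidueField →+* (Ideal.span {v}).ResidueField :=
  Ideal.ResidueField.map (primeP A v Γ) (Ideal.span {v}) (normalizationIn A Γ).val.toRingHom rfl

/-- `gbar` is an irreducible factor, over the residue field of `𝔭'`, of the reduction of `f₁`
(in particular this reduction has its coefficients in that residue field). -/
def IsResidualFactor (v : B) [(Ideal.span {v}).IsPrime] (Γ : Set B) (f₁ : B[X])
    (gbar : (primeP A v Γ).ResidueField[X]) : Prop :=
  ∃ fbar : (primeP A v Γ).ResidueField[X],
    fbar.map (residueMap A v Γ) = f₁.map (algebraMap B (Ideal.span {v}).ResidueField) ∧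
    gbar.Monic ∧ Irreducible gbar ∧ gbar ∣ fbar

/-- `g` is the canonical lift of `gbar`: the polynomial `gbar` has its coefficients in `B/(v)`,
where we write it as `gv`, and `g` is obtained by applying the lifting map `σ` to them. -/
def IsCanonicalLift (v : B) [(Ideal.span {v}).IsPrime] (σ : B ⧸ Ideal.span {v} →+* B) (Γ : Set B)
    (gbar : (primeP A v Γ).ResidueField[X]) (gv : (B ⧸ Ideal.span {v})[X])
    (g : (Localization.AtPrime (primeP A v Γ))[X]) : Prop :=
  gv.map (algebraMap (B ⧸ Ideal.span {v}) (Ideal.span {v}).ResidueField) =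
      gbar.map (residueMap A v Γ) ∧
    g.map (localMap A v Γ) =
      (gv.map σ).map (algebraMap B (Localization.AtPrime (Ideal.span {v})))

/-- A state of the mixed algorithm. Here `adjoined` is the set of roots of lifts that have been
adjoined so far; the roots of the original polynomial that are being approximated are
`rp + v ^ prec * β`, where `β` is a root of `f`. -/
structure MixedState (B : Type v) [CommRing B] where
  first : Bool
  adjoined : Set B
  f : B[X]
  prec : ℕ
  rp : B
  rm : B

/-- The initial state of the mixed algorithm for the polynomial `f`. -/
def MixedState.init (f : B[X]) : MixedState B := ⟨true, ∅, f, 0, 0, 0⟩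

/-- First half of a pass of the mixed algorithm in the state `S`: a line segment of slope `e` of
the Newton polygon with respect to `𝔭` is chosen with which the target height `hp` is not yet
reached, `f₁` is the rescaled polynomial, and `gbar` is a chosen irreducible factor of its
reduction. -/
def MixedChoice (v : B) [(Ideal.span {v}).IsPrime] (hp : ℕ) (S : MixedState B) (e : ℕ)
    (f₁ : B[X]) (gbar : (primeP A v S.adjoined).ResidueField[X]) : Prop :=
  Admissible S.first e ∧ HasSlope v S.f e ∧ S.prec + e < hp ∧ IsRescaling v e S.f f₁ ∧
    IsResidualFactor A v S.adjoined f₁ gbar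

/-- The `u`-adic expansion `r'` up to height `hm` of the root `γ mod v` of `gv`, as
returned by the discrete algorithm over `B/(v)` with uniformizer `u`. -/
def IsResidualExpansion (u v : B) (ι : k →+* B) (hm : ℕ) (gv : (B ⧸ Ideal.span {v})[X]) (γ : B)
    (r' : B ⧸ Ideal.span {v}) : Prop :=
  DiscreteOutput ((Ideal.Quotient.mk (Ideal.span {v})).comp ι)
      (Ideal.Quotient.mk (Ideal.span {v}) u) hm gv r' ∧
    Ideal.Quotient.mk (Ideal.span {v}) γ - r' ∈
      Ideal.span {Ideal.Quotient.mk (Ideal.span {v}) u ^ hm}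

/-- One pass of the mixed algorithm with target heights `(hm, hp)`. -/
def MixedStep (u v : B) [(Ideal.span {v}).IsPrime] (ι : k →+* B)
    (σ : B ⧸ Ideal.span {v} →+* B) (hm hp : ℕ) (S T : MixedState B) : Prop :=
  ∃ (e : ℕ) (f₁ : B[X]) (gbar : (primeP A v S.adjoined).ResidueField[X])
    (gv : (B ⧸ Ideal.span {v})[X]) (g : (Localization.AtPrime (primeP A v S.adjoined))[X])
    (γ : B) (r' : B ⧸ Ideal.span {v}),
    MixedChoice A v hp S e f₁ gbar ∧
    -- lift the factor canonically and adjoin a root `γ` of the lift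
    IsCanonicalLift A v σ S.adjoined gbar gv g ∧
    (g.map (localMap A v S.adjoined)).IsRoot (algebraMap B _ γ) ∧
    -- expand the reduction of `γ` in powers of `u`
    IsResidualExpansion u v ι hm gv γ r' ∧
    -- translate over `γ`, and update the power series
    T = { first := false
          adjoined := insert γ S.adjoined
          f := f₁.comp (X + C γ)
          prec := S.prec + e
          rp := S.rp + γ * v ^ (S.prec + e)
          rm := S.rm + σ r' * v ^ (S.prec + e) }

/-- The state `S` can be reached by the mixed algorithm from the input `f`. -/
def MixedReachable (u v : B) [(Ideal.span {v}).IsPrime] (ι : k →+* B)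
    (σ : B ⧸ Ideal.span {v} →+* B) (hm hp : ℕ) (f : B[X]) (S : MixedState B) : Prop :=
  Relation.ReflTransGen (MixedStep A u v ι σ hm hp) (MixedState.init f) S

/-- The algorithm stops for a line segment of infinite slope, or when the precision reaches the
target height `hp`. -/
def MixedHalts (v : B) (hp : ℕ) (S : MixedState B) : Prop :=
  HasInfiniteSlope S.f ∨
    ∃ e : ℚ, Admissible S.first e ∧ HasSlope v S.f e ∧ (hp : ℚ) ≤ S.prec + e

/-- `(rm, rp)` is one of the pairs returned by the mixed algorithm for the input `f`. -/
def MixedOutput (u v : B) [(Ideal.span {v}).IsPrime] (ι : k →+* B)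
    (σ : B ⧸ Ideal.span {v} →+* B) (hm hp : ℕ) (f : B[X]) (rm rp : B) : Prop :=
  ∃ S, MixedReachable A u v ι σ hm hp f S ∧ MixedHalts v hp S ∧ S.rm = rm ∧ S.rp = rp

/-- The mixed algorithm with input `f` and target heights `(hm, hp)` correctly computes the
`(𝔪, 𝔭)`-adic approximations of the roots of `f` in `B`: it never gets stuck, it terminates, it
returns only approximations of roots, and it returns an approximation of every root. Moreover, all
the lifts that it uses are `𝔪'`-integral étale lifts. -/
structure MixedCorrect (u v : B) [(Ideal.span {v}).IsPrime] [(Ideal.span {u, v}).IsPrime]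
    (ι : k →+* B) (σ : B ⧸ Ideal.span {v} →+* B) (hm hp : ℕ) (f : A[X]) : Prop where
  /-- every pair returned is an approximation of a root -/
  sound : ∀ rm rp, MixedOutput A u v ι σ hm hp (f.map (algebraMap A B)) rm rp →
    ∃ α : B, aeval α f = 0 ∧ IsApproximation u v hm hp α rm rp
  /-- every root has an approximation among the pairs returned -/
  complete : ∀ α : B, aeval α f = 0 →
    ∃ rm rp, MixedOutput A u v ι σ hm hp (f.map (algebraMap A B)) rm rp ∧
      IsApproximation u v hm hp α rm rp
  /-- there is no infinite sequence of passes -/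
  terminates : Acc (fun T S => MixedStep A u v ι σ hm hp S T)
    (MixedState.init (f.map (algebraMap A B)))
  /-- at every point only finitely many continuations are possible -/
  finite_choices : ∀ S, MixedReachable A u v ι σ hm hp (f.map (algebraMap A B)) S →
    {T | MixedStep A u v ι σ hm hp S T}.Finite
  /-- unless `f` is constant, there is always a line segment to choose -/
  exists_slope : ∀ S, MixedReachable A u v ι σ hm hp (f.map (algebraMap A B)) S →
    (S.first = false ∨ 0 < f.natDegree) →
    HasInfiniteSlope S.f ∨ ∃ e : ℚ, Admissible S.first e ∧ HasSlope v S.f e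
  /-- the finite slopes are integral -/
  slope_integral : ∀ S, MixedReachable A u v ι σ hm hp (f.map (algebraMap A B)) S →
    ∀ e : ℚ, Admissible S.first e → HasSlope v S.f e → ∃ n : ℕ, e = n
  /-- after choosing a line segment the polynomial can be rescaled -/
  exists_rescaling : ∀ S, MixedReachable A u v ι σ hm hp (f.map (algebraMap A B)) S →
    ∀ e : ℕ, Admissible S.first e → HasSlope v S.f e → ∃ f₁, IsRescaling v e S.f f₁
  /-- the reduction of the rescaled polynomial has an irreducible factor -/
  exists_factor : ∀ S, MixedReachable A u v ι σ hm hp (f.map (algebraMap A B)) S →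
    ∀ (e : ℕ) (f₁ : B[X]), Admissible S.first e → HasSlope v S.f e → IsRescaling v e S.f f₁ →
      ∃ gbar, IsResidualFactor A v S.adjoined f₁ gbar
  /-- every irreducible factor has a canonical lift -/
  exists_lift : ∀ S, MixedReachable A u v ι σ hm hp (f.map (algebraMap A B)) S →
    ∀ e f₁ gbar, MixedChoice A v hp S e f₁ gbar →
      ∃ gv g, IsCanonicalLift A v σ S.adjoined gbar gv g
  /-- the canonical lift is an `𝔪'`-integral étale lift -/
  etale_lift : ∀ S, MixedReachable A u v ι σ hm hp (f.map (algebraMap A B)) S →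
    ∀ e f₁ gbar, MixedChoice A v hp S e f₁ gbar →
      ∀ gv g, IsCanonicalLift A v σ S.adjoined gbar gv g →
        IsIntegralEtaleLift (primeP A v S.adjoined) (primeM A u v S.adjoined) gbar g
  /-- the canonical lift has a root in `B` -/
  exists_root : ∀ S, MixedReachable A u v ι σ hm hp (f.map (algebraMap A B)) S →
    ∀ e f₁ gbar, MixedChoice A v hp S e f₁ gbar →
      ∀ gv g, IsCanonicalLift A v σ S.adjoined gbar gv g →
        ∃ γ : B, (g.map (localMap A v S.adjoined)).IsRoot (algebraMap B _ γ)
  /-- for every root of the canonical lift, the discrete algorithm finds the `u`-adic expansion -/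
  exists_expansion : ∀ S, MixedReachable A u v ι σ hm hp (f.map (algebraMap A B)) S →
    ∀ e f₁ gbar, MixedChoice A v hp S e f₁ gbar →
      ∀ gv g, IsCanonicalLift A v σ S.adjoined gbar gv g →
        ∀ γ : B, (g.map (localMap A v S.adjoined)).IsRoot (algebraMap B _ γ) →
          ∃ r', IsResidualExpansion u v ι hm gv γ r'
  /-- the ring obtained by adjoining roots is étale over `A` at its prime `𝔪'` over `𝔪` -/
  etale : ∀ S, MixedReachable A u v ι σ hm hp (f.map (algebraMap A B)) S →
    Algebra.IsEtaleAt A (primeM A u v S.adjoined)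

end Mixed

end MixedNP

/-! Two facts carry the proof: everything the algorithm adjoins lives in a copy of the
one-dimensional ring `B/(v)` inside `B`, and the Newton polygon of a product of linear factors can
be read off from the valuations of the roots.

Geometry of `B`. Modulo `v` the node becomes `k[u]`. As a filtered colimit of étale `A`-algebras,
`B` is flat over `A` with maximal ideal `(u, v)`, so `v, u` stays a regular sequence; Krull's
intersection theorem, applied in the étale algebras, makes `B` separated. Hence `v` is prime, `B` is
a normal domain, and `B/(v)` is a discrete valuation ring with uniformizer `u`, algebraic over
`k[u]`. `NodeModel` collects what is needed of this, together with a Hensel property: a simple root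
modulo the maximal ideal of a standard étale pair over `A` comes from a point of `B`, flat over the
étale algebra.

Lifting. In characteristic zero every finite extension of `k(u)` inside the fraction field of
`B/(v)` is generated by some `z` in `B/(v)` that is a simple root modulo `u` of a polynomial over
`k[u]` with leading coefficient prime to `u` (`Uniformized.exists_simple_root`,
`Uniformized.exists_simple_primitive`). Such a polynomial defines a standard étale `A`-algebra, so
`z` lifts to exactly one root in `B`. Therefore the elements of `B` algebraic over `k[u]` map
isomorphically onto `B/(v)`; the inverse is a lifting map, and every lifting map sends `z` to that
root.

Fields. If `Γ = σ(Γ₀)`, then `K(A)(Γ)` is generated by one point of a flat standard étale algebra,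
and flatness shows that each element of `B` in this field is a quotient of two polynomials in the
point whose denominator is a unit of `B` (`exists_aeval_mul_eq_aeval`). So `A'` at `𝔪'` is a
localization of the étale algebra, `k(𝔭')` lies in `k(u)(Γ₀)`, and `σ` carries the coefficients of a
residual factor back into `A'_{𝔭'}`. The lift is irreducible by Gauss's lemma because `A'` is
normal; the same argument with one more root gives the étale prime of the normalization.

Algorithm. The current polynomial is always a product of factors `y - b` and a polynomial that is a
nonzero constant modulo `v` (`NewtonFactored`). Nonnegative slopes are the valuations of the `b`.
Over the fraction field of `B/(v)` a residual factor is a product of factors `y - c mod v` with `v^e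
c` a root of the current polynomial, so the roots of the lift are the elements `γ = σ(c mod v)`, and
`v` divides `c - γ`. Thus following any root `v^e c` never gets stuck, the precision grows from the
second pass on, and `r_𝔭` and `r_𝔪` stay congruent modulo `u^{h_𝔪}`. -/

namespace MixedNP

/-! ### Newton polygons of products of linear factors -/

section NewtonFactored

variable {O : Type*} [CommRing O]

/-- `F` is the product of the linear polynomials `y - b`, for `b` in `s`, and of a polynomial that
is a nonzero constant modulo `ϖ`. -/
def NewtonFactored (ϖ : O) (s : Multiset O) (F : O[X]) : Prop :=
  ∃ (g₀ : O) (H : O[X]), ¬ ϖ ∣ g₀ ∧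
    F = (s.map fun b => X - C b).prod * (C g₀ + C ϖ * H)

/-- The weight of the monomial `a * y ^ l` for the weight `q` of `ϖ` and the weight `p` of `y`. -/
noncomputable def monomialWeight (ϖ : O) (q p l : ℕ) (a : O) : ℕ∞ :=
  q * emultiplicity ϖ a + p * l

/-- The monomials of minimal weight `μ` of `F` have degrees between `i` and `j`, and both bounds
are attained. -/
structure InitialRange (ϖ : O) (q p : ℕ) (F : O[X]) (μ i j : ℕ) : Prop where
  le : i ≤ j
  min_le : ∀ l, (μ : ℕ∞) ≤ monomialWeight ϖ q p l (F.coeff l)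
  left : monomialWeight ϖ q p i (F.coeff i) = μ
  right : monomialWeight ϖ q p j (F.coeff j) = μ
  lt_left : ∀ l < i, (μ : ℕ∞) < monomialWeight ϖ q p l (F.coeff l)
  lt_right : ∀ l, j < l → (μ : ℕ∞) < monomialWeight ϖ q p l (F.coeff l)

theorem monomialWeight_zero (ϖ : O) {q : ℕ} (hq : 0 < q) (p l : ℕ) :
    monomialWeight ϖ q p l 0 = ⊤ := by
  simp [monomialWeight, hq.ne']

theorem monomialWeight_succ (ϖ : O) (q p l : ℕ) (a : O) :
    monomialWeight ϖ q p (l + 1) a = monomialWeight ϖ q p l a + p := by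
  simp [monomialWeight, mul_add, add_assoc]

theorem le_monomialWeight_sub {ϖ : O} {q p l : ℕ} {a b : O} {m : ℕ∞}
    (ha : m ≤ monomialWeight ϖ q p l a) (hb : m ≤ monomialWeight ϖ q p l b) :
    m ≤ monomialWeight ϖ q p l (a - b) := by
  have h := min_le_emultiplicity_add (p := ϖ) (a := a) (b := -b)
  rw [emultiplicity_neg, ← sub_eq_add_neg] at h
  unfold monomialWeight at *
  rcases le_total (emultiplicity ϖ a) (emultiplicity ϖ b) with h' | h'
  · rw [min_eq_left h'] at h
    exact ha.trans (by gcongr)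
  · rw [min_eq_right h'] at h
    exact hb.trans (by gcongr)

theorem lt_monomialWeight_sub {ϖ : O} {q p l : ℕ} {a b : O} {m : ℕ∞}
    (ha : m < monomialWeight ϖ q p l a) (hb : m < monomialWeight ϖ q p l b) :
    m < monomialWeight ϖ q p l (a - b) := by
  have h := Order.add_one_le_of_lt ha
  have h' := Order.add_one_le_of_lt hb
  exact (ENat.lt_add_one_iff (ne_top_of_lt ha)).2 le_rfl |>.trans_le (le_monomialWeight_sub h h')

theorem monomialWeight_sub_of_lt {ϖ : O} {q p l : ℕ} {a b : O}
    (h : monomialWeight ϖ q p l a < monomialWeight ϖ q p l b) :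
    monomialWeight ϖ q p l (a - b) = monomialWeight ϖ q p l a := by
  have : emultiplicity ϖ a < emultiplicity ϖ b := by
    by_contra! h'
    refine absurd h (not_lt.2 ?_)
    unfold monomialWeight
    gcongr
  have h2 : emultiplicity ϖ (a - b) = emultiplicity ϖ a := by
    rw [← neg_sub, emultiplicity_neg, emultiplicity_sub_of_gt this]
  rw [monomialWeight, h2, monomialWeight]

theorem monomialWeight_sub_of_gt {ϖ : O} {q p l : ℕ} {a b : O}
    (h : monomialWeight ϖ q p l b < monomialWeight ϖ q p l a) :
    monomialWeight ϖ q p l (a - b) = monomialWeight ϖ q p l b := by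
  have := monomialWeight_sub_of_lt h
  rw [← this, monomialWeight, monomialWeight, ← neg_sub, emultiplicity_neg]

/-- Multiplied by `q`, a line belonging to the slope `p/q` is a level set of the weight. The segment
of that slope joins the first and the last monomial of minimal weight, and is nondegenerate exactly
when these differ. -/
theorem InitialRange.hasSlope_iff {ϖ : O} {q p : ℕ} (hq : 0 < q) {F : O[X]} {μ i j : ℕ}
    (h : InitialRange ϖ q p F μ i j) : HasSlope ϖ F (p / q : ℚ) ↔ i < j := by
  have hq' : (0 : ℚ) < q := by exact_mod_cast hq
  have fin : ∀ l, monomialWeight ϖ q p l (F.coeff l) = μ →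
      ∃ a : ℕ, emultiplicity ϖ (F.coeff l) = a ∧ q * a + p * l = μ := by
    intro l hl
    rcases eq_or_ne (emultiplicity ϖ (F.coeff l)) ⊤ with ht | ht
    · simp [monomialWeight, ht, hq.ne'] at hl
    · obtain ⟨a, ha⟩ := ENat.ne_top_iff_exists.1 ht
      refine ⟨a, ha.symm, ?_⟩
      rw [monomialWeight, ← ha] at hl
      exact_mod_cast hl
  have low : ∀ l c : ℕ, emultiplicity ϖ (F.coeff l) = c → μ ≤ q * c + p * l := by
    intro l c hc
    have := h.min_le l
    rw [monomialWeight, hc] at this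
    exact_mod_cast this
  have comp : ∀ a b i j : ℕ, ((a : ℚ) + p / q * i ≤ b + p / q * j ↔
      q * a + p * i ≤ q * b + p * j) := by
    intro a b i j
    have h1 : (a : ℚ) + p / q * i = (q * a + p * i : ℕ) / q := by push_cast; field_simp
    have h2 : (b : ℚ) + p / q * j = (q * b + p * j : ℕ) / q := by push_cast; field_simp
    rw [h1, h2, div_le_div_iff_of_pos_right hq']
    exact_mod_cast Iff.rfl
  constructor
  · rintro ⟨i', j', a, b, hij, ha, hb, hab, hmin⟩
    obtain ⟨c, hc, hcμ⟩ := fin i h.left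
    have h1 : q * a + p * i' = μ :=
      le_antisymm (hcμ ▸ (comp _ _ _ _).1 (hmin i c hc)) (low _ _ ha)
    have h2 : q * b + p * j' = μ :=
      le_antisymm (h1 ▸ (comp _ _ _ _).1 hab.ge) (low _ _ hb)
    have h3 : i ≤ i' := by
      by_contra! hlt
      have := h.lt_left i' hlt
      rw [monomialWeight, ha] at this
      have : μ < q * a + p * i' := by exact_mod_cast this
      omega
    have h4 : j' ≤ j := by
      by_contra! hlt
      have := h.lt_right j' hlt
      rw [monomialWeight, hb] at this
      have : μ < q * b + p * j' := by exact_mod_cast this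
      omega
    omega
  · intro hij
    obtain ⟨a, ha, haμ⟩ := fin i h.left
    obtain ⟨b, hb, hbμ⟩ := fin j h.right
    refine ⟨i, j, a, b, hij, ha, hb, le_antisymm ((comp _ _ _ _).2 (by omega))
      ((comp _ _ _ _).2 (by omega)), fun l c hc => (comp _ _ _ _).2 ?_⟩
    have := low l c hc
    omega

/-- A linear factor whose root has too small a valuation becomes, after rescaling, a factor of this
kind; it is absorbed into the part that is constant modulo `ϖ`. -/
theorem NewtonFactored.mul_unit_residue {ϖ : O} (hϖ : Prime ϖ) {s : Multiset O} {F : O[X]}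
    (h : NewtonFactored ϖ s F) {b : O} (hb : ¬ ϖ ∣ b) (H' : O[X]) :
    NewtonFactored ϖ s ((C ϖ * H' - C b) * F) := by
  obtain ⟨g₀, H, hg, rfl⟩ := h
  refine ⟨-(b * g₀), H' * (C g₀ + C ϖ * H) - C b * H, ?_, ?_⟩
  · rw [dvd_neg]
    exact fun h => (hϖ.dvd_or_dvd h).elim hb hg
  · simp only [C_neg, C_mul]
    ring

theorem NewtonFactored.mul_X_sub_C {ϖ : O} {s : Multiset O} {F : O[X]}
    (h : NewtonFactored ϖ s F) (b : O) : NewtonFactored ϖ (b ::ₘ s) ((X - C b) * F) := by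
  obtain ⟨g₀, H, hg, rfl⟩ := h
  exact ⟨g₀, H, hg, by simp [mul_assoc]⟩

/-- All coefficients but the constant one are divisible by `ϖ`, so they weigh at least `q > 0`. This
works even for `p = 0`, when powers of `y` weigh nothing. -/
theorem initialRange_of_unit_residue {ϖ : O} {q p : ℕ} (hq : 0 < q) {g₀ : O} (H : O[X])
    (hg : ¬ ϖ ∣ g₀) : InitialRange ϖ q p (C g₀ + C ϖ * H) 0 0 0 := by
  have h0 : monomialWeight ϖ q p 0 ((C g₀ + C ϖ * H).coeff 0) = 0 := by
    have : ¬ ϖ ∣ g₀ + ϖ * H.coeff 0 := fun h => hg ((dvd_add_left (dvd_mul_right _ _)).1 h)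
    simp [monomialWeight, emultiplicity_eq_zero.2 this]
  refine ⟨le_rfl, by simp, by simpa using h0, by simpa using h0, by simp, ?_⟩
  intro l hl
  have : ϖ ∣ (C g₀ + C ϖ * H).coeff l := by
    simp [coeff_C, hl.ne']
  have h1 : (1 : ℕ∞) ≤ emultiplicity ϖ ((C g₀ + C ϖ * H).coeff l) := by
    exact_mod_cast le_emultiplicity_of_pow_dvd (k := 1) (by rwa [pow_one])
  unfold monomialWeight
  calc ((0 : ℕ) : ℕ∞) < (q : ℕ∞) * 1 := by simpa using hq
    _ ≤ q * emultiplicity ϖ ((C g₀ + C ϖ * H).coeff l) := by gcongr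
    _ ≤ _ := le_self_add

/-- Gauss's lemma: `C ϖ` is prime and divides none of the factors. This is the primitivity demanded
of a rescaled polynomial. -/
theorem NewtonFactored.not_dvd {ϖ : O} (hϖ : Prime ϖ) {s : Multiset O} {F : O[X]}
    (h : NewtonFactored ϖ s F) : ¬ C ϖ ∣ F := by
  obtain ⟨g₀, H, hg, rfl⟩ := h
  have hp : Prime (C ϖ) := prime_C_iff.2 hϖ
  intro hd
  rcases hp.dvd_or_dvd hd with h1 | h1
  · obtain ⟨c, -, h2⟩ := hp.exists_mem_multiset_map_dvd h1
    rw [C_dvd_iff_dvd_coeff] at h2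
    have := h2 1
    simp at this
    exact hϖ.not_isUnit (isUnit_of_dvd_one this)
  · have := (dvd_add_left (dvd_mul_right _ _)).1 h1
    rw [C_dvd_iff_dvd_coeff] at this
    exact hg (by simpa using this 0)

section Domain

variable [IsDomain O] {ϖ : O}

theorem monomialWeight_mul (hϖ : Prime ϖ) (q p l : ℕ) (a b : O) :
    monomialWeight ϖ q p l (a * b) = monomialWeight ϖ q p l a + q * emultiplicity ϖ b := by
  rw [monomialWeight, monomialWeight, emultiplicity_mul hϖ, mul_add]
  abel

/-- A coefficient of the product is `F_l - b F_{l+1}`. The first term shifts weights by `p`, the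
second by `q · ord b`, and the smaller shift wins. Only in a tie do both contribute, and then the
range gets longer by one. -/
theorem InitialRange.mul_X_sub_C (hϖ : Prime ϖ) {q p : ℕ} (hq : 0 < q) {F : O[X]} {μ i j : ℕ}
    (h : InitialRange ϖ q p F μ i j) (b : O) :
    ∃ μ' i' j', InitialRange ϖ q p (F * (X - C b)) μ' i' j' ∧
      (i' < j' ↔ i < j ∨ (q : ℕ∞) * emultiplicity ϖ b = p) := by
  have hz : (F * (X - C b)).coeff 0 = 0 - F.coeff 0 * b := by simp [mul_coeff_zero]
  have hs : ∀ l, (F * (X - C b)).coeff (l + 1) = F.coeff l - F.coeff (l + 1) * b := fun l =>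
    coeff_mul_X_sub_C
  have hm := monomialWeight_mul hϖ q p
  have hsucc := monomialWeight_succ ϖ q p
  have h0 := monomialWeight_zero ϖ hq p
  have hadd : ∀ {x y : ℕ∞} (n : ℕ), x < y → x + n < y + n := fun n hxy =>
    (ENat.add_lt_add_iff_right (ENat.natCast_ne_top n)).2 hxy
  rcases lt_trichotomy ((q : ℕ∞) * emultiplicity ϖ b) p with hlt | heq | hgt
  · obtain ⟨β, hβ⟩ := ENat.ne_top_iff_exists.1 (ne_top_of_lt hlt)
    have hβp : (β : ℕ∞) < p := hβ ▸ hlt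
    have hμ : (μ : ℕ∞) + β < μ + p := by
      have : β < p := by exact_mod_cast hβp
      exact_mod_cast Nat.add_lt_add_left this μ
    -- the second term dominates
    have key : ∀ l, monomialWeight ϖ q p l (F.coeff l) = μ →
        monomialWeight ϖ q p l ((F * (X - C b)).coeff l) = (μ + β : ℕ) := by
      intro l hl
      have h2 : monomialWeight ϖ q p l (F.coeff l * b) = (μ + β : ℕ) := by
        rw [hm, hl, ← hβ]; push_cast; rfl
      rw [← h2]
      cases l with
      | zero =>
        rw [hz]
        exact monomialWeight_sub_of_gt (by rw [h0, h2]; exact ENat.natCast_lt_top _)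
      | succ l =>
        rw [hs]
        refine monomialWeight_sub_of_gt ?_
        rw [h2, hsucc]
        push_cast
        exact hμ.trans_le (by gcongr; exact h.min_le l)
    refine ⟨μ + β, i, j, ⟨h.le, ?_, key i h.left, key j h.right, ?_, ?_⟩, ?_⟩
    · intro l
      cases l with
      | zero =>
        rw [hz]
        refine le_monomialWeight_sub (by rw [h0]; exact le_top) ?_
        rw [hm, ← hβ]; push_cast; gcongr; exact h.min_le _
      | succ l =>
        rw [hs]
        refine le_monomialWeight_sub ?_ ?_
        · rw [hsucc]; push_cast; exact hμ.le.trans (by gcongr; exact h.min_le _)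
        · rw [hm, ← hβ]; push_cast; gcongr; exact h.min_le _
    · intro l hl
      cases l with
      | zero =>
        rw [hz]
        refine lt_monomialWeight_sub (by rw [h0]; exact ENat.natCast_lt_top _) ?_
        rw [hm, ← hβ]; push_cast; exact hadd _ (h.lt_left _ hl)
      | succ l =>
        rw [hs]
        refine lt_monomialWeight_sub ?_ ?_
        · rw [hsucc]; push_cast; exact hμ.trans_le (by gcongr; exact h.min_le _)
        · rw [hm, ← hβ]; push_cast; exact hadd _ (h.lt_left _ hl)
    · intro l hl
      cases l with
      | zero => omega
      | succ l =>
        rw [hs]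
        refine lt_monomialWeight_sub ?_ ?_
        · rw [hsucc]; push_cast; exact hμ.trans_le (by gcongr; exact h.min_le _)
        · rw [hm, ← hβ]; push_cast; exact hadd _ (h.lt_right _ hl)
    · simp [hlt.ne]
  -- In a tie the middle coefficients may cancel, but the two ends cannot: at `i` only `b F_i` has
  -- minimal weight, and at `j + 1` only `F_j`.
  · have hge : ∀ l, ((μ + p : ℕ) : ℕ∞) ≤ monomialWeight ϖ q p l (F.coeff l * b) := fun l => by
      rw [hm, heq]; push_cast; gcongr; exact h.min_le _
    have hge' : ∀ l, ((μ + p : ℕ) : ℕ∞) ≤ monomialWeight ϖ q p (l + 1) (F.coeff l) := fun l => by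
      rw [hsucc]; push_cast; gcongr; exact h.min_le _
    refine ⟨μ + p, i, j + 1, ⟨by have := h.le; omega, ?_, ?_, ?_, ?_, ?_⟩, ?_⟩
    · intro l
      cases l with
      | zero => rw [hz]; exact le_monomialWeight_sub (by rw [h0]; exact le_top) (hge _)
      | succ l => rw [hs]; exact le_monomialWeight_sub (hge' _) (hge _)
    · have h2 : monomialWeight ϖ q p i (F.coeff i * b) = (μ + p : ℕ) := by
        rw [hm, h.left, heq]; push_cast; rfl
      have hi := h.lt_left
      rw [← h2]
      cases i with
      | zero =>
        rw [hz]
        exact monomialWeight_sub_of_gt (by rw [h0, h2]; exact ENat.natCast_lt_top _)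
      | succ i =>
        rw [hs]
        refine monomialWeight_sub_of_gt ?_
        rw [h2, hsucc]
        push_cast
        exact hadd _ (hi i (by omega))
    · have h2 : monomialWeight ϖ q p (j + 1) (F.coeff j) = (μ + p : ℕ) := by
        rw [hsucc, h.right]; push_cast; rfl
      rw [← h2, hs]
      refine monomialWeight_sub_of_lt ?_
      rw [h2, hm, heq]
      push_cast
      exact hadd _ (h.lt_right _ (by omega))
    · intro l hl
      have h2 : ((μ + p : ℕ) : ℕ∞) < monomialWeight ϖ q p l (F.coeff l * b) := by
        rw [hm, heq]; push_cast; exact hadd _ (h.lt_left _ hl)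
      cases l with
      | zero =>
        rw [hz]
        exact lt_monomialWeight_sub (by rw [h0]; exact ENat.natCast_lt_top _) h2
      | succ l =>
        rw [hs]
        refine lt_monomialWeight_sub ?_ h2
        rw [hsucc]; push_cast; exact hadd _ (h.lt_left _ (by omega))
    · intro l hl
      cases l with
      | zero => omega
      | succ l =>
        rw [hs]
        refine lt_monomialWeight_sub ?_ ?_
        · rw [hsucc]; push_cast; exact hadd _ (h.lt_right _ (by omega))
        · rw [hm, heq]; push_cast; exact hadd _ (h.lt_right _ (by omega))
    · have := h.le
      simp [heq]; omega
  · have hgt' : ∀ l, ((μ + p : ℕ) : ℕ∞) < monomialWeight ϖ q p l (F.coeff l * b) := fun l => by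
      rw [hm]; push_cast
      calc (μ : ℕ∞) + p < μ + q * emultiplicity ϖ b :=
            (ENat.add_lt_add_iff_left (ENat.natCast_ne_top μ)).2 hgt
        _ ≤ _ := by gcongr; exact h.min_le _
    have key : ∀ l, monomialWeight ϖ q p l (F.coeff l) = μ →
        monomialWeight ϖ q p (l + 1) ((F * (X - C b)).coeff (l + 1)) = (μ + p : ℕ) := by
      intro l hl
      have h2 : monomialWeight ϖ q p (l + 1) (F.coeff l) = (μ + p : ℕ) := by
        rw [hsucc, hl]; push_cast; rfl
      rw [← h2, hs]
      exact monomialWeight_sub_of_lt (by rw [h2]; exact hgt' _)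
    refine ⟨μ + p, i + 1, j + 1, ⟨by have := h.le; omega, ?_, key i h.left, key j h.right, ?_, ?_⟩,
      ?_⟩
    · intro l
      cases l with
      | zero => rw [hz]; exact le_monomialWeight_sub (by rw [h0]; exact le_top) (hgt' _).le
      | succ l =>
        rw [hs]
        refine le_monomialWeight_sub ?_ (hgt' _).le
        rw [hsucc]; push_cast; gcongr; exact h.min_le _
    · intro l hl
      cases l with
      | zero =>
        rw [hz]
        exact lt_monomialWeight_sub (by rw [h0]; exact ENat.natCast_lt_top _) (hgt' _)
      | succ l =>
        rw [hs]
        refine lt_monomialWeight_sub ?_ (hgt' _)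
        rw [hsucc]; push_cast; exact hadd _ (h.lt_left _ (by omega))
    · intro l hl
      cases l with
      | zero => omega
      | succ l =>
        rw [hs]
        refine lt_monomialWeight_sub ?_ (hgt' _)
        rw [hsucc]; push_cast; exact hadd _ (h.lt_right _ (by omega))
    · simp [hgt.ne']

theorem NewtonFactored.exists_initialRange (hϖ : Prime ϖ) {q p : ℕ} (hq : 0 < q)
    {s : Multiset O} {F : O[X]} (h : NewtonFactored ϖ s F) :
    ∃ μ i j, InitialRange ϖ q p F μ i j ∧
      (i < j ↔ ∃ b ∈ s, (q : ℕ∞) * emultiplicity ϖ b = p) := by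
  obtain ⟨g₀, H, hg, rfl⟩ := h
  induction s using Multiset.induction_on with
  | empty => exact ⟨0, 0, 0, by simpa using initialRange_of_unit_residue hq H hg, by simp⟩
  | cons b s ih =>
    obtain ⟨μ, i, j, h, hij⟩ := ih
    obtain ⟨μ', i', j', h', hij'⟩ := h.mul_X_sub_C hϖ hq b
    refine ⟨μ', i', j', ?_, ?_⟩
    · convert h' using 1
      simp only [Multiset.map_cons, Multiset.prod_cons]
      ring
    · rw [hij', hij]
      simp [or_comm]

/-- The slopes `k ≥ 0` of the Newton polygon are the valuations of the roots. -/
theorem NewtonFactored.hasSlope_iff (hϖ : Prime ϖ) {s : Multiset O} {F : O[X]}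
    (h : NewtonFactored ϖ s F) {k : ℚ} (hk : 0 ≤ k) :
    HasSlope ϖ F k ↔ ∃ b ∈ s, ∃ n : ℕ, emultiplicity ϖ b = n ∧ k = n := by
  obtain ⟨p, hp⟩ : ∃ p : ℕ, k.num = p := Int.eq_ofNat_of_zero_le (Rat.num_nonneg.2 hk)
  have hkq : k = (p : ℚ) / (k.den : ℕ) := by
    conv_lhs => rw [← Rat.num_div_den k, hp]
    simp
  obtain ⟨μ, i, j, hr, hij⟩ := h.exists_initialRange hϖ (p := p) k.den_pos
  have h1 : HasSlope ϖ F k ↔ i < j := by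
    conv_lhs => rw [hkq]
    exact hr.hasSlope_iff k.den_pos
  rw [h1, hij]
  have hden : (k.den : ℚ) ≠ 0 := by exact_mod_cast k.den_nz
  refine exists_congr fun b => and_congr_right fun hb => ⟨fun h => ?_, ?_⟩
  · rcases eq_or_ne (emultiplicity ϖ b) ⊤ with ht | ht
    · simp [ht] at h
    · obtain ⟨n, hn⟩ := ENat.ne_top_iff_exists.1 ht
      refine ⟨n, hn.symm, ?_⟩
      rw [← hn] at h
      have : k.den * n = p := by exact_mod_cast h
      rw [hkq, ← this]
      push_cast
      field_simp
  · rintro ⟨n, hn, hkn⟩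
    rw [hn]
    have : (k.den : ℚ) * n = p := by
      rw [← hkn, mul_comm]
      exact (eq_div_iff hden).1 hkq
    exact_mod_cast this

/-- Primitivity pins down the exponent `m`. Uniqueness allows any rescaling chosen by the algorithm
to be replaced by the explicit one. -/
theorem IsRescaling.unique (hϖ : Prime ϖ) {e : ℕ} {F f₁ f₂ : O[X]} (h₁ : IsRescaling ϖ e F f₁)
    (h₂ : IsRescaling ϖ e F f₂) : f₁ = f₂ := by
  obtain ⟨m, hm, hd⟩ := h₁
  obtain ⟨n, hn, hd'⟩ := h₂
  wlog hmn : m ≤ n generalizing m n f₁ f₂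
  · exact (this n hn hd' m hm hd (le_of_not_ge hmn)).symm
  obtain ⟨r, rfl⟩ := Nat.exists_eq_add_of_le hmn
  have h0 : C (ϖ ^ m) ≠ 0 := by simpa using pow_ne_zero _ hϖ.ne_zero
  have : f₁ = C (ϖ ^ r) * f₂ := by
    apply mul_left_cancel₀ h0
    rw [hm, ← hn, pow_add, C_mul, mul_assoc]
  cases r with
  | zero => simpa using this
  | succ r =>
    refine absurd ?_ hd
    rw [this, pow_succ', C_mul, mul_assoc]
    exact dvd_mul_right _ _

/-- The factor `y - b` turns into `ϖ^e y - b`. If `ϖ^e` divides `b`, then `ϖ^e` comes out and a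
linear factor remains. Otherwise only `ϖ^j` with `j = ord b < e` comes out, and what remains is a
nonzero constant modulo `ϖ`. -/
theorem NewtonFactored.exists_rescaling (hϖ : Prime ϖ) {s : Multiset O} {F : O[X]}
    (h : NewtonFactored ϖ s F) (e : ℕ) :
    ∃ f₁ s₁, IsRescaling ϖ e F f₁ ∧ NewtonFactored ϖ s₁ f₁ ∧ ∀ c, c ∈ s₁ ↔ ϖ ^ e * c ∈ s := by
  suffices ∃ (m : ℕ) (f₁ : O[X]) (s₁ : Multiset O),
      C (ϖ ^ m) * f₁ = F.comp (C (ϖ ^ e) * X) ∧ NewtonFactored ϖ s₁ f₁ ∧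
      ∀ c, c ∈ s₁ ↔ ϖ ^ e * c ∈ s by
    obtain ⟨m, f₁, s₁, h1, h2, h3⟩ := this
    exact ⟨f₁, s₁, ⟨m, h1, h2.not_dvd hϖ⟩, h2, h3⟩
  obtain ⟨g₀, H, hg, rfl⟩ := h
  induction s using Multiset.induction_on with
  | empty =>
    exact ⟨0, _, 0, by simp, ⟨g₀, H.comp (C (ϖ ^ e) * X), hg, rfl⟩, by simp⟩
  | cons b s ih =>
    obtain ⟨m, f₁, s₁, h1, h2, h3⟩ := ih
    have hpe : ϖ ^ e ≠ 0 := pow_ne_zero _ hϖ.ne_zero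
    by_cases hb : ϖ ^ e ∣ b
    · obtain ⟨c, rfl⟩ := hb
      refine ⟨m + e, (X - C c) * f₁, c ::ₘ s₁, ?_, h2.mul_X_sub_C c, fun d => ?_⟩
      · simp only [Multiset.map_cons, Multiset.prod_cons, mul_assoc, mul_comp] at h1 ⊢
        rw [← h1]
        rw [sub_comp, X_comp, C_comp, pow_add, C_mul, C_mul]
        ring
      · simp [h3, mul_right_inj' hpe]
    · have hfin : FiniteMultiplicity ϖ b := ⟨e, fun h => hb ((pow_dvd_pow _ e.le_succ).trans h)⟩
      obtain ⟨b', hb', hnd⟩ := hfin.exists_eq_pow_mul_and_not_dvd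
      set j := multiplicity ϖ b with hj
      have hje : j < e := by
        by_contra! hle
        exact hb (hb' ▸ (pow_dvd_pow ϖ hle).mul_right _)
      -- Here `e = j + r + 1`, so that one factor `ϖ` stays visible in front of `ϖ^r y`.
      obtain ⟨r, hr⟩ := Nat.exists_eq_add_of_lt hje
      refine ⟨m + j, (C ϖ * (C (ϖ ^ r) * X) - C b') * f₁, s₁, ?_,
        h2.mul_unit_residue hϖ hnd _, fun d => ?_⟩
      · simp only [Multiset.map_cons, Multiset.prod_cons, mul_assoc, mul_comp] at h1 ⊢
        rw [← h1]
        rw [sub_comp, X_comp, C_comp, hb', hr]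
        simp only [pow_add, C_mul, pow_one]
        ring
      · rw [h3, Multiset.mem_cons, or_iff_right]
        rintro rfl
        exact hb (dvd_mul_right _ _)

theorem NewtonFactored.of_isRescaling (hϖ : Prime ϖ) {s : Multiset O} {F f₁ : O[X]}
    (h : NewtonFactored ϖ s F) {e : ℕ} (hr : IsRescaling ϖ e F f₁) :
    ∃ s₁, NewtonFactored ϖ s₁ f₁ ∧ ∀ c, c ∈ s₁ ↔ ϖ ^ e * c ∈ s := by
  obtain ⟨f₂, s₁, h1, h2, h3⟩ := h.exists_rescaling hϖ e
  obtain rfl := hr.unique hϖ h1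
  exact ⟨s₁, h2, h3⟩

end Domain

theorem NewtonFactored.translate {ϖ : O} {s : Multiset O} {F : O[X]} (h : NewtonFactored ϖ s F)
    (γ : O) : NewtonFactored ϖ (s.map fun b => b - γ) (F.comp (X + C γ)) := by
  obtain ⟨g₀, H, hg, rfl⟩ := h
  refine ⟨g₀, H.comp (X + C γ), hg, ?_⟩
  simp only [mul_comp, add_comp, C_comp, multiset_prod_comp, Multiset.map_map]
  congr 3
  funext b
  simp
  ring

theorem NewtonFactored.eval_eq_zero {ϖ : O} {s : Multiset O} {F : O[X]}
    (h : NewtonFactored ϖ s F) {b : O} (hb : b ∈ s) : F.eval b = 0 := by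
  obtain ⟨g₀, H, hg, rfl⟩ := h
  obtain ⟨t, rfl⟩ := Multiset.exists_cons_of_mem hb
  simp

/-- The remaining factor has no zeros: its values are congruent to `g₀` modulo `ϖ`. -/
theorem NewtonFactored.mem_of_eval_eq_zero [IsDomain O] {ϖ : O} {s : Multiset O} {F : O[X]}
    (h : NewtonFactored ϖ s F) {b : O} (hb : F.eval b = 0) : b ∈ s := by
  obtain ⟨g₀, H, hg, rfl⟩ := h
  rw [eval_mul, mul_eq_zero] at hb
  rcases hb with hb | hb
  · rw [eval_multiset_prod, Multiset.prod_eq_zero_iff] at hb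
    simp only [Multiset.map_map, Multiset.mem_map, Function.comp] at hb
    obtain ⟨c, hc, h0⟩ := hb
    simp [sub_eq_zero] at h0
    exact h0 ▸ hc
  · refine absurd ⟨-H.eval b, ?_⟩ hg
    simp at hb
    linear_combination hb

end NewtonFactored

end MixedNP

namespace MixedNP

/-! ### The discrete algorithm: uniqueness and existence of expansions -/

section Discrete

variable {k O : Type*} [Field k] [CommRing O]

/-- Nonzero constants become units, so the lowest term of `p` decides the order of its value at `ϖ`.
-/
theorem pow_dvd_of_pow_dvd_eval₂ [IsDomain O] {ι : k →+* O} {ϖ : O} (hϖ : Prime ϖ) {n : ℕ}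
    {p : k[X]} (h : ϖ ^ n ∣ p.eval₂ ι ϖ) : X ^ n ∣ p := by
  induction n generalizing p with
  | zero => simp
  | succ n ih =>
    obtain ⟨q, rfl⟩ := ih ((pow_dvd_pow _ n.le_succ).trans h)
    rw [eval₂_mul, eval₂_X_pow, pow_succ] at h
    have h1 := (mul_dvd_mul_iff_left (pow_ne_zero n hϖ.ne_zero)).1 h
    rw [pow_succ]
    refine mul_dvd_mul_left _ ?_
    rw [X_dvd_iff]
    by_contra h0
    rw [← divX_mul_X_add q, eval₂_add, eval₂_mul, eval₂_X, eval₂_C,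
      dvd_add_right (dvd_mul_left _ _)] at h1
    exact hϖ.not_isUnit (isUnit_of_dvd_unit h1 ((isUnit_iff_ne_zero.2 h0).map ι))

theorem eval₂_injective_of_prime [IsDomain O] {ι : k →+* O} {ϖ : O} (hϖ : Prime ϖ) :
    Function.Injective (eval₂RingHom ι ϖ) := by
  rw [injective_iff_map_eq_zero]
  intro p hp
  have : X ^ (p.natDegree + 1) ∣ p :=
    pow_dvd_of_pow_dvd_eval₂ hϖ (by rw [← coe_eval₂RingHom, hp]; exact dvd_zero _)
  by_contra h0
  have := natDegree_le_of_dvd this h0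
  simp at this

theorem DiscreteOutput.exists_polynomial {ι : k →+* O} {ϖ : O} {h : ℕ} {f : O[X]} {r : O}
    (hr : DiscreteOutput ι ϖ h f r) : ∃ p : k[X], p.degree < h ∧ r = p.eval₂ ι ϖ := by
  obtain ⟨S, hS, -, rfl⟩ := hr
  induction hS with
  | refl => exact ⟨0, by simp, by simp⟩
  | @tail T _ _ hstep ih =>
    obtain ⟨p, hp, hr⟩ := ih
    obtain ⟨e, f₁, d, -, -, hlt, -, -, rfl⟩ := hstep
    refine ⟨p + C d * X ^ (T.prec + e), (degree_add_le _ _).trans_lt (max_lt hp ?_), ?_⟩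
    · exact (degree_C_mul_X_pow_le _ _).trans_lt (by exact_mod_cast hlt)
    · simp [hr]

/-- Outputs are polynomials in `ϖ` of degree less than `h` over the coefficient field, hence
determined modulo `ϖ^h`. This makes the number of choices in a mixed pass finite. -/
theorem DiscreteOutput.eq_of_pow_dvd_sub [IsDomain O] {ι : k →+* O} {ϖ : O} (hϖ : Prime ϖ) {h : ℕ}
    {f f' : O[X]} {r r' : O} (hr : DiscreteOutput ι ϖ h f r) (hr' : DiscreteOutput ι ϖ h f' r')
    (hd : ϖ ^ h ∣ r - r') : r = r' := by
  obtain ⟨p, hp, rfl⟩ := hr.exists_polynomial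
  obtain ⟨q, hq, rfl⟩ := hr'.exists_polynomial
  rw [← eval₂_sub] at hd
  have h0 : p - q = 0 := by
    refine eq_zero_of_dvd_of_degree_lt (pow_dvd_of_pow_dvd_eval₂ hϖ hd) ?_
    rw [degree_X_pow]
    exact (degree_sub_le _ _).trans_lt (max_lt hp hq)
  rw [sub_eq_zero.1 h0]

theorem admissible_of_dvd {ϖ : O} {first : Bool} {b : O} {n : ℕ} (hn : emultiplicity ϖ b = n)
    (h : first = false → ϖ ∣ b) : Admissible first (n : ℚ) := by
  rcases Nat.eq_zero_or_pos n with rfl | hpos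
  · cases first with
    | true => exact Or.inr ⟨rfl, by simp⟩
    | false => exact absurd (h rfl) (emultiplicity_eq_zero.1 (by simpa using hn))
  · exact Or.inl (by exact_mod_cast hpos)

/-- One root `β` is followed: its valuation is the slope to choose, the residue of its unit part is
the factor to choose, and the remaining root is divisible by `ϖ`, hence admissible in the next pass.
-/
theorem exists_discreteHalts [IsDomain O] {ι : k →+* O} {ϖ : O} (hϖ : Prime ϖ)
    (hfin : ∀ b : O, b ≠ 0 → FiniteMultiplicity ϖ b) (hres : ∀ b, ∃ c, ϖ ∣ b - ι c) (h : ℕ)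
    (S : DiscreteState O) {s : Multiset O} (hs : NewtonFactored ϖ s S.f) {β : O} (hβ : β ∈ s)
    (hβ' : S.first = false → ϖ ∣ β) :
    ∃ T, Relation.ReflTransGen (DiscreteStep ι ϖ h) S T ∧ DiscreteHalts ϖ h T ∧
      ϖ ^ h ∣ S.r + ϖ ^ S.prec * β - T.r := by
  -- The first pass may have slope `0` and leave the precision unchanged; the flag `first` pays for
  -- that pass.
  induction hn : S.first.toNat + (h - S.prec) using Nat.strong_induction_on
    generalizing S s β with
  | _ n ih =>
  subst hn
  rcases eq_or_ne β 0 with rfl | h0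
  · refine ⟨S, .refl, .inl ?_, by simp⟩
    have := hs.eval_eq_zero hβ
    rwa [HasInfiniteSlope, coeff_zero_eq_eval_zero]
  obtain ⟨β₁, hβ₁, hnd⟩ := (hfin β h0).exists_eq_pow_mul_and_not_dvd
  have hm : emultiplicity ϖ β = (multiplicity ϖ β : ℕ) := (hfin β h0).emultiplicity_eq_multiplicity
  set e := multiplicity ϖ β with he
  have hadm : Admissible S.first (e : ℚ) := admissible_of_dvd hm hβ'
  have hslope : HasSlope ϖ S.f e :=
    (hs.hasSlope_iff hϖ (by positivity)).2 ⟨β, hβ, e, hm, rfl⟩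
  by_cases hlt : S.prec + e < h
  · obtain ⟨f₁, s₁, hr, hs₁, hmem⟩ := hs.exists_rescaling hϖ e
    obtain ⟨d, hd⟩ := hres β₁
    have hβ₁s : β₁ ∈ s₁ := (hmem _).2 (hβ₁ ▸ hβ)
    let T : DiscreteState O :=
      { first := false
        f := f₁.comp (X + C (ι d))
        prec := S.prec + e
        r := S.r + ι d * ϖ ^ (S.prec + e) }
    have hstep : DiscreteStep ι ϖ h S T := by
      refine ⟨e, f₁, d, hadm, hslope, hlt, hr, ?_, rfl⟩
      have := (hd.trans (sub_dvd_eval_sub β₁ (ι d) f₁))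
      rwa [hs₁.eval_eq_zero hβ₁s, zero_sub, dvd_neg] at this
    have hmeas : T.first.toNat + (h - T.prec) < S.first.toNat + (h - S.prec) := by
      rcases hadm with hpos | ⟨hf, -⟩
      · have hpos' : 0 < e := by exact_mod_cast hpos
        have : S.prec + e < h := hlt
        simp only [T, Bool.toNat_false]
        omega
      · simp only [T, hf, Bool.toNat_false, Bool.toNat_true]
        omega
    obtain ⟨U, hU, hhalt, hdvd⟩ := ih _ hmeas T (hs₁.translate (ι d))
      (Multiset.mem_map_of_mem _ hβ₁s) (fun _ => hd) rfl
    refine ⟨U, .head hstep hU, hhalt, ?_⟩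
    convert hdvd using 1
    simp only [T, pow_add]
    conv_lhs => rw [hβ₁]
    ring
  · refine ⟨S, .refl, .inr ⟨e, hadm, hslope, by exact_mod_cast not_lt.1 hlt⟩, ?_⟩
    rw [add_sub_cancel_left, hβ₁, ← mul_assoc, ← pow_add]
    exact (pow_dvd_pow _ (not_lt.1 hlt)).mul_right _

theorem exists_discreteOutput [IsDomain O] {ι : k →+* O} {ϖ : O} (hϖ : Prime ϖ)
    (hfin : ∀ b : O, b ≠ 0 → FiniteMultiplicity ϖ b) (hres : ∀ b, ∃ c, ϖ ∣ b - ι c) (h : ℕ)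
    {f : O[X]} {s : Multiset O} (hs : NewtonFactored ϖ s f) {β : O} (hβ : β ∈ s) :
    ∃ r, DiscreteOutput ι ϖ h f r ∧ ϖ ^ h ∣ β - r := by
  obtain ⟨T, h1, h2, h3⟩ :=
    exists_discreteHalts hϖ hfin hres h ⟨true, f, 0, 0⟩ hs hβ (by simp)
  exact ⟨T.r, ⟨T, h1, h2, rfl⟩, by simpa using h3⟩

end Discrete

end MixedNP

namespace MixedNP

/-! ### Algebraic elements as simple roots -/

section Uniformized

variable {k O : Type*} [Field k] [CommRing O]

/-- The ring `O` behaves like a discrete valuation ring with uniformizer `φ X`, residue field `k`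
and all elements algebraic over `k[X]`. -/
structure Uniformized (φ : k[X] →+* O) : Prop where
  prime : Prime (φ X)
  finiteMultiplicity : ∀ b, b ≠ 0 → FiniteMultiplicity (φ X) b
  residue : ∀ b, ∃ c, φ X ∣ b - φ (C c)
  isUnit : ∀ b, ¬ φ X ∣ b → IsUnit b
  algebraic : ∀ b, ∃ P : k[X][X], P ≠ 0 ∧ P.eval₂ φ b = 0

variable {φ : k[X] →+* O}

theorem ringHom_eq_eval₂ (φ : k[X] →+* O) (p : k[X]) : φ p = p.eval₂ (φ.comp C) (φ X) := by
  rw [← coe_eval₂RingHom]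
  congr 1
  ext <;> simp

theorem Uniformized.exists_truncation (h : Uniformized φ) (b : O) (n : ℕ) :
    ∃ t, φ X ^ n ∣ b - φ t := by
  induction n with
  | zero => simp
  | succ n ih =>
    obtain ⟨t, c, hc⟩ := ih
    obtain ⟨d, e, he⟩ := h.residue c
    refine ⟨t + X ^ n * C d, e, ?_⟩
    rw [map_add, map_mul, map_pow, pow_succ, mul_assoc, ← he]
    linear_combination hc

theorem dvd_of_dvd_sum_of_ne {ι : Type*} [DecidableEq ι] {s : Finset ι} {ϖ : O} {a : ι → O} {j : ι}
    (hj : j ∈ s) (h : ∀ i ∈ s, i ≠ j → ϖ ∣ a i) (hs : ϖ ∣ ∑ i ∈ s, a i) : ϖ ∣ a j := by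
  rw [← Finset.add_sum_erase s a hj] at hs
  refine (dvd_add_left (Finset.dvd_sum fun i hi => ?_)).1 hs
  exact h i (Finset.mem_of_mem_erase hi) (Finset.ne_of_mem_erase hi)

variable [IsDomain O]

theorem pow_dvd_of_map_X_pow_dvd (hp : Prime (φ X)) {n : ℕ} {p : k[X]} (h : φ X ^ n ∣ φ p) :
    X ^ n ∣ p :=
  pow_dvd_of_pow_dvd_eval₂ hp (by rwa [ringHom_eq_eval₂ φ p] at h)

theorem injective_of_prime_map_X (hp : Prime (φ X)) : Function.Injective φ := by
  convert eval₂_injective_of_prime (ι := φ.comp C) hp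
  ext <;> simp

/-- In an algebraic relation of least degree the derivative cannot vanish at `θ`; characteristic
zero keeps the derivative itself nonzero. -/
theorem Uniformized.exists_separable (h : Uniformized φ) [CharZero k] (θ : O) :
    ∃ H : k[X][X], 0 < H.natDegree ∧ H.eval₂ φ θ = 0 ∧ (derivative H).eval₂ φ θ ≠ 0 := by
  obtain ⟨H, ⟨h0, hH⟩, hmin⟩ := WellFounded.has_min (measure (natDegree (R := k[X]))).wf
    {P | P ≠ 0 ∧ P.eval₂ φ θ = 0} (h.algebraic θ)
  have hd : 0 < H.natDegree := by
    by_contra! hle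
    rw [eq_C_of_natDegree_le_zero hle, eval₂_C] at hH
    refine h0 ?_
    rw [eq_C_of_natDegree_le_zero hle, (injective_iff_map_eq_zero φ).1
      (injective_of_prime_map_X h.prime) _ hH, C_0]
  refine ⟨H, hd, hH, fun h' => hmin (derivative H) ⟨fun h'' => ?_, h'⟩ ?_⟩
  · exact hd.ne' (derivative_eq_zero.1 h'')
  · exact natDegree_derivative_lt hd.ne'

/-- After truncating its expansion, an algebraic element becomes the inverse of a simple root. -/
theorem Uniformized.exists_simple_root (h : Uniformized φ) [CharZero k] (θ : O) :
    ∃ (t : k[X]) (M : ℕ) (z : O) (f : k[X][X]), IsUnit z ∧ θ * z = φ t * z + φ X ^ M ∧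
      ¬ X ∣ f.leadingCoeff ∧ f.eval₂ φ z = 0 ∧ ¬ φ X ∣ (derivative f).eval₂ φ z := by
  obtain ⟨H, hN, hH, hH'⟩ := h.exists_separable θ
  have hp := h.prime
  set ϖ := φ X with hϖ
  set N := H.natDegree with hNdef
  set n := multiplicity ϖ ((derivative H).eval₂ φ θ) with hn
  have hfin := h.finiteMultiplicity _ hH'
  -- The precision `n + 1` exceeds the order `n` of `H'(θ)`, as in Hensel's lemma. A remainder
  -- divisible by `ϖ` is shifted by `1` to make it a unit.
  obtain ⟨t, β, hθ, hβ⟩ : ∃ t β, θ = φ t + ϖ ^ (n + 1) * β ∧ ¬ ϖ ∣ β := by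
    obtain ⟨t, β, hβ⟩ := h.exists_truncation θ (n + 1)
    by_cases hd : ϖ ∣ β
    · refine ⟨t - X ^ (n + 1), β + 1, ?_, fun h1 => ?_⟩
      · rw [map_sub, map_pow, ← hϖ]
        linear_combination hβ
      · exact hp.not_isUnit (isUnit_of_dvd_one ((dvd_add_right hd).1 h1))
    · exact ⟨t, β, by linear_combination hβ, hd⟩
  -- The inverse of `β` is used because the equation of `β` has its higher coefficients divisible by
  -- `ϖ`. The reciprocal equation has the constant term as leading coefficient, which will turn out
  -- to be prime to `X`.
  obtain ⟨z, hzβ⟩ := (h.isUnit β hβ).exists_right_inv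
  have hzu : IsUnit z := IsUnit.of_mul_eq_one_right _ hzβ
  have hznd : ∀ j : ℕ, ¬ ϖ ∣ z ^ j := fun j hd => hp.not_isUnit (isUnit_of_dvd_unit hd (hzu.pow j))
  set τ := taylor t H with hτ
  have hsum : ∑ i ∈ Finset.range (N + 1), φ (τ.coeff i) * (ϖ ^ (n + 1) * β) ^ i = 0 := by
    rw [← hH, hθ, ← eval₂_eq_sum_range' φ (p := τ) (n := N + 1)
      (by rw [hτ, natDegree_taylor]; omega), hτ, taylor_apply, eval₂_comp]
    congr 1
    simp
    ring
  -- the derivative at the truncation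
  have hder : ϖ ^ (n + 1) ∣ φ (τ.coeff 1) - (derivative H).eval₂ φ θ := by
    rw [hτ, taylor_coeff_one, ← eval₂_at_apply, eval₂_eq_eval_map, eval₂_eq_eval_map]
    refine dvd_trans ?_ (sub_dvd_eval_sub _ _ _)
    exact ⟨-β, by rw [hθ]; ring⟩
  obtain ⟨e, he⟩ : X ^ n ∣ τ.coeff 1 := by
    refine pow_dvd_of_map_X_pow_dvd hp ?_
    exact (dvd_iff_dvd_of_dvd_sub ((pow_dvd_pow _ n.le_succ).trans hder)).2
      (pow_multiplicity_dvd _ _)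
  have hXe : ¬ ϖ ∣ φ e := by
    rintro ⟨e', he'⟩
    refine hfin.not_pow_dvd_of_multiplicity_lt n.lt_succ_self
      ((dvd_iff_dvd_of_dvd_sub hder).1 ⟨e', ?_⟩)
    rw [he, map_mul, map_pow, he', ← hϖ]
    ring
  -- Division of `H(t + X^(n+1) Y)` by `X^(2n+1)`: the linear coefficient becomes `e`, prime to `X`;
  -- the higher ones keep a factor `X`; the constant one is divisible because all other terms of
  -- `hsum` are.
  have hc : ∀ i, ∃ c, X ^ (n + (n + 1)) * c = X ^ ((n + 1) * i) * τ.coeff i ∧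
      (i = 1 → c = e) ∧ (2 ≤ i → X ∣ c) := by
    have h1 : ∀ i, 1 ≤ i → X ^ (n + (n + 1)) ∣ X ^ ((n + 1) * i) * τ.coeff i := by
      intro i hi
      rcases hi.eq_or_lt with rfl | hi
      · rw [he, mul_one, pow_add, mul_comm (X ^ n)]
        exact mul_dvd_mul_left _ (dvd_mul_right _ _)
      · refine (pow_dvd_pow _ ?_).mul_right _
        nlinarith
    intro i
    rcases Nat.lt_trichotomy i 1 with hi | rfl | hi
    · obtain rfl : i = 0 := by omega
      suffices X ^ (n + (n + 1)) ∣ τ.coeff 0 by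
        obtain ⟨c, hc⟩ := this
        exact ⟨c, by simp [hc], by omega, by omega⟩
      refine pow_dvd_of_map_X_pow_dvd hp ?_
      rw [Finset.sum_range_succ', pow_zero, mul_one] at hsum
      rw [eq_neg_of_add_eq_zero_right hsum, dvd_neg]
      refine Finset.dvd_sum fun i _ => ?_
      have := map_dvd φ (h1 (i + 1) (by omega))
      rw [map_mul, map_pow, map_pow, ← hϖ] at this
      rw [mul_pow, ← pow_mul, ← mul_assoc, mul_comm (φ _)]
      exact this.mul_right _
    · refine ⟨e, ?_, fun _ => rfl, by omega⟩
      rw [he, mul_one]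
      ring
    · refine ⟨X ^ ((n + 1) * i - (n + (n + 1))) * τ.coeff i, ?_, by omega, fun _ => ?_⟩
      · rw [← mul_assoc, ← pow_add, Nat.add_sub_cancel' (by nlinarith)]
      · refine (dvd_pow_self X ?_).mul_right _
        have : n + (n + 1) < (n + 1) * i := by nlinarith
        omega
  choose c hc hc1 hc2 using hc
  have hz : ∀ i ∈ Finset.range (N + 1), z ^ (N - i) = z ^ N * β ^ i := by
    intro i hi
    have hi' : i ≤ N := Nat.lt_succ_iff.1 (Finset.mem_range.1 hi)
    obtain ⟨r, hr⟩ := Nat.exists_eq_add_of_le hi'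
    rw [hr, Nat.add_sub_cancel_left, pow_add, mul_right_comm, ← mul_pow, mul_comm z, hzβ, one_pow,
      one_mul]
  have hzero : ∑ i ∈ Finset.range (N + 1), φ (c i) * z ^ (N - i) = 0 := by
    refine ((mul_eq_zero (a := ϖ ^ (n + (n + 1)))).1 ?_).resolve_left (pow_ne_zero _ hp.ne_zero)
    rw [Finset.mul_sum]
    trans z ^ N * ∑ i ∈ Finset.range (N + 1), φ (τ.coeff i) * (ϖ ^ (n + 1) * β) ^ i
    · rw [Finset.mul_sum]
      refine Finset.sum_congr rfl fun i hi => ?_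
      have := congrArg φ (hc i)
      simp only [map_mul, map_pow, ← hϖ] at this
      rw [hz i hi, ← mul_assoc, this, mul_pow, ← pow_mul]
      ring
    · rw [hsum, mul_zero]
  have hdvd : ∀ i ≠ 1, i ≠ 0 → ϖ ∣ φ (c i) := fun i h1 h0 => map_dvd φ (hc2 i (by omega))
  have hc1' : ¬ ϖ ∣ φ (c 1) * z ^ (N - 1) := fun hd =>
    (hp.dvd_or_dvd hd).elim (by rwa [hc1 1 rfl]) (hznd _)
  set f : k[X][X] := ∑ i ∈ Finset.range (N + 1), monomial (N - i) (c i) with hf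
  have hmem1 : 1 ∈ Finset.range (N + 1) := by simp; omega
  -- Otherwise the term with index `1` would be the only one in `hzero` not divisible by `ϖ`.
  have hc0 : ¬ X ∣ c 0 := by
    intro hd
    refine hc1' (dvd_of_dvd_sum_of_ne (a := fun i => φ (c i) * z ^ (N - i)) hmem1
      (fun i _ hi => ?_) (by rw [hzero]; exact dvd_zero ϖ))
    rcases eq_or_ne i 0 with rfl | h0
    · exact (map_dvd φ hd).mul_right _
    · exact (hdvd i hi h0).mul_right _
  have hcoeff : f.coeff N = c 0 := by
    rw [hf, finsetSum_coeff, Finset.sum_eq_single 0]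
    · simp
    · intro i hi h0
      rw [coeff_monomial, if_neg]
      simp at hi
      omega
    · simp
  have hdeg : f.natDegree = N := by
    refine le_antisymm (natDegree_sum_le_of_forall_le _ _ fun i _ => ?_) ?_
    · exact (natDegree_monomial_le _).trans (Nat.sub_le _ _)
    · refine le_natDegree_of_ne_zero ?_
      rw [hcoeff]
      rintro h0
      simp [h0] at hc0
  have hev : f.eval₂ φ z = 0 := by
    rw [hf, eval₂_finsetSum, ← hzero]
    simp [eval₂_monomial]
  refine ⟨t, n + 1, z, f, hzu, ?_, ?_, hev, fun hd => hc1' ?_⟩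
  · rw [hθ]
    linear_combination ϖ ^ (n + 1) * hzβ
  · rwa [leadingCoeff, hdeg, hcoeff]
  -- Subtracting `N f(z) = 0` replaces the weights `N - i` by `-i`. Modulo `ϖ` only `i = 1`
  -- survives, since the weight of `i = 0` is zero.
  · have key : z * (derivative f).eval₂ φ z =
        - ∑ i ∈ Finset.range (N + 1), (i : O) * (φ (c i) * z ^ (N - i)) := by
      have h1 : z * (derivative f).eval₂ φ z =
          ∑ i ∈ Finset.range (N + 1), ((N - i : ℕ) : O) * (φ (c i) * z ^ (N - i)) := by
        rw [hf, derivative_sum, eval₂_finsetSum, Finset.mul_sum]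
        refine Finset.sum_congr rfl fun i _ => ?_
        rw [derivative_monomial, eval₂_monomial]
        rcases Nat.eq_zero_or_pos (N - i) with h0 | h0
        · simp [h0]
        · conv_rhs => rw [← Nat.sub_add_cancel h0, pow_succ, Nat.sub_add_cancel h0]
          simp
          ring
      have h2 : (N : O) * ∑ i ∈ Finset.range (N + 1), φ (c i) * z ^ (N - i) = 0 := by
        rw [hzero, mul_zero]
      rw [h1, eq_neg_iff_add_eq_zero, ← Finset.sum_add_distrib, ← h2, Finset.mul_sum]
      refine Finset.sum_congr rfl fun i hi => ?_
      rw [Nat.cast_sub (Nat.lt_succ_iff.1 (Finset.mem_range.1 hi))]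
      ring
    have h3 : ϖ ∣ ∑ i ∈ Finset.range (N + 1), (i : O) * (φ (c i) * z ^ (N - i)) := by
      rw [← dvd_neg, ← key]
      exact hd.mul_left _
    have := dvd_of_dvd_sum_of_ne hmem1 (fun i _ hi => ?_) h3
    · simpa using this
    · rcases eq_or_ne i 0 with rfl | h0
      · simp
      · exact ((hdvd i hi h0).mul_right _).mul_left _

end Uniformized

/-! ### Primitive elements that are simple roots -/

section Primitive

variable {k O : Type*} [Field k] [CommRing O] (Q : Type*) [Field Q] [Algebra O Q]

/-- The subfield of `Q` that is generated by the image of `k[X]` and by `Γ`. -/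
def generatedField (φ : k[X] →+* O) (Γ : Set O) : Subfield Q :=
  Subfield.closure (algebraMap O Q '' (Set.range φ ∪ Γ))

variable {Q} {φ : k[X] →+* O}

theorem map_mem_generatedField (Γ : Set O) (p : k[X]) :
    algebraMap O Q (φ p) ∈ generatedField Q φ Γ :=
  Subfield.subset_closure (Set.mem_image_of_mem _ (Or.inl ⟨p, rfl⟩))

theorem mem_generatedField {Γ : Set O} {γ : O} (h : γ ∈ Γ) :
    algebraMap O Q γ ∈ generatedField Q φ Γ :=
  Subfield.subset_closure (Set.mem_image_of_mem _ (Or.inr h))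

theorem generatedField_le {Γ : Set O} {K : Subfield Q} (h : ∀ p, algebraMap O Q (φ p) ∈ K)
    (h' : ∀ γ ∈ Γ, algebraMap O Q γ ∈ K) : generatedField Q φ Γ ≤ K := by
  refine Subfield.closure_le.2 ?_
  rintro _ ⟨x, ⟨p, rfl⟩ | hx, rfl⟩
  exacts [h p, h' x hx]

theorem exists_div_of_mem_generatedField {Γ : Set O} {x : Q} (h : x ∈ generatedField Q φ Γ) :
    ∃ y ∈ Subring.closure (Set.range φ ∪ Γ), ∃ w ∈ Subring.closure (Set.range φ ∪ Γ),
      algebraMap O Q y / algebraMap O Q w = x := by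
  rw [generatedField, Subfield.mem_closure_iff] at h
  obtain ⟨y, hy, w, hw, rfl⟩ := h
  rw [← RingHom.map_closure] at hy hw
  obtain ⟨y, hy, rfl⟩ := hy
  obtain ⟨w, hw, rfl⟩ := hw
  exact ⟨y, hy, w, hw, rfl⟩

variable [IsDomain O] [FaithfulSMul O Q]

theorem Uniformized.exists_primitive (h : Uniformized φ) [CharZero k] {Γ : Set O}
    (hΓ : Γ.Finite) : ∃ θ, generatedField Q φ {θ} = generatedField Q φ Γ := by
  have hinj : Function.Injective (algebraMap O Q) := FaithfulSMul.algebraMap_injective O Q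
  set F : Subfield Q := generatedField Q φ ∅ with hF
  have : CharZero Q := charZero_of_injective_ringHom
    (f := ((algebraMap O Q).comp φ).comp C)
    ((hinj.comp (injective_of_prime_map_X h.prime)).comp C_injective)
  have hcF : CharZero F := inferInstance
  let ψ : k[X] →+* F := ((algebraMap O Q).comp φ).codRestrict F (map_mem_generatedField ∅)
  have hψ : ∀ p, (algebraMap F Q) (ψ p) = algebraMap O Q (φ p) := fun _ => rfl
  have hψinj : Function.Injective ψ := fun a b hab => by
    have := congrArg (algebraMap F Q) hab
    rw [hψ, hψ] at this
    exact injective_of_prime_map_X h.prime (hinj this)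
  have hint : ∀ x ∈ algebraMap O Q '' Γ, IsIntegral F x := by
    rintro _ ⟨γ, -, rfl⟩
    obtain ⟨P, hP, hP0⟩ := h.algebraic γ
    refine IsAlgebraic.isIntegral ⟨P.map ψ, (Polynomial.map_ne_zero_iff hψinj).2 hP, ?_⟩
    have h1 : (algebraMap F Q).comp ψ = (algebraMap O Q).comp φ := RingHom.ext hψ
    rw [aeval_def, eval₂_map, h1, ← hom_eval₂, hP0, map_zero]
  have hcl : ∀ Δ : Set O, (IntermediateField.adjoin F (algebraMap O Q '' Δ)).toSubfield =
      generatedField Q φ Δ := by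
    intro Δ
    apply le_antisymm
    · refine Subfield.closure_le.2 (Set.union_subset ?_ ?_)
      · rintro _ ⟨x, rfl⟩
        have hx : (x : Q) ∈ generatedField Q φ ∅ := x.2
        exact generatedField_le (fun p => map_mem_generatedField _ p)
          (fun γ hγ => absurd hγ (Set.notMem_empty γ)) hx
      · rintro _ ⟨x, hx, rfl⟩
        exact mem_generatedField hx
    · refine generatedField_le (fun p => ?_) (fun γ hγ => ?_)
      · exact (IntermediateField.adjoin F (algebraMap O Q '' Δ)).algebraMap_mem (ψ p)
      · exact IntermediateField.subset_adjoin F _ (Set.mem_image_of_mem _ hγ)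
  have : Finite (algebraMap O Q '' Γ) := (hΓ.image _).to_subtype
  have : FiniteDimensional F (IntermediateField.adjoin F (algebraMap O Q '' Γ)) :=
    IntermediateField.finiteDimensional_adjoin hint
  obtain ⟨α, hα⟩ := Field.exists_primitive_element F
    (IntermediateField.adjoin F (algebraMap O Q '' Γ))
  have hα' : IntermediateField.adjoin F {(α : Q)} =
      IntermediateField.adjoin F (algebraMap O Q '' Γ) := by
    rw [← IntermediateField.lift_adjoin_simple, hα, IntermediateField.lift_top]
  have hαmem : (α : Q) ∈ generatedField Q φ Γ := by
    rw [← hcl]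
    exact α.2
  obtain ⟨y, -, w, -, hyw⟩ := exists_div_of_mem_generatedField hαmem
  -- The primitive element is a quotient of elements of `O`. Its denominator is a unit times a power
  -- of `φ X`, and that power lies in the base field, so clearing it does not change the generated
  -- field.
  obtain ⟨θ, n, hθ⟩ : ∃ (θ : O) (n : ℕ), algebraMap O Q θ = α * algebraMap O Q (φ X) ^ n := by
    rcases eq_or_ne w 0 with rfl | hw
    · exact ⟨0, 0, by simp [← hyw]⟩
    · obtain ⟨w', hw', hnd⟩ := (h.finiteMultiplicity w hw).exists_eq_pow_mul_and_not_dvd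
      obtain ⟨w'', hu⟩ := (h.isUnit w' hnd).exists_right_inv
      refine ⟨y * w'', multiplicity (φ X) w, ?_⟩
      have h0 : algebraMap O Q w ≠ 0 := by simpa using hw
      have h1 := congrArg (algebraMap O Q) hw'
      have h2 := congrArg (algebraMap O Q) hu
      simp only [map_mul, map_pow, map_one] at h1 h2
      rw [← hyw, div_mul_eq_mul_div, eq_div_iff h0, map_mul, h1]
      linear_combination (algebraMap O Q y * algebraMap O Q (φ X) ^ multiplicity (φ X) w) * h2
  refine ⟨θ, ?_⟩
  have hX : algebraMap O Q (φ X) ^ n ≠ 0 := pow_ne_zero _ (by simpa using h.prime.ne_zero)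
  rw [← hcl, ← hcl, ← hα', Set.image_singleton]
  congr 1
  have hXmem : ∀ K : IntermediateField F Q, algebraMap O Q (φ X) ^ n ∈ K := fun K =>
    pow_mem (K.algebraMap_mem (ψ X)) n
  apply le_antisymm
  · rw [IntermediateField.adjoin_simple_le_iff, hθ]
    exact mul_mem (IntermediateField.mem_adjoin_simple_self F _) (hXmem _)
  · rw [IntermediateField.adjoin_simple_le_iff, (eq_div_iff hX).2 hθ.symm]
    exact div_mem (IntermediateField.mem_adjoin_simple_self F _) (hXmem _)

/-- The field generated by finitely many elements is generated by a simple root. -/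
theorem Uniformized.exists_simple_primitive (h : Uniformized φ) [CharZero k] {Γ : Set O}
    (hΓ : Γ.Finite) :
    ∃ (z : O) (f : k[X][X]), generatedField Q φ {z} = generatedField Q φ Γ ∧
      ¬ X ∣ f.leadingCoeff ∧ f.eval₂ φ z = 0 ∧ ¬ φ X ∣ (derivative f).eval₂ φ z := by
  obtain ⟨θ, hθ⟩ := h.exists_primitive (Q := Q) hΓ
  obtain ⟨t, M, z, f, hz, hzθ, h1, h2, h3⟩ := h.exists_simple_root θ
  refine ⟨z, f, hθ ▸ ?_, h1, h2, h3⟩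
  have hinj : Function.Injective (algebraMap O Q) := FaithfulSMul.algebraMap_injective O Q
  have hz0 : algebraMap O Q z ≠ 0 := (hz.map _).ne_zero
  have hX : algebraMap O Q (φ (X ^ M)) ≠ 0 := by
    simpa using pow_ne_zero M h.prime.ne_zero
  -- The relation `(θ - t) z = X^M` expresses each of `θ` and `z` rationally through the other.
  have e1 : (algebraMap O Q θ - algebraMap O Q (φ t)) * algebraMap O Q z =
      algebraMap O Q (φ (X ^ M)) := by
    rw [← map_sub, ← map_mul, map_pow]
    congr 1
    linear_combination hzθ
  have hne : algebraMap O Q θ - algebraMap O Q (φ t) ≠ 0 := fun h0 =>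
    hX (by rw [← e1, h0, zero_mul])
  apply le_antisymm
  · refine generatedField_le (map_mem_generatedField _) ?_
    intro x hx
    rw [Set.mem_singleton_iff.1 hx]
    rw [eq_div_of_mul_eq hne ((mul_comm _ _).trans e1)]
    exact div_mem (map_mem_generatedField _ _)
      (sub_mem (mem_generatedField rfl) (map_mem_generatedField _ _))
  · refine generatedField_le (map_mem_generatedField _) ?_
    intro x hx
    rw [Set.mem_singleton_iff.1 hx]
    rw [← sub_add_cancel (algebraMap O Q θ) (algebraMap O Q (φ t)), eq_div_of_mul_eq hz0 e1]
    exact add_mem (div_mem (map_mem_generatedField _ _) (mem_generatedField rfl))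
      (map_mem_generatedField _ _)

end Primitive

end MixedNP

namespace MixedNP

universe u v w

open IsLocalRing

/-! ### Consequences of flatness -/

section Flat

variable {A : Type u} {B : Type v} [CommRing A] [CommRing B]

theorem ringHom_flat_of_forall {g : A →+* B}
    (h : ∀ (l : ℕ) (f : Fin l → A) (x : Fin l → B), ∑ i, g (f i) * x i = 0 →
      ∃ (k : ℕ) (a : Fin l → Fin k → A) (y : Fin k → B), (∀ i, x i = ∑ j, g (a i j) * y j) ∧
        ∀ j, ∑ i, f i * a i j = 0) : g.Flat := by
  algebraize [g]
  exact Module.Flat.iff_forall_isTrivialRelation.2 fun {l f x} hx => h l f x hx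

theorem _root_.RingHom.Flat.exists_of_sum_eq_zero {g : A →+* B} (hg : g.Flat) {l : ℕ}
    {f : Fin l → A} {x : Fin l → B} (hx : ∑ i, g (f i) * x i = 0) :
    ∃ (k : ℕ) (a : Fin l → Fin k → A) (y : Fin k → B), (∀ i, x i = ∑ j, g (a i j) * y j) ∧
      ∀ j, ∑ i, f i * a i j = 0 := by
  algebraize [g]
  exact Module.Flat.isTrivialRelation_of_sum_smul_eq_zero (f := f) (x := x) hx

/-- Ideals of the local ring at the center of a flat local ring are contracted. -/
theorem _root_.RingHom.Flat.exists_isUnit_mul_mem [IsLocalRing B] {g : A →+* B} (hg : g.Flat)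
    (I : Ideal A) {x : A} (hx : g x ∈ I.map g) : ∃ s, IsUnit (g s) ∧ s * x ∈ I := by
  let _ := g.toAlgebra
  have hflat : Module.Flat A B := hg
  set p := (maximalIdeal B).comap g with hp
  have hpu : ∀ s, s ∉ p ↔ IsUnit (g s) := fun s => by
    rw [hp, Ideal.mem_comap, mem_maximalIdeal, mem_nonunits_iff, not_not]
  have hu : ∀ s : p.primeCompl, IsUnit (algebraMap A B s) := fun s => (hpu s).1 s.2
  let _ : Algebra (Localization.AtPrime p) B := (IsLocalization.lift hu).toAlgebra
  have : IsScalarTower A (Localization.AtPrime p) B :=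
    .of_algebraMap_eq fun x => (IsLocalization.lift_eq hu x).symm
  have : Module.Flat (Localization.AtPrime p) B :=
    (Module.flat_iff_of_isLocalization _ p.primeCompl B).2 hflat
  have : IsLocalHom (algebraMap (Localization.AtPrime p) B) := by
    constructor
    intro a ha
    obtain ⟨x, s, rfl⟩ := IsLocalization.exists_mk'_eq p.primeCompl a
    rw [IsLocalization.AtPrime.isUnit_mk'_iff _ p]
    refine (hpu x).2 ?_
    have h1 : algebraMap (Localization.AtPrime p) B (IsLocalization.mk' _ x s) *
        algebraMap A B s = g x := by
      rw [IsScalarTower.algebraMap_apply A (Localization.AtPrime p) B, ← map_mul,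
        IsLocalization.mk'_spec, ← IsScalarTower.algebraMap_apply]
      rfl
    exact h1 ▸ ha.mul (hu s)
  have hff : Module.FaithfullyFlat (Localization.AtPrime p) B :=
    Module.FaithfullyFlat.of_flat_of_isLocalHom
  have h1 : algebraMap A (Localization.AtPrime p) x ∈
      I.map (algebraMap A (Localization.AtPrime p)) := by
    rw [← Ideal.comap_map_eq_self_of_faithfullyFlat (B := B)
      (I.map (algebraMap A (Localization.AtPrime p))), Ideal.mem_comap,
      Ideal.map_map, ← IsScalarTower.algebraMap_eq, ← IsScalarTower.algebraMap_apply]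
    exact hx
  obtain ⟨s, hs, hsx⟩ := (IsLocalization.algebraMap_mem_map_algebraMap_iff p.primeCompl _ _ _).1 h1
  exact ⟨s, (hpu s).1 hs, hsx⟩

/-- A weak regularity property is inherited by flat algebras. -/
theorem dvd_of_mul_eq_mul {g : A →+* B} (hg : g.Flat) {p q : A}
    (h : ∀ a b, p * a = q * b → q ∣ a) {a b : B} (hab : g p * a = g q * b) : g q ∣ a := by
  have : ∑ i : Fin 2, g ((![p, -q] : Fin 2 → A) i) * (![a, b] : Fin 2 → B) i = 0 := by
    simp [hab]
  -- By flatness `(a, b)` is a combination of relations over `A`, whose first entries are all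
  -- divisible by `q`.
  obtain ⟨k, c, y, h1, h2⟩ := hg.exists_of_sum_eq_zero this
  have h3 := h1 0
  simp only [Matrix.cons_val_zero] at h3
  rw [h3]
  refine Finset.dvd_sum fun j _ => ?_
  have h4 := h2 j
  simp at h4
  exact (_root_.map_dvd g (h _ _ (by linear_combination h4 : p * c 0 j = q * c 1 j))).mul_right _

end Flat

/-! ### Colimits of étale algebras with a point -/

section EtaleColimit

variable (A : Type u) (B : Type v) (κ : Type w) [CommRing A] [CommRing B] [Algebra A B] [Field κ]
  [Algebra A κ]

/-- The data of a colimit of the étale `A`-algebras with a point in `κ`. -/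
structure EtaleColimit where
  map : ∀ (E : Type u) [CommRing E] [Algebra A E] [Algebra.Etale A E],
    (E →ₐ[A] κ) → (E →ₐ[A] B)
  map_comp : ∀ (E E' : Type u) [CommRing E] [Algebra A E] [Algebra.Etale A E]
    [CommRing E'] [Algebra A E'] [Algebra.Etale A E']
    (α' : E' →ₐ[A] κ) (φ : E →ₐ[A] E'),
    (map E' α').comp φ = map E (α'.comp φ)
  exists_map_eq : ∀ b : B, ∃ (E : Type u) (_ : CommRing E) (_ : Algebra A E)
    (_ : Algebra.Etale A E) (α : E →ₐ[A] κ) (x : E), map E α x = b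
  exists_eq_zero : ∀ (E : Type u) [CommRing E] [Algebra A E] [Algebra.Etale A E]
    (α : E →ₐ[A] κ) (x : E), map E α x = 0 →
    ∃ (E' : Type u) (_ : CommRing E') (_ : Algebra A E') (_ : Algebra.Etale A E')
      (α' : E' →ₐ[A] κ) (φ : E →ₐ[A] E'),
      α'.comp φ = α ∧ φ x = 0

variable {A B κ}

theorem IsStrictHenselization.nonempty_etaleColimit [IsLocalRing A]
    (h : IsStrictHenselization A B) :
    Nonempty (EtaleColimit A B (SeparableClosure (ResidueField A))) := by
  obtain ⟨ι, h1, h2, h3⟩ := h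
  exact ⟨⟨ι, h1, h2, h3⟩⟩

namespace EtaleColimit

variable (D : EtaleColimit A B κ)

theorem map_apply {E E' : Type u} [CommRing E] [Algebra A E] [Algebra.Etale A E]
    [CommRing E'] [Algebra A E'] [Algebra.Etale A E']
    {α : E →ₐ[A] κ}
    {α' : E' →ₐ[A] κ} {φ : E →ₐ[A] E'} (h : α'.comp φ = α)
    (x : E) : D.map E' α' (φ x) = D.map E α x := by
  rw [← h, ← D.map_comp]
  rfl

/-- Finitely many elements of the colimit come from a common étale algebra. -/
theorem exists_common {E : Type u} [CommRing E] [Algebra A E] [Algebra.Etale A E]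
    (α : E →ₐ[A] κ) {n : ℕ} (b : Fin n → B) :
    ∃ (E' : Type u) (_ : CommRing E') (_ : Algebra A E') (_ : Algebra.Etale A E')
      (α' : E' →ₐ[A] κ) (φ : E →ₐ[A] E'),
      α'.comp φ = α ∧ ∃ x : Fin n → E', ∀ i, D.map E' α' (x i) = b i := by
  induction n with
  | zero => exact ⟨E, _, _, inferInstance, α, AlgHom.id A E, by simp, fun i => i.elim0,
      fun i => i.elim0⟩
  | succ n ih =>
    obtain ⟨E₁, _, _, _, α₁, φ₁, h₁, x, hx⟩ := ih (fun i => b i.castSucc)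
    obtain ⟨E₂, _, _, _, α₂, y, hy⟩ := D.exists_map_eq (b (Fin.last n))
    -- The two points together define a point of the tensor product, which is again étale: the
    -- system is directed.
    have : Algebra.Etale A (TensorProduct A E₁ E₂) := Algebra.Etale.comp A E₁ _
    let α' : TensorProduct A E₁ E₂ →ₐ[A] κ :=
      Algebra.TensorProduct.lift α₁ α₂ (fun _ _ => Commute.all _ _)
    have hl : α'.comp Algebra.TensorProduct.includeLeft = α₁ :=
      Algebra.TensorProduct.lift_comp_includeLeft _ _ (fun _ _ => Commute.all _ _)
    have hr : α'.comp Algebra.TensorProduct.includeRight = α₂ :=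
      Algebra.TensorProduct.lift_comp_includeRight _ _ (fun _ _ => Commute.all _ _)
    let x' : Fin (n + 1) → TensorProduct A E₁ E₂ :=
      Fin.lastCases (Algebra.TensorProduct.includeRight y)
        (fun i => Algebra.TensorProduct.includeLeft (S := A) (x i))
    have hlast : x' (Fin.last n) = Algebra.TensorProduct.includeRight y := Fin.lastCases_last
    have hcast : ∀ i : Fin n, x' i.castSucc = Algebra.TensorProduct.includeLeft (S := A) (x i) :=
      fun i => Fin.lastCases_castSucc i
    refine ⟨TensorProduct A E₁ E₂, inferInstance, inferInstance, this, α',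
      Algebra.TensorProduct.includeLeft.comp φ₁, ?_, x', fun i => ?_⟩
    · rw [← AlgHom.comp_assoc, hl, h₁]
    · induction i using Fin.lastCases with
      | last => rw [hlast]; exact (D.map_apply hr y).trans hy
      | cast i => rw [hcast]; exact (D.map_apply hl (x i)).trans (hx i)

/-- A homomorphism between étale `A`-algebras is itself étale. -/
theorem flat_of_algHom {E E' : Type u} [CommRing E] [Algebra A E] [Algebra.Etale A E]
    [CommRing E'] [Algebra A E'] [Algebra.Etale A E'] (φ : E →ₐ[A] E') :
    φ.toRingHom.Flat := by
  let _ := φ.toRingHom.toAlgebra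
  have : IsScalarTower A E E' := .of_algebraMap_eq fun x => (φ.commutes x).symm
  have : Algebra.Etale E E' := Algebra.Etale.of_restrictScalars A E E'
  exact Algebra.Smooth.flat E E'

/-- By the equational criterion: a linear relation in `B` involves finitely many elements, so it
already holds in some étale algebra. That algebra is flat over `E`; the relation is trivialized
there and the result is mapped to `B`. -/
theorem flat_map {E : Type u} [CommRing E] [Algebra A E] [Algebra.Etale A E] (α : E →ₐ[A] κ) :
    (D.map E α).toRingHom.Flat := by
  refine ringHom_flat_of_forall fun l f b hb => ?_
  obtain ⟨E₁, _, _, _, α₁, φ₁, h₁, x, hx⟩ := D.exists_common α b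
  have h0 : D.map E₁ α₁ (∑ i, φ₁ (f i) * x i) = 0 := by
    rw [← hb, map_sum]
    refine Finset.sum_congr rfl fun i _ => ?_
    rw [map_mul, hx, D.map_apply h₁]
    rfl
  obtain ⟨E₂, _, _, _, α₂, φ₂, h₂, h0⟩ := D.exists_eq_zero E₁ α₁ _ h0
  have hrel : ∑ i, (φ₂.comp φ₁).toRingHom (f i) * φ₂ (x i) = 0 := by
    rw [← h0, map_sum]
    exact Finset.sum_congr rfl fun i _ => by rw [map_mul]; rfl
  obtain ⟨k, a, y, h3, h4⟩ := (flat_of_algHom (φ₂.comp φ₁)).exists_of_sum_eq_zero hrel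
  refine ⟨k, a, fun j => D.map E₂ α₂ (y j), fun i => ?_, h4⟩
  have h5 : α₂.comp (φ₂.comp φ₁) = α := by rw [← AlgHom.comp_assoc, h₂, h₁]
  rw [← hx i, ← D.map_apply h₂, h3, map_sum]
  refine Finset.sum_congr rfl fun j _ => ?_
  rw [map_mul]
  congr 1
  exact D.map_apply h5 (a i j)

theorem flat_algebraMap (D : EtaleColimit A B κ) : (algebraMap A B).Flat := by
  have h : (D.map A (Algebra.ofId A _)).toRingHom = algebraMap A B :=
    RingHom.ext fun a => (D.map A _).commutes a
  exact h ▸ D.flat_map (Algebra.ofId A κ)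

/-- The point extends to the localization of `E` away from `x`, again an étale algebra. -/
theorem isUnit_map {E : Type u} [CommRing E] [Algebra A E] [Algebra.Etale A E]
    {α : E →ₐ[A] κ} {x : E} (hx : α x ≠ 0) :
    IsUnit (D.map E α x) := by
  have hu : ∀ y : Submonoid.powers x, IsUnit (α y) := by
    rintro ⟨_, n, rfl⟩
    exact (isUnit_iff_ne_zero.2 (by simpa using pow_ne_zero n hx))
  let α' : Localization.Away x →ₐ[A] κ :=
    IsLocalization.liftAlgHom (M := Submonoid.powers x) hu
  have h : α'.comp (IsScalarTower.toAlgHom A E (Localization.Away x)) = α :=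
    AlgHom.ext fun y => IsLocalization.lift_eq hu y
  rw [← D.map_apply h]
  exact (IsLocalization.Away.algebraMap_isUnit x).map (D.map _ α')

/-- The prime of an étale algebra that belongs to a point. -/
noncomputable def pointIdeal {E : Type u} [CommRing E] [Algebra A E]
    (α : E →ₐ[A] κ) : Ideal E := RingHom.ker α.toRingHom

instance {E : Type u} [CommRing E] [Algebra A E]
    (α : E →ₐ[A] κ) : (pointIdeal α).IsPrime :=
  RingHom.ker_isPrime _

theorem mem_pointIdeal {E : Type u} [CommRing E] [Algebra A E]
    {α : E →ₐ[A] κ} {x : E} : x ∈ pointIdeal α ↔ α x = 0 := Iff.rfl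

variable [IsLocalRing A] [IsLocalHom (algebraMap A κ)]

theorem algebraMap_eq_zero_iff {a : A} : algebraMap A κ a = 0 ↔ a ∈ maximalIdeal A := by
  rw [mem_maximalIdeal, mem_nonunits_iff, ← isUnit_map_iff (algebraMap A κ), isUnit_iff_ne_zero,
    not_not]

theorem isLocalHom_atPrime {E : Type u} [CommRing E] [Algebra A E]
    (α : E →ₐ[A] κ) :
    IsLocalHom (algebraMap A (Localization.AtPrime (pointIdeal α))) := by
  constructor
  intro a ha
  by_contra hu
  rw [IsScalarTower.algebraMap_apply A E,
    IsLocalization.AtPrime.isUnit_to_map_iff _ (pointIdeal α)] at ha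
  exact ha (mem_pointIdeal.2 (by
    rw [α.commutes, algebraMap_eq_zero_iff]
    exact hu))

/-- Étale algebras are unramified: the maximal ideal of the local ring at the point is generated by
that of `A`. -/
theorem map_mem_map_maximalIdeal {E : Type u} [CommRing E] [Algebra A E] [Algebra.Etale A E]
    {α : E →ₐ[A] κ} {x : E} (hx : α x = 0) :
    D.map E α x ∈ (maximalIdeal A).map (algebraMap A B) := by
  have := isLocalHom_atPrime α
  have h1 := Algebra.FormallyUnramified.map_maximalIdeal (R := A)
    (S := Localization.AtPrime (pointIdeal α))
  have h2 : algebraMap E (Localization.AtPrime (pointIdeal α)) x ∈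
      ((maximalIdeal A).map (algebraMap A E)).map
        (algebraMap E (Localization.AtPrime (pointIdeal α))) := by
    rw [Ideal.map_map, ← IsScalarTower.algebraMap_eq, h1]
    exact (IsLocalization.AtPrime.to_map_mem_maximal_iff _ (pointIdeal α) x).2 hx
  obtain ⟨s, hs, hsx⟩ := (IsLocalization.algebraMap_mem_map_algebraMap_iff
    (pointIdeal α).primeCompl _ _ _).1 h2
  have h3 := Ideal.mem_map_of_mem (D.map E α).toRingHom hsx
  rw [Ideal.map_map] at h3
  have h4 : (D.map E α).toRingHom.comp (algebraMap A E) = algebraMap A B :=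
    (D.map E α).comp_algebraMap
  rw [h4] at h3
  have hu : IsUnit (D.map E α s) := D.isUnit_map hs
  have h5 : D.map E α s * D.map E α x ∈ (maximalIdeal A).map (algebraMap A B) := by
    rw [← map_mul]; exact h3
  exact (Ideal.unit_mul_mem_iff_mem _ hu).1 h5

/-- An equation `1 = b p + c q` would hold in some étale algebra, whose point sends `p` and `q` to
zero. -/
theorem map_maximalIdeal_ne_top (D : EtaleColimit A B κ) {p q : A}
    (h : maximalIdeal A = Ideal.span {p, q}) :
    (maximalIdeal A).map (algebraMap A B) ≠ ⊤ := by
  rw [h, Ideal.map_span, Set.image_pair, Ne, Ideal.eq_top_iff_one, Ideal.mem_span_pair]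
  rintro ⟨b, c, hbc⟩
  obtain ⟨E, _, _, _, α, φ, -, x, hx⟩ := D.exists_common (Algebra.ofId A _) ![b, c]
  have h0 : D.map E α (x 0 * algebraMap A E p + x 1 * algebraMap A E q - 1) = 0 := by
    have h1 := hx 0
    have h2 := hx 1
    simp only [Matrix.cons_val_zero, Matrix.cons_val_one] at h1 h2
    rw [map_sub, map_add, map_mul, map_mul, h1, h2, AlgHom.commutes, AlgHom.commutes, hbc, map_one,
      sub_self]
  obtain ⟨E', _, _, _, α', ψ, h1, h2⟩ := D.exists_eq_zero E α _ h0
  have h3 := congrArg α' h2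
  have hp : algebraMap A κ p = 0 :=
    algebraMap_eq_zero_iff.2 (h ▸ Ideal.subset_span (by simp))
  have hq : algebraMap A κ q = 0 :=
    algebraMap_eq_zero_iff.2 (h ▸ Ideal.subset_span (by simp))
  rw [← AlgHom.comp_apply, h1, map_sub, map_add, map_mul, map_mul, AlgHom.commutes,
    AlgHom.commutes, hp, hq] at h3
  simp at h3

theorem map_mem_iff (hne : (maximalIdeal A).map (algebraMap A B) ≠ ⊤) {E : Type u} [CommRing E]
    [Algebra A E] [Algebra.Etale A E]
    {α : E →ₐ[A] κ} {x : E} :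
    D.map E α x ∈ (maximalIdeal A).map (algebraMap A B) ↔ α x = 0 := by
  refine ⟨fun h => ?_, D.map_mem_map_maximalIdeal⟩
  by_contra h0
  exact hne (Ideal.eq_top_of_isUnit_mem _ h (D.isUnit_map h0))

theorem isUnit_of_notMem (D : EtaleColimit A B κ) {b : B}
    (hb : b ∉ (maximalIdeal A).map (algebraMap A B)) : IsUnit b := by
  obtain ⟨E, _, _, _, α, x, rfl⟩ := D.exists_map_eq b
  exact D.isUnit_map fun h => hb (D.map_mem_map_maximalIdeal h)

theorem notMem_iff_isUnit (D : EtaleColimit A B κ) 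
    (hne : (maximalIdeal A).map (algebraMap A B) ≠ ⊤) {b : B} :
    b ∉ (maximalIdeal A).map (algebraMap A B) ↔ IsUnit b :=
  ⟨D.isUnit_of_notMem, fun h h' => hne (Ideal.eq_top_of_isUnit_mem _ h' h)⟩

theorem isLocalRing (D : EtaleColimit A B κ) 
    (hne : (maximalIdeal A).map (algebraMap A B) ≠ ⊤) : IsLocalRing B := by
  have : Nontrivial B := ⟨⟨0, 1, fun h => hne ((Ideal.eq_top_iff_one _).2 (h ▸ zero_mem _))⟩⟩
  refine IsLocalRing.of_nonunits_add fun a b ha hb => ?_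
  rw [mem_nonunits_iff, ← D.notMem_iff_isUnit hne, not_not] at *
  exact add_mem ha hb

/-- Ideals of the local rings of an étale algebra are contracted from the colimit. -/
theorem exists_mul_mem (hne : (maximalIdeal A).map (algebraMap A B) ≠ ⊤)
    {E : Type u} [CommRing E] [Algebra A E] [Algebra.Etale A E]
    (α : E →ₐ[A] κ) (I : Ideal E) {x : E}
    (hx : D.map E α x ∈ I.map (D.map E α).toRingHom) : ∃ s, α s ≠ 0 ∧ s * x ∈ I := by
  have hB := D.isLocalRing hne
  obtain ⟨s, hs, hsx⟩ := (D.flat_map α).exists_isUnit_mul_mem I hx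
  exact ⟨s, fun h0 => (D.notMem_iff_isUnit hne).2 hs (D.map_mem_map_maximalIdeal h0), hsx⟩

/-- Principal ideals are closed. -/
theorem dvd_of_forall_mem_span (D : EtaleColimit A B κ) [IsNoetherianRing A]
    (hne : (maximalIdeal A).map (algebraMap A B) ≠ ⊤) {a b t : B}
    (ht : t ∈ (maximalIdeal A).map (algebraMap A B))
    (h : ∀ n : ℕ, a ∈ Ideal.span {b, t ^ n}) : b ∣ a := by
  -- The three elements come from one étale algebra. Flatness contracts the hypotheses to its
  -- noetherian local ring `L`, where Krull's intersection theorem for `L/(b)` applies.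
  obtain ⟨E, _, _, _, α, -, -, x, hx⟩ := D.exists_common (Algebra.ofId A _) ![a, b, t]
  have ha : D.map E α (x 0) = a := hx 0
  have hb : D.map E α (x 1) = b := hx 1
  have ht' : D.map E α (x 2) = t := hx 2
  have : IsNoetherianRing E := Algebra.FiniteType.isNoetherianRing A E
  set L := Localization.AtPrime (pointIdeal α) with hL
  have : IsNoetherianRing L := IsLocalization.isNoetherianRing (pointIdeal α).primeCompl _
    inferInstance
  have htm : algebraMap E L (x 2) ∈ maximalIdeal L :=
    (IsLocalization.AtPrime.to_map_mem_maximal_iff _ (pointIdeal α) _).2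
      ((D.map_mem_iff hne).1 (ht' ▸ ht))
  have h1 : ∀ n : ℕ, algebraMap E L (x 0) ∈
      Ideal.span {algebraMap E L (x 1), algebraMap E L (x 2) ^ n} := by
    intro n
    obtain ⟨s, hs, hsx⟩ := D.exists_mul_mem hne α (Ideal.span {x 1, x 2 ^ n}) (x := x 0) (by
      rw [Ideal.map_span, Set.image_pair]
      change D.map E α (x 0) ∈ Ideal.span {D.map E α (x 1), D.map E α (x 2 ^ n)}
      rw [map_pow, ha, hb, ht']
      exact h n)
    have := (IsLocalization.algebraMap_mem_map_algebraMap_iff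
      (pointIdeal α).primeCompl L _ _).2 ⟨s, hs, hsx⟩
    rwa [Ideal.map_span, Set.image_pair, map_pow] at this
  have h2 : (Submodule.mkQ (Ideal.span {algebraMap E L (x 1)})) (algebraMap E L (x 0)) ∈
      (⨅ i, Ideal.span {algebraMap E L (x 2)} ^ i • ⊤ :
        Submodule L (L ⧸ Ideal.span {algebraMap E L (x 1)})) := by
    rw [Submodule.mem_iInf]
    intro n
    obtain ⟨c, d, hcd⟩ := Ideal.mem_span_pair.1 (h1 n)
    have : (Submodule.mkQ (Ideal.span {algebraMap E L (x 1)})) (algebraMap E L (x 0)) =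
        algebraMap E L (x 2) ^ n • (Submodule.mkQ (Ideal.span {algebraMap E L (x 1)})) d := by
      rw [← map_smul, ← sub_eq_zero, ← map_sub, ← LinearMap.mem_ker, Submodule.ker_mkQ,
        Ideal.mem_span_singleton]
      exact ⟨c, by rw [← hcd, smul_eq_mul]; ring⟩
    rw [this]
    exact Submodule.smul_mem_smul
      (Ideal.pow_mem_pow (Ideal.mem_span_singleton_self _) n) Submodule.mem_top
  rw [Ideal.iInf_pow_smul_eq_bot_of_isLocalRing _ (by
    rw [Ne, Ideal.span_singleton_eq_top]
    exact htm), Submodule.mem_bot, ← LinearMap.mem_ker, Submodule.ker_mkQ] at h2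
  have h3 : algebraMap E L (x 0) ∈ (Ideal.span {x 1}).map (algebraMap E L) := by
    rwa [Ideal.map_span, Set.image_singleton]
  obtain ⟨s, hs, hsx⟩ := (IsLocalization.algebraMap_mem_map_algebraMap_iff
    (pointIdeal α).primeCompl L _ _).1 h3
  obtain ⟨c, hc⟩ := Ideal.mem_span_singleton.1 hsx
  have h4 := congrArg (D.map E α) hc
  rw [map_mul, map_mul, ha, hb] at h4
  exact (D.isUnit_map hs).dvd_mul_left.1 ⟨_, h4⟩

end EtaleColimit

end EtaleColimit

end MixedNP

namespace MixedNP

universe u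

open IsLocalRing

/-! ### A coefficient field of `R` -/

section Section

/-- The field is an algebraic, hence separable, extension of a purely transcendental one. -/
theorem formallySmooth_rat (K : Type*) [Field K] [CharZero K] [Algebra ℚ K] :
    Algebra.FormallySmooth ℚ K := by
  obtain ⟨s, hs⟩ := exists_isTranscendenceBasis ℚ K
  have : Algebra.IsAlgebraic (IntermediateField.adjoin ℚ (Set.range ((↑) : s → K))) K :=
    hs.isAlgebraic_field
  exact Algebra.FormallySmooth.of_algebraicIndependent_of_isSeparable hs.1

variable (R : Type*) [CommRing R] [IsLocalRing R] [IsAdicComplete (maximalIdeal R) R]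
  [CharZero (ResidueField R)]

/-- A complete local ring with residue field of characteristic zero contains a copy of its residue
field. -/
theorem exists_section_residue : ∃ s : ResidueField R →+* R, ∀ x, residue R (s x) = x := by
  have hunit : ∀ n : ℤ, n ≠ 0 → IsUnit (n : R) := by
    intro n hn
    rw [← isUnit_map_iff (residue R), map_intCast, isUnit_iff_ne_zero]
    exact_mod_cast hn
  -- Nonzero integers are units of `R`, so `R` is a `ℚ`-algebra. Formal smoothness and completeness
  -- then lift the identity of the residue field to `R`.
  let j : ℚ →+* R := IsLocalization.lift (M := nonZeroDivisors ℤ) (g := Int.castRingHom R)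
    (fun n => hunit n (nonZeroDivisors.ne_zero n.2))
  let _ : Algebra ℚ R := j.toAlgebra
  have : Algebra.FormallySmooth ℚ (R ⧸ maximalIdeal R) := by
    have : CharZero (R ⧸ maximalIdeal R) := inferInstanceAs (CharZero (ResidueField R))
    exact @formallySmooth_rat (R ⧸ maximalIdeal R) (Ideal.Quotient.field _) this
      (Ideal.instAlgebraQuotient ℚ (maximalIdeal R))
  obtain ⟨g, hg⟩ := Algebra.FormallySmooth.exists_mkₐ_comp_eq_of_isAdicComplete
    (AlgHom.id ℚ (R ⧸ maximalIdeal R))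
  exact ⟨g.toRingHom, fun x => DFunLike.congr_fun hg x⟩

end Section

/-! ### The node modulo `v` -/

section Node

theorem nodeU_mul_nodeV {R : Type u} [CommRing R] (π : R) :
    nodeU π * nodeV π = algebraMap R (Node π) π := by
  rw [nodeU, nodeV, ← map_mul]
  exact (Ideal.Quotient.mk_eq_mk_iff_sub_mem _ _).2 (Ideal.mem_span_singleton_self _)

section Poly

variable {R : Type u} [CommRing R] [IsDomain R] [IsDiscreteValuationRing R] (π : R)
  {s : ResidueField R →+* R}

/-- The map from `k[u]` that belongs to a section of the residue map. -/
noncomputable def nodePoly (s : ResidueField R →+* R) : (ResidueField R)[X] →+* Node π :=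
  eval₂RingHom ((algebraMap R (Node π)).comp s) (nodeU π)

theorem nodePoly_X : nodePoly π s X = nodeU π := by simp [nodePoly]

theorem nodePoly_C (c : ResidueField R) : nodePoly π s (C c) = algebraMap R (Node π) (s c) := by
  simp [nodePoly]

end Poly

variable {R : Type u} [CommRing R] [IsDomain R] [IsDiscreteValuationRing R] (π : R)
  [hπ : Fact (Irreducible π)]

theorem residue_uniformizer : residue R π = 0 := by
  rw [residue_eq_zero_iff]
  exact (mem_maximalIdeal _).2 hπ.out.not_isUnit

/-- The reduction of `R[u, v] / (u v - π)` modulo `v`. -/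
noncomputable def nodeModV : Node π →+* (ResidueField R)[X] :=
  Ideal.Quotient.lift _
    (MvPolynomial.eval₂Hom (C.comp (residue R)) ![X, 0]) (by
      intro a ha
      obtain ⟨b, rfl⟩ := Ideal.mem_span_singleton'.1 ha
      simp [residue_uniformizer π])

theorem nodeModV_nodeU : nodeModV π (nodeU π) = X := by simp [nodeModV, nodeU]

theorem nodeModV_nodeV : nodeModV π (nodeV π) = 0 := by simp [nodeModV, nodeV]

theorem nodeModV_algebraMap (r : R) : nodeModV π (algebraMap R (Node π) r) = C (residue R r) := by
  change MvPolynomial.eval₂Hom _ _ (MvPolynomial.C r) = _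
  simp

theorem nodeEval_eq_coeff (n : Node π) : nodeEval π hπ.out n = (nodeModV π n).coeff 0 := by
  obtain ⟨p, rfl⟩ := Ideal.Quotient.mk_surjective n
  change MvPolynomial.eval₂Hom _ _ p =
    (MvPolynomial.eval₂Hom (C.comp (residue R)) ![X, 0] p).coeff 0
  rw [← constantCoeff_apply, ← RingHom.comp_apply]
  congr 1
  ext i
  · simp
  · fin_cases i <;> simp

theorem nodeModV_ne_zero {n : Node π} (h : n ∉ nodeIdeal π) : nodeModV π n ≠ 0 := by
  intro h0
  refine h ?_
  rw [nodeIdeal_eq_ker π hπ.out, RingHom.mem_ker, nodeEval_eq_coeff, h0, coeff_zero]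

variable {s : ResidueField R →+* R}

theorem nodeModV_nodePoly (hs : ∀ x, residue R (s x) = x) (p : (ResidueField R)[X]) :
    nodeModV π (nodePoly π s p) = p := by
  suffices (nodeModV π).comp (nodePoly π s) = RingHom.id _ from congrArg (fun f => f p) this
  ext
  · simp [nodePoly_C, nodeModV_algebraMap, hs]
  · simp [nodePoly_X, nodeModV_nodeU]

/-- Modulo `v` the uniformizer `π = u v` vanishes, so a constant `r` agrees with the lift of its
residue. Hence the node modulo `v` is `k[u]`. -/
theorem nodeV_dvd_sub (hs : ∀ x, residue R (s x) = x) (n : Node π) :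
    nodeV π ∣ n - nodePoly π s (nodeModV π n) := by
  obtain ⟨p, rfl⟩ := Ideal.Quotient.mk_surjective n
  induction p using MvPolynomial.induction_on with
  | C r =>
    have h : (Ideal.Quotient.mk _ (MvPolynomial.C r) : Node π) = algebraMap R (Node π) r := rfl
    rw [h, nodeModV_algebraMap, nodePoly_C, ← map_sub]
    have h1 : r - s (residue R r) ∈ maximalIdeal R := by
      rw [← residue_eq_zero_iff, map_sub, hs, sub_self]
    rw [hπ.out.maximalIdeal_eq, Ideal.mem_span_singleton] at h1
    obtain ⟨c, hc⟩ := h1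
    rw [hc, map_mul, ← nodeU_mul_nodeV]
    exact ((dvd_mul_left _ _).mul_right _)
  | add p q hp hq =>
    simp only [map_add]
    rw [add_sub_add_comm]
    exact dvd_add hp hq
  | mul_X p i hp =>
    simp only [map_mul]
    have hi : nodeV π ∣ (Ideal.Quotient.mk _ (MvPolynomial.X i) : Node π) -
        nodePoly π s (nodeModV π (Ideal.Quotient.mk _ (MvPolynomial.X i))) := by
      fin_cases i
      · change nodeV π ∣ nodeU π - nodePoly π s (nodeModV π (nodeU π))
        simp [nodeModV_nodeU, nodePoly_X]
      · change nodeV π ∣ nodeV π - nodePoly π s (nodeModV π (nodeV π))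
        simp [nodeModV_nodeV]
    obtain ⟨c, hc⟩ := hp
    obtain ⟨d, hd⟩ := hi
    exact ⟨c * Ideal.Quotient.mk _ (MvPolynomial.X i) + nodePoly π s (nodeModV π _) * d, by
      linear_combination Ideal.Quotient.mk _ (MvPolynomial.X i) * hc +
        nodePoly π s (nodeModV π (Ideal.Quotient.mk _ p)) * hd⟩

theorem nodeV_dvd_iff (hs : ∀ x, residue R (s x) = x) {n : Node π} :
    nodeV π ∣ n ↔ nodeModV π n = 0 := by
  constructor
  · rintro ⟨c, rfl⟩
    rw [map_mul, nodeModV_nodeV, zero_mul]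
  · intro h
    simpa [h] using nodeV_dvd_sub π hs n

/-- The variable `v` is prime and does not divide the nonzero constant `π`. It follows that `v` is a
nonzerodivisor modulo `u v - π`. -/
theorem X_one_dvd_of_dvd {q : MvPolynomial (Fin 2) R}
    (h : MvPolynomial.X 1 ∣ (MvPolynomial.X 0 * MvPolynomial.X 1 - MvPolynomial.C π) * q) :
    MvPolynomial.X 1 ∣ q := by
  have h1 : (MvPolynomial.X 1 : MvPolynomial (Fin 2) R) ∣ MvPolynomial.C π * q := by
    rw [sub_mul] at h
    exact (dvd_sub_right ((dvd_mul_left _ _).mul_right _)).1 h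
  refine (MvPolynomial.X_prime.dvd_or_dvd h1).resolve_left fun h2 => ?_
  simpa [hπ.out.ne_zero] using MvPolynomial.X_dvd_monomial.1 h2

theorem eq_zero_of_nodeV_mul_eq_zero {n : Node π} (h : nodeV π * n = 0) : n = 0 := by
  obtain ⟨p, rfl⟩ := Ideal.Quotient.mk_surjective n
  rw [nodeV, ← map_mul, Ideal.Quotient.eq_zero_iff_mem, Ideal.mem_span_singleton] at h
  obtain ⟨q, hq⟩ := h
  obtain ⟨r, rfl⟩ := X_one_dvd_of_dvd π ⟨p, hq.symm⟩
  rw [Ideal.Quotient.eq_zero_iff_mem, Ideal.mem_span_singleton]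
  refine ⟨r, mul_left_cancel₀ (MvPolynomial.X_ne_zero (1 : Fin 2)) ?_⟩
  rw [hq]
  ring

/-- The image of `u` in the local ring. -/
noncomputable def localU : NodeLocal π := algebraMap (Node π) (NodeLocal π) (nodeU π)

/-- The image of `v` in the local ring. -/
noncomputable def localV : NodeLocal π := algebraMap (Node π) (NodeLocal π) (nodeV π)

/-- The map `k[u] → A` that belongs to a section of the residue map. -/
noncomputable def localPoly (s : ResidueField R →+* R) : (ResidueField R)[X] →+* NodeLocal π :=
  (algebraMap (Node π) (NodeLocal π)).comp (nodePoly π s)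

theorem localPoly_X : localPoly π s X = localU π := by simp [localPoly, nodePoly_X, localU]

theorem localPoly_C (c : ResidueField R) :
    localPoly π s (C c) = algebraMap R (NodeLocal π) (s c) := by
  rw [localPoly, RingHom.comp_apply, nodePoly_C, ← IsScalarTower.algebraMap_apply]

theorem maximalIdeal_nodeLocal : maximalIdeal (NodeLocal π) = Ideal.span {localU π, localV π} := by
  rw [← Localization.AtPrime.map_eq_maximalIdeal]
  change Ideal.map _ (Ideal.span {nodeU π, nodeV π, algebraMap R (Node π) π}) = _
  rw [Ideal.map_span, Set.image_insert_eq, Set.image_pair]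
  apply le_antisymm
  · rw [Ideal.span_le]
    rintro _ (rfl | rfl | rfl)
    · exact Ideal.subset_span (by simp [localU])
    · exact Ideal.subset_span (by simp [localV])
    · rw [← nodeU_mul_nodeV, map_mul]
      exact Ideal.mul_mem_left _ _ (Ideal.subset_span (by simp [localV]))
  · refine Ideal.span_mono ?_
    rintro _ (rfl | rfl)
    · exact Or.inl rfl
    · exact Or.inr (Or.inl rfl)

theorem eq_zero_of_localV_mul_eq_zero {a : NodeLocal π} (h : localV π * a = 0) : a = 0 := by
  obtain ⟨n, w, rfl⟩ := IsLocalization.exists_mk'_eq (nodeIdeal π).primeCompl a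
  rw [localV, ← IsLocalization.mk'_one (M := (nodeIdeal π).primeCompl) (NodeLocal π),
    ← IsLocalization.mk'_mul, IsLocalization.mk'_eq_zero_iff] at h
  obtain ⟨t, ht⟩ := h
  rw [IsLocalization.mk'_eq_zero_iff]
  exact ⟨t, eq_zero_of_nodeV_mul_eq_zero π (by linear_combination ht)⟩

/-- Modulo `v` the denominators become nonzero elements of the domain `k[u]`, in which `u` can be
cancelled. -/
theorem localV_dvd_of_localU_mul (hs : ∀ x, residue R (s x) = x) {a b : NodeLocal π}
    (h : localU π * a = localV π * b) : localV π ∣ a := by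
  obtain ⟨n, w, rfl⟩ := IsLocalization.exists_mk'_eq (nodeIdeal π).primeCompl a
  obtain ⟨m, w', rfl⟩ := IsLocalization.exists_mk'_eq (nodeIdeal π).primeCompl b
  rw [localU, localV, ← IsLocalization.mk'_one (M := (nodeIdeal π).primeCompl) (NodeLocal π),
    ← IsLocalization.mk'_one (M := (nodeIdeal π).primeCompl) (NodeLocal π),
    ← IsLocalization.mk'_mul, ← IsLocalization.mk'_mul, IsLocalization.mk'_eq_iff_eq,
    IsLocalization.eq_iff_exists (nodeIdeal π).primeCompl] at h
  obtain ⟨t, ht⟩ := h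
  have h1 := congrArg (nodeModV π) ht
  simp only [map_mul, nodeModV_nodeU, nodeModV_nodeV, zero_mul, mul_zero, Submonoid.coe_mul,
    mul_eq_zero, X_ne_zero, false_or, nodeModV_ne_zero π t.2, nodeModV_ne_zero π w'.2,
    OneMemClass.coe_one, map_one, one_ne_zero] at h1
  obtain ⟨c, hc⟩ := (nodeV_dvd_iff π hs).2 h1
  refine ⟨IsLocalization.mk' _ c w, ?_⟩
  rw [hc, localV, ← IsLocalization.mul_mk'_eq_mk'_of_mul]

theorem isUnit_localPoly (hs : ∀ x, residue R (s x) = x) {d : (ResidueField R)[X]}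
    (hd : ¬ X ∣ d) : IsUnit (localPoly π s d) := by
  rw [localPoly, RingHom.comp_apply, IsLocalization.AtPrime.isUnit_to_map_iff _ (nodeIdeal π)]
  intro h
  have h' : nodePoly π s d ∈ nodeIdeal π := h
  rw [nodeIdeal_eq_ker π hπ.out, RingHom.mem_ker, nodeEval_eq_coeff, nodeModV_nodePoly π hs] at h'
  exact hd (X_dvd_iff.2 h')

theorem exists_localV_dvd_sub (hs : ∀ x, residue R (s x) = x) (a : NodeLocal π) :
    ∃ p d, ¬ X ∣ d ∧ localV π ∣ localPoly π s d * a - localPoly π s p := by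
  obtain ⟨n, w, rfl⟩ := IsLocalization.exists_mk'_eq (nodeIdeal π).primeCompl a
  refine ⟨nodeModV π n, nodeModV π w, fun h => w.2 ?_, ?_⟩
  · refine (nodeIdeal_eq_ker π hπ.out).ge (RingHom.mem_ker.2 ?_)
    rw [nodeEval_eq_coeff]
    exact X_dvd_iff.1 h
  · obtain ⟨c, hc⟩ := nodeV_dvd_sub π hs n
    obtain ⟨d, hd⟩ := nodeV_dvd_sub π hs w
    have key : ∀ {S : Type u} [CommRing S] {n w x pn pw v c d : S}, n - pn = v * c →
        w - pw = v * d → x * w = n → pw * x - pn = v * (c - d * x) := by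
      intro S _ n w x pn pw v c d h1 h2 h3
      linear_combination h1 - x * h2 + h3
    have h1 := congrArg (algebraMap (Node π) (NodeLocal π)) hc
    have h2 := congrArg (algebraMap (Node π) (NodeLocal π)) hd
    have h3 := IsLocalization.mk'_spec (NodeLocal π) n w
    simp only [map_sub, map_mul] at h1 h2
    simp only [localPoly, localV, RingHom.comp_apply]
    exact ⟨_, key (S := NodeLocal π) h1 h2 h3⟩

instance : IsNoetherianRing (NodeLocal π) :=
  IsLocalization.isNoetherianRing (nodeIdeal π).primeCompl _ inferInstance

end Node

end MixedNP

namespace MixedNP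

universe u v w

open IsLocalRing

/-! ### Regular sequences and primality -/

section Regular

variable {B : Type*} [CommRing B] {p q : B}

/-- Modulo `q`, any element outside `(q)` is a power of `p` times a unit. Separatedness supplies a
largest exponent, and the cofactor must be a unit since otherwise the exponent could be raised.
Powers of `p` can be cancelled modulo `q`. -/
theorem prime_of_regular (hunit : ∀ b, b ∉ Ideal.span {p, q} → IsUnit b)
    (hne : Ideal.span {p, q} ≠ ⊤) (hq : ∀ b, q * b = 0 → b = 0)
    (hpq : ∀ b, q ∣ p * b → q ∣ b) (hcl : ∀ b, (∀ n : ℕ, b ∈ Ideal.span {q, p ^ n}) → q ∣ b) :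
    Prime q := by
  have h1 : (1 : B) ∉ Ideal.span {p, q} := fun h => hne ((Ideal.eq_top_iff_one _).2 h)
  have hpow : ∀ (n : ℕ) b, q ∣ p ^ n * b → q ∣ b := by
    intro n
    induction n with
    | zero => simp
    | succ n ih =>
      intro b hb
      rw [pow_succ', mul_assoc] at hb
      exact ih b (hpq _ hb)
  refine ⟨?_, ?_, fun a b hab => ?_⟩
  · rintro rfl
    exact h1 (by rw [hq 1 (zero_mul 1)]; exact zero_mem _)
  · intro hu
    exact hne (Ideal.eq_top_of_isUnit_mem _ (Ideal.subset_span (by simp)) hu)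
  · by_contra! hn
    obtain ⟨ha, hb⟩ := hn
    have hex : ∃ n : ℕ, a ∉ Ideal.span {q, p ^ n} := by
      by_contra! h
      exact ha (hcl a h)
    classical
    obtain ⟨n, hn⟩ : ∃ n, Nat.find hex = n + 1 := by
      refine Nat.exists_eq_succ_of_ne_zero fun h0 => ?_
      have := Nat.find_spec hex
      rw [h0] at this
      exact this (by
        rw [pow_zero]
        exact Ideal.mem_span_pair.2 ⟨0, a, by simp⟩)
    have h2 : a ∉ Ideal.span {q, p ^ (n + 1)} := hn ▸ Nat.find_spec hex
    obtain ⟨c, d, hcd⟩ := Ideal.mem_span_pair.1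
      (not_not.1 (Nat.find_min hex (m := n) (by omega)))
    have hd : IsUnit d := by
      refine hunit d fun hd => h2 ?_
      obtain ⟨x, y, hxy⟩ := Ideal.mem_span_pair.1 hd
      exact Ideal.mem_span_pair.2 ⟨c + y * p ^ n, x, by rw [← hcd, ← hxy]; ring⟩
    refine hb (hpow n b (hd.dvd_mul_right.1 ?_))
    have : p ^ n * b * d = a * b - q * (c * b) := by rw [← hcd]; ring
    rw [this]
    exact dvd_sub hab (dvd_mul_right _ _)

/-- After removal of its powers of `q`, the element `a` is prime to `q`. Then `a b = 0` makes `b`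
divisible by `q`, the quotient satisfies the same equation, and so `b` lies in every power of `(q)`.
-/
theorem noZeroDivisors_of_prime (hp : Prime q) (hq : ∀ b, q * b = 0 → b = 0)
    (hcl : ∀ b, (∀ n : ℕ, q ^ n ∣ b) → b = 0) : NoZeroDivisors B := by
  refine ⟨fun {a b} hab => ?_⟩
  by_contra! hn
  obtain ⟨ha, hb⟩ := hn
  have hfin : FiniteMultiplicity q a := by
    by_contra h
    rw [FiniteMultiplicity] at h
    push Not at h
    exact ha (hcl a fun n => (pow_dvd_pow q n.le_succ).trans (h n))
  obtain ⟨a', ha', hnd⟩ := hfin.exists_eq_pow_mul_and_not_dvd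
  have hpow : ∀ (n : ℕ) b, q ^ n * b = 0 → b = 0 := by
    intro n
    induction n with
    | zero => simp
    | succ n ih =>
      intro b hb
      rw [pow_succ, mul_assoc] at hb
      exact hq b (ih _ hb)
  have h0 : a' * b = 0 := hpow _ _ (by rw [← mul_assoc, ← ha', hab])
  have key : ∀ (n : ℕ) (b : B), a' * b = 0 → q ^ n ∣ b := by
    intro n
    induction n with
    | zero => simp
    | succ n ih =>
      intro b hb
      obtain ⟨c, rfl⟩ := (hp.dvd_or_dvd (hb ▸ dvd_zero q)).resolve_left hnd
      rw [pow_succ']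
      exact mul_dvd_mul_left _ (ih c (hq _ (by linear_combination hb)))
  exact hb (hcl b fun n => key n b h0)

theorem mk_dvd_mk_iff {a : B} : Ideal.Quotient.mk (Ideal.span {q}) p ∣ Ideal.Quotient.mk _ a ↔
    a ∈ Ideal.span {p, q} := by
  rw [Ideal.mem_span_pair]
  constructor
  · rintro ⟨c, hc⟩
    obtain ⟨c, rfl⟩ := Ideal.Quotient.mk_surjective c
    rw [← map_mul, Ideal.Quotient.mk_eq_mk_iff_sub_mem, Ideal.mem_span_singleton] at hc
    obtain ⟨d, hd⟩ := hc
    exact ⟨c, d, by linear_combination -hd⟩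
  · rintro ⟨c, d, rfl⟩
    have : Ideal.Quotient.mk (Ideal.span {q}) (d * q) = 0 :=
      Ideal.Quotient.eq_zero_iff_mem.2 (Ideal.mul_mem_left _ _ (Ideal.mem_span_singleton_self q))
    rw [map_add, this, add_zero, map_mul]
    exact dvd_mul_left _ _

theorem mk_eq_zero_iff_dvd {a : B} : Ideal.Quotient.mk (Ideal.span {q}) a = 0 ↔ q ∣ a := by
  rw [Ideal.Quotient.eq_zero_iff_mem, Ideal.mem_span_singleton]

end Regular

/-- The properties of the strict Henselization `B` of the node that are used: the map `ψ` from
`k[u]` to `A` identifies `A / (w)` with a localization of `k[u]`. -/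
structure NodeModel {A B k : Type*} [CommRing A] [CommRing B] [Algebra A B] [Field k]
    (ψ : k[X] →+* A) (w : A) (u v : B) : Prop where
  map_X : algebraMap A B (ψ X) = u
  map_w : algebraMap A B w = v
  prime : Prime v
  ne_top : Ideal.span {u, v} ≠ ⊤
  isUnit : ∀ b, b ∉ Ideal.span {u, v} → IsUnit b
  uniformized : Uniformized ((Ideal.Quotient.mk (Ideal.span {v})).comp ((algebraMap A B).comp ψ))
  closed : ∀ a b t : B, t ∈ Ideal.span {u, v} → (∀ n : ℕ, a ∈ Ideal.span {b, t ^ n}) → b ∣ a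
  isUnit_poly : ∀ d, ¬ X ∣ d → IsUnit (ψ d)
  exists_fraction : ∀ a, ∃ p d, ¬ X ∣ d ∧ w ∣ ψ d * a - ψ p
  exists_root : ∀ (P : StandardEtalePair A) (c : k), ¬ IsUnit (P.f.eval (ψ (C c))) →
    IsUnit (P.g.eval (ψ (C c))) → ∃ (z : B) (hz : P.HasMap z),
      z - algebraMap A B (ψ (C c)) ∈ Ideal.span {u, v} ∧ (P.lift z hz).toRingHom.Flat

/-! ### The ring `B` as a model of the strict Henselization -/

section Algebraic

/-- Base change to the field `F` makes an étale algebra finite over `F`, and the map to `Q` factors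
through it. -/
theorem isIntegral_of_etale {A E F Q : Type*} [CommRing A] [CommRing E] [Field F] [Field Q]
    [Algebra A E] [Algebra.Etale A E] [Algebra A F] [Algebra F Q] [Algebra A Q]
    [IsScalarTower A F Q] (f : E →ₐ[A] Q) (x : E) : IsIntegral F (f x) := by
  have hfin : Module.Finite F (TensorProduct A F E) :=
    Algebra.FormallyUnramified.finite_of_free F _
  let g : TensorProduct A F E →ₐ[F] Q :=
    Algebra.TensorProduct.lift (Algebra.ofId F Q) f (fun _ _ => Commute.all _ _)
  have h : g (Algebra.TensorProduct.includeRight x) = f x :=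
    DFunLike.congr_fun (Algebra.TensorProduct.lift_comp_includeRight (Algebra.ofId F Q) f
      (fun _ _ => Commute.all _ _)) x
  rw [← h]
  exact (Algebra.IsIntegral.isIntegral (Algebra.TensorProduct.includeRight x)).map g

theorem exists_eval₂_eq_zero_of_isIntegral {k O Q : Type*} [Field k] [CommRing O] [IsDomain O]
    [Field Q] [Algebra O Q] [FaithfulSMul O Q] {φ : k[X] →+* O} (hφ : Function.Injective φ) {b : O}
    (hb : IsIntegral (generatedField Q φ ∅) (algebraMap O Q b)) :
    ∃ P : k[X][X], P ≠ 0 ∧ P.eval₂ φ b = 0 := by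
  set F := generatedField Q φ ∅
  have hinj : Function.Injective (algebraMap O Q) := FaithfulSMul.algebraMap_injective O Q
  let χ : k[X] →+* F := ((algebraMap O Q).comp φ).codRestrict F (map_mem_generatedField ∅)
  let _ : Algebra k[X] F := χ.toAlgebra
  let _ : Algebra k[X] Q := ((algebraMap O Q).comp φ).toAlgebra
  have : IsScalarTower k[X] F Q := .of_algebraMap_eq fun _ => rfl
  have hχ : Function.Injective χ := fun a c hac =>
    hφ (hinj (congrArg (algebraMap F Q) hac))
  have hrange : Subring.closure (Set.range φ ∪ ∅) = φ.range := by
    rw [Set.union_empty, ← RingHom.coe_range, Subring.closure_eq]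
  have : Algebra.IsAlgebraic k[X] F := by
    refine ⟨fun x => ?_⟩
    have : FaithfulSMul k[X] F := (faithfulSMul_iff_algebraMap_injective k[X] F).2 hχ
    obtain ⟨y, hy, c, hc, hx⟩ := exists_div_of_mem_generatedField x.2
    rw [hrange] at hy hc
    obtain ⟨y, rfl⟩ := hy
    obtain ⟨c, rfl⟩ := hc
    have hx' : x = algebraMap k[X] F y / algebraMap k[X] F c := Subtype.ext hx.symm
    rw [hx', div_eq_mul_inv]
    exact (isAlgebraic_algebraMap y).mul (isAlgebraic_algebraMap c).inv
  obtain ⟨P, hP, h0⟩ := hb.isAlgebraic.restrictScalars k[X]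
  refine ⟨P, hP, hinj ?_⟩
  rw [map_zero, hom_eval₂, ← h0, aeval_def]
  rfl

end Algebraic

section Construction

variable {A : Type u} {B : Type v} {κ : Type w} [CommRing A] [CommRing B] [Algebra A B] [Field κ]
  [Algebra A κ]

theorem EtaleColimit.isIntegral_of_forall_mem (D : EtaleColimit A B κ) {Q : Type*} [Field Q]
    (g : B →+* Q) {F : Subfield Q} (hF : ∀ a, g (algebraMap A B a) ∈ F) (b : B) :
    IsIntegral F (g b) := by
  let _ : Algebra A F := ((g.comp (algebraMap A B)).codRestrict F hF).toAlgebra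
  let _ : Algebra A Q := (g.comp (algebraMap A B)).toAlgebra
  have : IsScalarTower A F Q := .of_algebraMap_eq fun _ => rfl
  obtain ⟨E, _, _, _, α, x, rfl⟩ := D.exists_map_eq b
  let f : E →ₐ[A] Q :=
    { g.comp (D.map E α).toRingHom with
      commutes' := fun a => congrArg g ((D.map E α).commutes a) }
  exact isIntegral_of_etale f x

variable [IsLocalRing A] [IsNoetherianRing A] [IsLocalHom (algebraMap A κ)]

/-- The sequence `w, ψ X` is regular in `A`, and flatness transports this to `B`. Closedness of
principal ideals comes from Krull's theorem in the étale algebras, algebraicity from their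
finiteness over fields, and the Hensel property from the fact that standard étale algebras with a
`κ`-point occur in the colimit. -/
theorem EtaleColimit.nodeModel (D : EtaleColimit A B κ) {k : Type*} [Field k] (ψ : k[X] →+* A)
    (w : A) (hmax : maximalIdeal A = Ideal.span {ψ X, w}) (hw : ∀ a, w * a = 0 → a = 0)
    (hu : ∀ a b, ψ X * a = w * b → w ∣ a) (hunit : ∀ d, ¬ X ∣ d → IsUnit (ψ d))
    (hbase : ∀ a, ∃ p d, ¬ X ∣ d ∧ w ∣ ψ d * a - ψ p)
    (hκ : ∀ x : κ, ∃ c, algebraMap A κ (ψ (C c)) = x) :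
    IsDomain B ∧ NodeModel ψ w (algebraMap A B (ψ X)) (algebraMap A B w) := by
  have hne := D.map_maximalIdeal_ne_top hmax
  set u := algebraMap A B (ψ X) with hudef
  set v := algebraMap A B w with hvdef
  have hm : (maximalIdeal A).map (algebraMap A B) = Ideal.span {u, v} := by
    rw [hmax, Ideal.map_span, Set.image_pair]
  have hflat := D.flat_algebraMap
  have hunitB : ∀ b, b ∉ Ideal.span {u, v} → IsUnit b := fun b hb =>
    D.isUnit_of_notMem (hm ▸ hb)
  have hcl : ∀ a b t : B, t ∈ Ideal.span {u, v} → (∀ n : ℕ, a ∈ Ideal.span {b, t ^ n}) → b ∣ a :=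
    fun a b t ht h => D.dvd_of_forall_mem_span hne (hm ▸ ht) h
  have hum : u ∈ Ideal.span {u, v} := Ideal.subset_span (by simp)
  have hvm : v ∈ Ideal.span {u, v} := Ideal.subset_span (by simp)
  have hv0 : ∀ b, v * b = 0 → b = 0 := by
    intro b hb
    have := dvd_of_mul_eq_mul hflat (p := w) (q := 0) (a := b) (b := 0)
      (fun a _ h => by rw [hw a (by rw [h, zero_mul])]) (by rw [← hvdef, hb, mul_zero])
    rwa [map_zero, zero_dvd_iff] at this
  have huv : ∀ b, v ∣ u * b → v ∣ b := by
    rintro b ⟨c, hc⟩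
    exact dvd_of_mul_eq_mul hflat hu hc
  have hvsep : ∀ b, (∀ n : ℕ, v ^ n ∣ b) → b = 0 := fun b h =>
    zero_dvd_iff.1 (hcl b 0 v hvm fun n => Ideal.mem_span_pair.2 (by
      obtain ⟨c, hc⟩ := h n
      exact ⟨0, c, by rw [hc]; ring⟩))
  have hne' : Ideal.span {u, v} ≠ ⊤ := hm ▸ hne
  have hvp : Prime v := prime_of_regular hunitB hne' hv0 huv fun b h => hcl b v u hum h
  have hnz := noZeroDivisors_of_prime hvp hv0 hvsep
  have hnt : Nontrivial B := ⟨⟨v, 0, hvp.ne_zero⟩⟩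
  have hdom : IsDomain B := NoZeroDivisors.to_isDomain B
  have hnonunit : ∀ b, b ∈ Ideal.span {u, v} → ¬ IsUnit b := fun b hb h =>
    hne' (Ideal.eq_top_of_isUnit_mem _ hb h)
  have hresidue : ∀ b, ∃ c, b - algebraMap A B (ψ (C c)) ∈ Ideal.span {u, v} := by
    intro b
    obtain ⟨E, _, _, _, α, x, rfl⟩ := D.exists_map_eq b
    obtain ⟨c, hc⟩ := hκ (α x)
    refine ⟨c, ?_⟩
    rw [← hm, ← (D.map E α).commutes, ← map_sub, D.map_mem_iff hne, map_sub, α.commutes, hc,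
      sub_self]
  refine ⟨hdom, rfl, rfl, hvp, hne', hunitB, ?_, hcl, hunit, hbase, ?_⟩
  · set φ := (Ideal.Quotient.mk (Ideal.span {v})).comp ((algebraMap A B).comp ψ) with hφ
    have hprime : (Ideal.span {v}).IsPrime := (Ideal.span_singleton_prime hvp.ne_zero).2 hvp
    have hφX : φ X = Ideal.Quotient.mk _ u := rfl
    have hφp : Prime (φ X) := by
      rw [hφX]
      refine ⟨?_, fun h => ?_, fun a b hab => ?_⟩
      · rw [Ne, mk_eq_zero_iff_dvd]
        intro h
        exact hvp.not_isUnit (isUnit_of_dvd_one (huv 1 (by rwa [mul_one])))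
      · have : Ideal.Quotient.mk (Ideal.span {v}) u ∣ Ideal.Quotient.mk _ 1 := h.dvd
        exact hne' ((Ideal.eq_top_iff_one _).2 (mk_dvd_mk_iff.1 this))
      · obtain ⟨a, rfl⟩ := Ideal.Quotient.mk_surjective a
        obtain ⟨b, rfl⟩ := Ideal.Quotient.mk_surjective b
        rw [← map_mul, mk_dvd_mk_iff] at hab
        rw [mk_dvd_mk_iff, mk_dvd_mk_iff]
        by_contra! h
        exact hnonunit _ hab ((hunitB a h.1).mul (hunitB b h.2))
    refine ⟨hφp, fun b hb => ?_, fun b => ?_, fun b hb => ?_, fun b => ?_⟩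
    · obtain ⟨b, rfl⟩ := Ideal.Quotient.mk_surjective b
      by_contra h
      rw [FiniteMultiplicity] at h
      push Not at h
      refine hb (mk_eq_zero_iff_dvd.2 (hcl b v u hum fun n => ?_))
      have h1 := (pow_dvd_pow _ n.le_succ).trans (h n)
      rw [hφX, ← map_pow, mk_dvd_mk_iff, Set.pair_comm] at h1
      exact h1
    · obtain ⟨b, rfl⟩ := Ideal.Quotient.mk_surjective b
      obtain ⟨c, hc⟩ := hresidue b
      refine ⟨c, ?_⟩
      have : Ideal.Quotient.mk (Ideal.span {v}) b - φ (C c) =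
          Ideal.Quotient.mk _ (b - algebraMap A B (ψ (C c))) := (map_sub _ _ _).symm
      rw [this, hφX, mk_dvd_mk_iff]
      exact hc
    · obtain ⟨b, rfl⟩ := Ideal.Quotient.mk_surjective b
      rw [hφX, mk_dvd_mk_iff] at hb
      exact (hunitB b hb).map _
    · obtain ⟨b, rfl⟩ := Ideal.Quotient.mk_surjective b
      let Q := FractionRing (B ⧸ Ideal.span {v})
      refine exists_eval₂_eq_zero_of_isIntegral (Q := Q) (injective_of_prime_map_X hφp) ?_
      let g : B →+* Q := (algebraMap (B ⧸ Ideal.span {v}) Q).comp (Ideal.Quotient.mk _)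
      -- Modulo `w` the elements of `A` are fractions of polynomials in `u`, so integrality over the
      -- image of `A` becomes integrality over `k(u)`.
      have hgF : ∀ a, g (algebraMap A B a) ∈ generatedField Q φ ∅ := by
        intro a
        obtain ⟨p, d, hd, e, he⟩ := hbase a
        have h1 : g (algebraMap A B (ψ d)) * g (algebraMap A B a) = g (algebraMap A B (ψ p)) := by
          rw [← map_mul, ← map_mul, ← sub_eq_zero, ← map_sub, ← map_sub, he]
          have : Ideal.Quotient.mk (Ideal.span {v}) (algebraMap A B (w * e)) = 0 := by
            rw [mk_eq_zero_iff_dvd, map_mul]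
            exact dvd_mul_right _ _
          change algebraMap (B ⧸ Ideal.span {v}) Q
            (Ideal.Quotient.mk (Ideal.span {v}) (algebraMap A B (w * e))) = 0
          rw [this, map_zero]
        have h2 : g (algebraMap A B (ψ d)) ≠ 0 := (((hunit d hd).map _).map g).ne_zero
        rw [eq_div_of_mul_eq h2 ((mul_comm _ _).trans h1)]
        exact div_mem (map_mem_generatedField ∅ p) (map_mem_generatedField ∅ d)
      exact D.isIntegral_of_forall_mem g hgF b
  · intro P c hf hg
    -- The two conditions on `c` say that it defines a `κ`-point of the standard étale algebra; the
    -- image of its generator in `B` is the desired root.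
    have hP : P.HasMap (algebraMap A κ (ψ (C c))) := by
      constructor
      · rw [aeval_algebraMap_apply_eq_algebraMap_eval, EtaleColimit.algebraMap_eq_zero_iff]
        exact hf
      · rw [aeval_algebraMap_apply_eq_algebraMap_eval]
        exact hg.map _
    have hz := P.hasMap_X.map (D.map P.Ring (P.lift _ hP))
    refine ⟨D.map P.Ring (P.lift _ hP) P.X, hz, ?_, ?_⟩
    · rw [← hm, ← (D.map P.Ring (P.lift _ hP)).commutes, ← map_sub, D.map_mem_iff hne, map_sub,
        P.lift_X, AlgHom.commutes, sub_self]
    · have : P.lift _ hz = D.map P.Ring (P.lift _ hP) := StandardEtalePair.hom_ext (P.lift_X _ _)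
      rw [this]
      exact D.flat_map _

end Construction

end MixedNP

namespace MixedNP

universe u v w

open IsLocalRing

section Instance

theorem exists_residue_sub_mem {k : Type*} {A : Type u} [Field k] [CommRing A] [IsLocalRing A]
    {ψ : k[X] →+* A} {w : A} (hmax : maximalIdeal A = Ideal.span {ψ X, w})
    (hunit : ∀ d, ¬ X ∣ d → IsUnit (ψ d)) (hbase : ∀ a, ∃ p d, ¬ X ∣ d ∧ w ∣ ψ d * a - ψ p)
    (a : A) : ∃ c, a - ψ (C c) ∈ maximalIdeal A := by
  obtain ⟨p, d, hd, hw⟩ := hbase a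
  have hX : ∀ q : k[X], ψ q - ψ (C (q.coeff 0)) ∈ maximalIdeal A := by
    intro q
    rw [← map_sub, hmax]
    obtain ⟨r, hr⟩ : X ∣ q - C (q.coeff 0) := by simp [X_dvd_iff]
    rw [hr, map_mul]
    exact Ideal.mul_mem_right _ _ (Ideal.subset_span (by simp))
  have hw' : ψ d * a - ψ p ∈ maximalIdeal A := by
    obtain ⟨c, hc⟩ := hw
    rw [hc, hmax]
    exact Ideal.mul_mem_right _ _ (Ideal.subset_span (by simp))
  have hd0 : d.coeff 0 ≠ 0 := fun h => hd (X_dvd_iff.2 h)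
  refine ⟨p.coeff 0 / d.coeff 0, ?_⟩
  have h1 : ψ (C (d.coeff 0)) * ψ (C (p.coeff 0 / d.coeff 0)) = ψ (C (p.coeff 0)) := by
    rw [← map_mul, ← C_mul, mul_div_cancel₀ _ hd0]
  have h2 : ψ d * (a - ψ (C (p.coeff 0 / d.coeff 0))) ∈ maximalIdeal A := by
    have h3 := sub_mem (add_mem hw' (hX p))
      (Ideal.mul_mem_right (ψ (C (p.coeff 0 / d.coeff 0))) _ (hX d))
    convert h3 using 1
    linear_combination -h1
  exact (Ideal.unit_mul_mem_iff_mem _ (hunit d hd)).1 h2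

theorem isLocalHom_algebraMap_trans (A K L : Type*) [CommRing A] [Field K] [Field L] [Algebra A K]
    [Algebra K L] [Algebra A L] [IsScalarTower A K L] [IsLocalHom (algebraMap A K)] :
    IsLocalHom (algebraMap A L) := by
  rw [IsScalarTower.algebraMap_eq A K L]
  exact RingHom.isLocalHom_comp _ _

/-- The residue field of `A` is a copy of the algebraically closed field `k`, so its separable
closure adds nothing and every point has values in constants. -/
theorem IsStrictHenselization.nodeModel {k A : Type u} {B : Type v} [Field k] [IsAlgClosed k]
    [CommRing A] [IsLocalRing A] [IsNoetherianRing A] [CommRing B] [Algebra A B]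
    (hB : IsStrictHenselization A B) (ψ : k[X] →+* A)
    (w : A) (hmax : maximalIdeal A = Ideal.span {ψ X, w}) (hw : ∀ a, w * a = 0 → a = 0)
    (hu : ∀ a b, ψ X * a = w * b → w ∣ a) (hunit : ∀ d, ¬ X ∣ d → IsUnit (ψ d))
    (hbase : ∀ a, ∃ p d, ¬ X ∣ d ∧ w ∣ ψ d * a - ψ p) :
    IsDomain B ∧ NodeModel ψ w (algebraMap A B (ψ X)) (algebraMap A B w) := by
  obtain ⟨D⟩ := hB.nonempty_etaleColimit
  let e : k →+* ResidueField A := (residue A).comp (ψ.comp C)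
  have he : Function.Surjective e := by
    intro x
    obtain ⟨a, rfl⟩ := residue_surjective x
    obtain ⟨c, hc⟩ := exists_residue_sub_mem hmax hunit hbase a
    refine ⟨c, ?_⟩
    rw [← residue_eq_zero_iff, map_sub, sub_eq_zero] at hc
    exact hc.symm
  have : IsAlgClosed (ResidueField A) :=
    IsAlgClosed.of_ringEquiv _ _ (RingEquiv.ofBijective e ⟨e.injective, he⟩)
  have hκ := IsSepClosed.algebraMap_surjective (ResidueField A)
    (SeparableClosure (ResidueField A))
  have h1 : IsLocalHom (algebraMap A (ResidueField A)) :=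
    inferInstanceAs (IsLocalHom (residue A))
  have : IsLocalHom (algebraMap A (SeparableClosure (ResidueField A))) :=
    isLocalHom_algebraMap_trans A (ResidueField A) _
  refine D.nodeModel ψ w hmax hw hu hunit hbase fun x => ?_
  obtain ⟨y, rfl⟩ := hκ x
  obtain ⟨c, rfl⟩ := he y
  refine ⟨c, ?_⟩
  rw [IsScalarTower.algebraMap_apply A (ResidueField A)]
  rfl

theorem IsStrictHenselization.nodeModel_localPoly {R : Type u} [CommRing R] [IsDomain R]
    [IsDiscreteValuationRing R] (π : R) [Fact (Irreducible π)] {B : Type v} [CommRing B]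
    [Algebra (NodeLocal π) B] {s : ResidueField R →+* R} [IsAlgClosed (ResidueField R)]
    (hB : IsStrictHenselization (NodeLocal π) B) (hs : ∀ x, residue R (s x) = x) :
    IsDomain B ∧ NodeModel (localPoly π s) (localV π) (algebraMap (NodeLocal π) B (localU π))
      (algebraMap (NodeLocal π) B (localV π)) := by
  have h := hB.nodeModel (localPoly π s) (localV π)
    (by rw [localPoly_X]; exact maximalIdeal_nodeLocal π)
    (fun a => eq_zero_of_localV_mul_eq_zero π)
    (fun a b h => localV_dvd_of_localU_mul π hs (by rwa [localPoly_X] at h))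
    (fun d => isUnit_localPoly π hs) (exists_localV_dvd_sub π hs)
  rwa [localPoly_X] at h

end Instance

/-! ### Normality of `B` and lifting maps -/

theorem eq_of_simple_root {B : Type*} [CommRing B] [IsDomain B] {g : B[X]} {a b d : B}
    (ha : g.eval a = 0) (hb : g.eval b = 0) (hab : d ∣ b - a)
    (hu : ¬ d ∣ (derivative g).eval a) : a = b := by
  obtain ⟨c, hc⟩ := binomExpansion g a (b - a)
  rw [add_sub_cancel, ha, hb, zero_add] at hc
  have h1 : (b - a) * ((derivative g).eval a + c * (b - a)) = 0 := by linear_combination -hc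
  rcases mul_eq_zero.1 h1 with h2 | h2
  · exact (sub_eq_zero.1 h2).symm
  · refine absurd ?_ hu
    rw [eq_neg_of_add_eq_zero_left h2]
    exact (hab.mul_left c).neg_right

/-- Comparing orders, `n ord b ≤ ord c + n ord a` for all `n` forces `ord b ≤ ord a`; the exponent
`n = ord c + 1` already suffices. This is complete integral closedness of a discrete valuation ring.
-/
theorem Uniformized.dvd_of_forall_pow_dvd {k O : Type*} [Field k] [CommRing O] [IsDomain O]
    {φ : k[X] →+* O} (h : Uniformized φ) {a b c : O} (hb : b ≠ 0) (hc : c ≠ 0)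
    (hn : ∀ n : ℕ, b ^ n ∣ c * a ^ n) : b ∣ a := by
  rcases eq_or_ne a 0 with rfl | ha
  · exact dvd_zero b
  obtain ⟨a', ha', hda⟩ := (h.finiteMultiplicity a ha).exists_eq_pow_mul_and_not_dvd
  obtain ⟨b', hb', hdb⟩ := (h.finiteMultiplicity b hb).exists_eq_pow_mul_and_not_dvd
  obtain ⟨c', hc', hdc⟩ := (h.finiteMultiplicity c hc).exists_eq_pow_mul_and_not_dvd
  set r := multiplicity (φ X) a
  set s := multiplicity (φ X) b
  set N := multiplicity (φ X) c
  by_cases hrs : s ≤ r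
  · rw [hb', ha', (h.isUnit _ hdb).mul_right_dvd]
    exact (pow_dvd_pow _ hrs).mul_right _
  · exfalso
    have h1 : φ X ^ (N + r * (N + 1) + 1) ∣ φ X ^ (N + r * (N + 1)) * (c' * a' ^ (N + 1)) := by
      have h2 : φ X ^ (N + r * (N + 1)) * (c' * a' ^ (N + 1)) = c * a ^ (N + 1) := by
        rw [hc', ha', mul_pow, ← pow_mul, pow_add]
        ring
      rw [h2]
      refine Dvd.dvd.trans ?_ (hn (N + 1))
      rw [hb', mul_pow, ← pow_mul]
      refine (pow_dvd_pow _ ?_).mul_right _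
      have : (r + 1) * (N + 1) ≤ s * (N + 1) := Nat.mul_le_mul_right _ (by omega)
      linarith
    rw [pow_succ, mul_dvd_mul_iff_left (pow_ne_zero _ h.prime.ne_zero)] at h1
    exact (h.prime.dvd_or_dvd h1).elim hdc fun h2 => hda (h.prime.dvd_of_dvd_pow h2)

/-- A section of the reduction map that is compatible with the map from `k[u]`. -/
structure IsNodeLift {A B k : Type*} [CommRing A] [CommRing B] [Algebra A B] [Field k]
    (ψ : k[X] →+* A) (v : B) (σ : B ⧸ Ideal.span {v} →+* B) : Prop where
  mk_apply : ∀ c, Ideal.Quotient.mk (Ideal.span {v}) (σ c) = c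
  apply_poly : ∀ p, σ (Ideal.Quotient.mk (Ideal.span {v}) (algebraMap A B (ψ p))) =
    algebraMap A B (ψ p)

section Model

variable {A B k : Type*} [CommRing A] [CommRing B] [Algebra A B] [Field k] {ψ : k[X] →+* A}
  {w : A} {u v : B}

theorem IsLiftingMap.isNodeLift {ι : k →+* B} {σ : B ⧸ Ideal.span {v} →+* B}
    (hσ : IsLiftingMap u v ι σ) (hX : algebraMap A B (ψ X) = u)
    (hι : ∀ c, algebraMap A B (ψ (C c)) = ι c) : IsNodeLift ψ v σ := by
  refine ⟨hσ.mk_apply, fun p => ?_⟩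
  suffices (σ.comp (Ideal.Quotient.mk _)).comp ((algebraMap A B).comp ψ) =
    (algebraMap A B).comp ψ from congrArg (fun f => f p) this
  ext c
  · simpa [hι] using hσ.apply_const c
  · simpa [hX] using hσ.apply_u

theorem IsNodeLift.isLiftingMap {ι : k →+* B} {σ : B ⧸ Ideal.span {v} →+* B}
    (hσ : IsNodeLift ψ v σ) (hX : algebraMap A B (ψ X) = u)
    (hι : ∀ c, algebraMap A B (ψ (C c)) = ι c) : IsLiftingMap u v ι σ :=
  ⟨hσ.mk_apply, fun a => by rw [← hι, hσ.apply_poly], by rw [← hX, hσ.apply_poly]⟩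

namespace NodeModel

theorem isUnit_iff (h : NodeModel ψ w u v) {b : B} : IsUnit b ↔ b ∉ Ideal.span {u, v} :=
  ⟨fun hb hm => h.ne_top (Ideal.eq_top_of_isUnit_mem _ hm hb), h.isUnit b⟩

theorem mk_u (h : NodeModel ψ w u v) : ((Ideal.Quotient.mk (Ideal.span {v})).comp
    ((algebraMap A B).comp ψ)) X = Ideal.Quotient.mk (Ideal.span {v}) u := by
  rw [← h.map_X]
  rfl

theorem isUnit_of_mk (h : NodeModel ψ w u v) {b : B}
    (hb : ¬ Ideal.Quotient.mk (Ideal.span {v}) u ∣ Ideal.Quotient.mk _ b) : IsUnit b :=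
  h.isUnit b fun hm => hb (mk_dvd_mk_iff.2 hm)

theorem isPrime_span (h : NodeModel ψ w u v) : (Ideal.span {v}).IsPrime :=
  (Ideal.span_singleton_prime h.prime.ne_zero).2 h.prime

theorem isPrime_span_pair (h : NodeModel ψ w u v) : (Ideal.span {u, v}).IsPrime :=
  ⟨h.ne_top, fun {x y} hxy => by
    by_contra! hn
    exact h.isUnit_iff.1 ((h.isUnit x hn.1).mul (h.isUnit y hn.2)) hxy⟩

theorem exists_eq_pow_mul (h : NodeModel ψ w u v) {c : B} (hc : c ≠ 0) :
    ∃ (N : ℕ) (c' : B), c = v ^ N * c' ∧ ¬ v ∣ c' := by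
  have hvm : v ∈ Ideal.span {u, v} := Ideal.subset_span (by simp)
  have hfin : FiniteMultiplicity v c := by
    by_contra hf
    rw [FiniteMultiplicity] at hf
    push Not at hf
    refine hc (zero_dvd_iff.1 (h.closed c 0 v hvm fun n => Ideal.mem_span_pair.2 ?_))
    obtain ⟨e, he⟩ := (pow_dvd_pow _ n.le_succ).trans (hf n)
    exact ⟨0, e, by rw [he]; ring⟩
  obtain ⟨c', h1, h2⟩ := hfin.exists_eq_pow_mul_and_not_dvd
  exact ⟨_, c', h1, h2⟩

/-- The one-dimensional case gives `a = x b + a₁ v`, and `a₁` inherits the hypothesis. Iteration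
puts `a` into `(b, v^m)` for all `m`, and principal ideals are closed. -/
theorem dvd_of_forall_pow_dvd_of_not_dvd [IsDomain B] (h : NodeModel ψ w u v) {a b c : B}
    (hb : ¬ v ∣ b) (hc : ¬ v ∣ c) (hn : ∀ n : ℕ, b ^ n ∣ c * a ^ n) : b ∣ a := by
  have hprime := h.isPrime_span
  have key : ∀ (m : ℕ) (a : B), (∀ n : ℕ, b ^ n ∣ c * a ^ n) → a ∈ Ideal.span {b, v ^ m} := by
    intro m
    induction m with
    | zero => intro a _; exact Ideal.mem_span_pair.2 ⟨0, a, by simp⟩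
    | succ m ih =>
      intro a hn
      have h1 : Ideal.Quotient.mk (Ideal.span {v}) b ∣ Ideal.Quotient.mk _ a := by
        refine h.uniformized.dvd_of_forall_pow_dvd (b := Ideal.Quotient.mk (Ideal.span {v}) b)
          (c := Ideal.Quotient.mk _ c) ?_ ?_ fun n => ?_
        · rwa [Ne, mk_eq_zero_iff_dvd]
        · rwa [Ne, mk_eq_zero_iff_dvd]
        · rw [← map_pow, ← map_pow, ← map_mul]
          exact _root_.map_dvd _ (hn n)
      rw [mk_dvd_mk_iff, Ideal.mem_span_pair] at h1
      obtain ⟨x, a₁, rfl⟩ := h1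
      have h2 : ∀ n : ℕ, b ^ n ∣ c * a₁ ^ n := by
        intro n
        -- In the binomial expansion of `c (a - x b)^n` each term contains `c a^i b^(n-i)`, which is
        -- divisible by `b^n`.
        have h3 : b ^ n ∣ v ^ n * (c * a₁ ^ n) := by
          have : v ^ n * (c * a₁ ^ n) = c * ((x * b + a₁ * v) + -(x * b)) ^ n := by ring
          rw [this, add_pow, Finset.mul_sum]
          refine Finset.dvd_sum fun i hi => ?_
          have hi' : n = i + (n - i) := by have := Finset.mem_range.1 hi; omega
          rw [← mul_assoc, ← mul_assoc]
          refine Dvd.dvd.mul_right ?_ _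
          conv_lhs => rw [hi', pow_add]
          refine mul_dvd_mul (hn i) ?_
          rw [neg_pow, mul_pow]
          exact ((dvd_refl _).mul_left _).mul_left _
        obtain ⟨e, he⟩ := h3
        obtain ⟨e', rfl⟩ := h.prime.pow_dvd_of_dvd_mul_left n
          (fun h' => hb (h.prime.dvd_of_dvd_pow h')) (Dvd.intro _ he)
        refine ⟨e', mul_left_cancel₀ (pow_ne_zero n h.prime.ne_zero) ?_⟩
        rw [he]
        ring
      obtain ⟨y, z, hyz⟩ := Ideal.mem_span_pair.1 (ih a₁ h2)
      exact Ideal.mem_span_pair.2 ⟨x + y * v, z, by rw [← hyz]; ring⟩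
  exact h.closed a b v (Ideal.subset_span (by simp)) fun m => key m a hn

/-- The powers of `v` are removed from `b` one at a time: each divides `a` too and cancels. Those in
`c` are prime to the remaining `b`. -/
theorem dvd_of_forall_pow_dvd [IsDomain B] (h : NodeModel ψ w u v) {a b c : B}
    (hb : b ≠ 0) (hc : c ≠ 0) (hn : ∀ n : ℕ, b ^ n ∣ c * a ^ n) : b ∣ a := by
  obtain ⟨s, b, rfl, hb'⟩ := h.exists_eq_pow_mul hb
  obtain ⟨N, c, rfl, hc'⟩ := h.exists_eq_pow_mul hc
  clear hb hc
  induction s generalizing a with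
  | zero =>
    rw [pow_zero, one_mul] at hn ⊢
    refine h.dvd_of_forall_pow_dvd_of_not_dvd hb' hc' fun n => ?_
    obtain ⟨e, he⟩ := hn n
    obtain ⟨e', rfl⟩ := h.prime.pow_dvd_of_dvd_mul_left N (b := e)
      (fun h' => hb' (h.prime.dvd_of_dvd_pow h')) (Dvd.intro (c * a ^ n) (by rw [← he]; ring))
    refine ⟨e', mul_left_cancel₀ (pow_ne_zero N h.prime.ne_zero) ?_⟩
    rw [← mul_assoc, he]
    ring
  | succ s ih =>
    have h1 : v ∣ a := by
      have h2 : v ^ (N + 1) ∣ v ^ N * (c * a ^ (N + 1)) := by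
        rw [← mul_assoc]
        refine Dvd.dvd.trans ?_ (hn (N + 1))
        exact pow_dvd_pow_of_dvd ((dvd_pow_self v s.succ_ne_zero).mul_right b) _
      rw [pow_succ, mul_dvd_mul_iff_left (pow_ne_zero N h.prime.ne_zero)] at h2
      exact h.prime.dvd_of_dvd_pow ((h.prime.dvd_or_dvd h2).resolve_left hc')
    obtain ⟨a, rfl⟩ := h1
    rw [pow_succ', mul_assoc]
    refine mul_dvd_mul_left v (ih fun n => ?_)
    have h2 := hn n
    rw [pow_succ', mul_assoc v, mul_pow v, mul_pow v, mul_left_comm] at h2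
    exact (mul_dvd_mul_iff_left (pow_ne_zero n h.prime.ne_zero)).1 h2

/-- All powers of an integral fraction have a common denominator. -/
theorem isIntegrallyClosed [IsDomain B] (h : NodeModel ψ w u v) : IsIntegrallyClosed B := by
  rw [isIntegrallyClosed_iff (FractionRing B)]
  intro x hx
  obtain ⟨a, b, hb, rfl⟩ := IsFractionRing.div_surjective (A := B) x
  have hb0 : b ≠ 0 := nonZeroDivisors.ne_zero hb
  have hinj := IsFractionRing.injective B (FractionRing B)
  obtain ⟨c, hc, hcn⟩ := hx.isAlmostIntegral
  have hab : b ∣ a := by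
    refine h.dvd_of_forall_pow_dvd hb0 (nonZeroDivisors.ne_zero hc) fun n => ?_
    obtain ⟨d, hd⟩ := hcn n
    refine ⟨d, hinj ?_⟩
    rw [map_mul, map_mul, hd, Algebra.smul_def, div_pow, map_pow, map_pow]
    have : algebraMap B (FractionRing B) b ≠ 0 := by
      rwa [Ne, map_eq_zero_iff _ hinj]
    field_simp
  obtain ⟨d, rfl⟩ := hab
  refine ⟨d, ?_⟩
  have : algebraMap B (FractionRing B) b ≠ 0 := by
    rwa [Ne, map_eq_zero_iff _ hinj]
  rw [map_mul]
  field_simp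

end NodeModel

end Model

end MixedNP

namespace MixedNP

/-! ### Lifting simple roots from `B/(v)` to `B` -/

section Lift

variable {A B k : Type*} [CommRing A] [CommRing B] [Algebra A B] [Field k]
  {ψ : k[X] →+* A} {w : A} {u v : B}

theorem IsNodeLift.injective {σ : B ⧸ Ideal.span {v} →+* B} (hσ : IsNodeLift ψ v σ) :
    Function.Injective σ :=
  Function.LeftInverse.injective hσ.mk_apply

theorem IsNodeLift.eval₂_eq {σ : B ⧸ Ideal.span {v} →+* B} (hσ : IsNodeLift ψ v σ) (f : k[X][X])
    (z : B ⧸ Ideal.span {v}) : f.eval₂ ((algebraMap A B).comp ψ) (σ z) =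
      σ (f.eval₂ ((Ideal.Quotient.mk (Ideal.span {v})).comp ((algebraMap A B).comp ψ)) z) := by
  rw [hom_eval₂]
  congr 1
  exact RingHom.ext fun p => (hσ.apply_poly p).symm

variable [IsDomain B]

namespace NodeModel

/-- A simple root modulo `v` of a polynomial over `k[u]` lifts to a point of a standard étale
algebra. -/
theorem exists_standardEtale (h : NodeModel ψ w u v) {z : B ⧸ Ideal.span {v}} {f : k[X][X]}
    (hf : ¬ X ∣ f.leadingCoeff)
    (hz : f.eval₂ ((Ideal.Quotient.mk (Ideal.span {v})).comp ((algebraMap A B).comp ψ)) z = 0)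
    (hz' : ¬ Ideal.Quotient.mk (Ideal.span {v}) u ∣ (derivative f).eval₂
      ((Ideal.Quotient.mk (Ideal.span {v})).comp ((algebraMap A B).comp ψ)) z) :
    ∃ (P : StandardEtalePair A) (y : B) (hy : P.HasMap y), Ideal.Quotient.mk _ y = z ∧
      f.eval₂ ((algebraMap A B).comp ψ) y = 0 ∧ (P.lift y hy).toRingHom.Flat := by
  set φ := (Ideal.Quotient.mk (Ideal.span {v})).comp ((algebraMap A B).comp ψ) with hφ
  have hprime := h.isPrime_span
  have hφX := h.mk_u
  rw [← hφ] at hφX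
  have hl := h.isUnit_poly _ hf
  have hnt : Nontrivial A := (algebraMap A B).domain_nontrivial
  obtain ⟨l, hl'⟩ := hl.exists_left_inv
  have hlm : (f.map ψ).leadingCoeff = ψ f.leadingCoeff :=
    leadingCoeff_map_of_leadingCoeff_ne_zero _ hl.ne_zero
  obtain ⟨c, hc⟩ := h.uniformized.residue z
  have hu : IsUnit l := .of_mul_eq_one _ hl'
  have hd : derivative (C l * f.map ψ) = C l * (derivative f).map ψ := by
    rw [derivative_C_mul, derivative_map]
  -- The leading coefficient of `f` is a unit of `A`, so `f` can be made monic; inverting its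
  -- derivative gives the étale algebra of simple roots.
  let P : StandardEtalePair A :=
    { f := C l * f.map ψ
      monic_f := monic_C_mul_of_mul_leadingCoeff_eq_one (by rw [hlm, hl'])
      g := derivative (C l * f.map ψ)
      cond := ⟨1, 0, 1, by simp⟩ }
  have hev : ∀ (q : k[X][X]) (a : A), (q.map ψ).eval (ψ (C c)) = ψ (q.eval (C c)) := by
    intro q _
    rw [eval_map, eval₂_at_apply]
  have hcong : ∀ q : k[X][X], φ X ∣ q.eval₂ φ z - φ (q.eval (C c)) := by
    intro q
    rw [← eval₂_at_apply, eval₂_eq_eval_map, eval₂_eq_eval_map]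
    exact hc.trans (sub_dvd_eval_sub _ _ _)
  have h1 : ¬ IsUnit (P.f.eval (ψ (C c))) := by
    change ¬ IsUnit ((C l * f.map ψ).eval (ψ (C c)))
    rw [eval_mul, eval_C, hev f 0, IsUnit.mul_iff, not_and]
    intro _ hunit
    have h2 := hcong f
    rw [hz, zero_sub, dvd_neg] at h2
    have h3 : IsUnit (φ (f.eval (C c))) := by
      have := (hunit.map (algebraMap A B)).map (Ideal.Quotient.mk (Ideal.span {v}))
      exact this
    exact h.uniformized.prime.not_isUnit (isUnit_of_dvd_unit h2 h3)
  have h2 : IsUnit (P.g.eval (ψ (C c))) := by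
    change IsUnit ((derivative (C l * f.map ψ)).eval (ψ (C c)))
    rw [hd, eval_mul, eval_C, hev _ 0]
    refine hu.mul (h.isUnit_poly _ fun hX => hz' ?_)
    have := (dvd_sub_comm.1 (hcong (derivative f)))
    rw [← hφX]
    exact (dvd_sub_right (_root_.map_dvd φ hX)).1 this
  obtain ⟨y, hy, hyc, hflat⟩ := h.exists_root P c h1 h2
  have hyf : f.eval₂ ((algebraMap A B).comp ψ) y = 0 := by
    have := hy.1
    change aeval y (C l * f.map ψ) = 0 at this
    rw [map_mul, aeval_C, aeval_def, eval₂_map] at this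
    exact (mul_eq_zero.1 this).resolve_left (hu.map _).ne_zero
  -- The class of `y` and `z` are roots of `f` with the same residue modulo `u`; simplicity makes
  -- them equal.
  refine ⟨P, y, hy, (eq_of_simple_root (g := f.map φ) (d := φ X) ?_ ?_ ?_ ?_).symm, hyf, hflat⟩
  · rw [eval_map, hz]
  · rw [eval_map, hφ, ← hom_eval₂, hyf, map_zero]
  · have h3 : φ X ∣ Ideal.Quotient.mk _ y - φ (C c) := by
      rw [hφX]
      exact mk_dvd_mk_iff.2 hyc
    have := dvd_sub h3 hc
    rwa [sub_sub_sub_cancel_right] at this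
  · rw [derivative_map, eval_map, hφX]
    exact hz'

/-- A point over a simple root modulo `v` is unique. -/
theorem eq_of_mk_eq {f : k[X][X]} {y y' : B}
    (hf : f.eval₂ ((algebraMap A B).comp ψ) y = 0) (hf' : f.eval₂ ((algebraMap A B).comp ψ) y' = 0)
    (hy : Ideal.Quotient.mk (Ideal.span {v}) y = Ideal.Quotient.mk _ y')
    (hz' : ¬ Ideal.Quotient.mk (Ideal.span {v}) u ∣ (derivative f).eval₂
      ((Ideal.Quotient.mk (Ideal.span {v})).comp ((algebraMap A B).comp ψ))
        (Ideal.Quotient.mk _ y)) : y = y' := by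
  refine eq_of_simple_root (g := f.map ((algebraMap A B).comp ψ)) (d := v) (by rwa [eval_map])
    (by rwa [eval_map]) ?_ fun hd => hz' ?_
  · rw [← mk_eq_zero_iff_dvd, map_sub, hy, sub_self]
  · rw [← hom_eval₂, ← eval_map, ← derivative_map, mk_eq_zero_iff_dvd.2 hd]
    exact dvd_zero _

/-- The elements of `B` that are algebraic over `k[u]` form a ring which reduction modulo `v` maps
bijectively onto `B/(v)`. The inverse of this map is the section. -/
theorem exists_isNodeLift [CharZero k] (h : NodeModel ψ w u v) :
    ∃ σ : B ⧸ Ideal.span {v} →+* B, IsNodeLift ψ v σ := by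
  have hprime := h.isPrime_span
  have hinj := injective_of_prime_map_X h.uniformized.prime
  let _ : Algebra k[X] B := ((algebraMap A B).comp ψ).toAlgebra
  let S := Subalgebra.algebraicClosure k[X] B
  let ρ : S →+* B ⧸ Ideal.span {v} := (Ideal.Quotient.mk (Ideal.span {v})).comp S.val.toRingHom
  have hρ : Function.Bijective ρ := by
    constructor
    · rw [injective_iff_map_eq_zero]
      rintro ⟨b, hb⟩ hb0
      by_contra hne
      have hne' : b ≠ 0 := fun h => hne (Subtype.ext h)
      have hvb : v ∣ b := mk_eq_zero_iff_dvd.1 hb0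
      -- A relation with nonzero constant term: if `v` divided `b` it would divide this element of
      -- `k[u]`, which however embeds into `B/(v)`.
      obtain ⟨q, hq, hq0⟩ := IsAlgebraic.exists_nonzero_coeff_and_aeval_eq_zero
        ((Subalgebra.mem_algebraicClosure _ _).1 hb) (mem_nonZeroDivisors_of_ne_zero hne')
      refine hq (hinj ?_)
      rw [map_zero]
      refine mk_eq_zero_iff_dvd.2 ?_
      have h1 : v ∣ (q.map ((algebraMap A B).comp ψ)).eval b -
          (q.map ((algebraMap A B).comp ψ)).eval 0 :=
        (by simpa using hvb : v ∣ b - 0).trans (sub_dvd_eval_sub _ _ _)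
      have h2 : (q.map ((algebraMap A B).comp ψ)).eval b = 0 := by
        rw [eval_map]
        exact hq0
      rw [h2, zero_sub, dvd_neg, ← coeff_zero_eq_eval_zero, coeff_map] at h1
      exact h1
    · intro c
      -- Here `c = t + u^M / z`, and the simple root `z` lifts to a unit of `B` algebraic over
      -- `k[u]`.
      obtain ⟨t, M, z, f, hz, hcz, hf, hfz, hfz'⟩ := h.uniformized.exists_simple_root c
      rw [h.mk_u] at hfz'
      obtain ⟨P, y, -, rfl, hy, -⟩ := h.exists_standardEtale hf hfz hfz'
      have hyu : IsUnit y := h.isUnit_of_mk fun hd =>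
        h.uniformized.prime.not_isUnit (isUnit_of_dvd_unit (by rwa [h.mk_u]) hz)
      have hf0 : f ≠ 0 := by
        rintro rfl
        simp at hf
      have hya : IsAlgebraic k[X] y := ⟨f, hf0, hy⟩
      obtain ⟨y', hy'⟩ := hyu.exists_right_inv
      have hb : y * (algebraMap k[X] B t + algebraMap k[X] B X ^ M * y') =
          algebraMap k[X] B t * y + algebraMap k[X] B X ^ M := by
        linear_combination algebraMap k[X] B X ^ M * hy'
      refine ⟨⟨algebraMap k[X] B t + algebraMap k[X] B X ^ M * y', ?_⟩, ?_⟩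
      · rw [Subalgebra.mem_algebraicClosure]
        refine IsAlgebraic.of_mul (mem_nonZeroDivisors_of_ne_zero hyu.ne_zero) hya ?_
        rw [hb, ← map_pow]
        exact ((isAlgebraic_algebraMap _).mul hya).add (isAlgebraic_algebraMap _)
      · refine mul_left_cancel₀ hz.ne_zero ?_
        rw [mul_comm _ c, hcz]
        have := congrArg (Ideal.Quotient.mk (Ideal.span {v})) hb
        rw [map_mul, map_add _ (algebraMap k[X] B t * y), map_mul _ (algebraMap k[X] B t),
          map_pow] at this
        exact this
  let e := RingEquiv.ofBijective ρ hρ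
  refine ⟨S.val.toRingHom.comp e.symm.toRingHom, fun c => e.apply_symm_apply c, fun p => ?_⟩
  have : e (algebraMap k[X] S p) = Ideal.Quotient.mk (Ideal.span {v}) (algebraMap A B (ψ p)) := rfl
  change (e.symm _ : B) = _
  rw [← this, RingEquiv.symm_apply_apply]
  rfl

end NodeModel

/-- Since `σ` fixes `k[u]`, the element `σ z` is a root of `f` over `z`. By uniqueness it is the
étale point, whichever lifting map is given. -/
theorem NodeModel.exists_standardEtale_lift (h : NodeModel ψ w u v)
    {σ : B ⧸ Ideal.span {v} →+* B} (hσ : IsNodeLift ψ v σ) {z : B ⧸ Ideal.span {v}} {f : k[X][X]}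
    (hf : ¬ X ∣ f.leadingCoeff)
    (hz : f.eval₂ ((Ideal.Quotient.mk (Ideal.span {v})).comp ((algebraMap A B).comp ψ)) z = 0)
    (hz' : ¬ Ideal.Quotient.mk (Ideal.span {v}) u ∣ (derivative f).eval₂
      ((Ideal.Quotient.mk (Ideal.span {v})).comp ((algebraMap A B).comp ψ)) z) :
    ∃ (P : StandardEtalePair A) (hy : P.HasMap (σ z)), (P.lift (σ z) hy).toRingHom.Flat := by
  obtain ⟨P, y, hy, rfl, hfy, hflat⟩ := h.exists_standardEtale hf hz hz'
  have : y = σ (Ideal.Quotient.mk _ y) :=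
    eq_of_mk_eq hfy (by rw [hσ.eval₂_eq, hz, map_zero]) (hσ.mk_apply _).symm hz'
  generalize Ideal.Quotient.mk (Ideal.span {v}) y = z at this ⊢
  subst this
  exact ⟨P, hy, hflat⟩

end Lift

end MixedNP

namespace MixedNP

open IsLocalRing

theorem _root_.StandardEtalePair.exists_mul_pow_eq_aeval {A : Type*} [CommRing A]
    (P : StandardEtalePair A)
    (x : P.Ring) : ∃ (p : A[X]) (n : ℕ), x * aeval P.X P.g ^ n = aeval P.X p := by
  let S : StandardEtalePresentation A P.Ring :=
    ⟨P, P.X, P.hasMap_X, by simpa using Function.bijective_id⟩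
  exact S.exists_mul_aeval_x_g_pow_eq_aeval_x x

/-! ### Local rings generated by a point of a standard étale algebra -/

section Etale

variable {A B : Type*} [CommRing A] [CommRing B] [Algebra A B]

/-- The local ring of `S` at `m` is a localization of the standard étale algebra: fractions with
unit denominators give surjectivity, flatness controls the kernel. -/
theorem isEtaleAt_of_standardEtale [IsLocalRing B] {P : StandardEtalePair A} {z : B}
    (hz : P.HasMap z) (hflat : (P.lift z hz).toRingHom.Flat) {S : Type*} [CommRing S] [Algebra A S]
    {ν : S →ₐ[A] B} (hν : Function.Injective ν) {z₀ : S} (hz₀ : ν z₀ = z) (m : Ideal S) [m.IsPrime]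
    (hm : ∀ x, x ∉ m ↔ IsUnit (ν x))
    (hS : ∀ x, ∃ T a : A[X], IsUnit (aeval z T) ∧ aeval z T * ν x = aeval z a) :
    Algebra.IsEtaleAt A m := by
  set L := Localization.AtPrime m with hL
  have hu : ∀ s : m.primeCompl, IsUnit (ν.toRingHom s) := fun s => (hm s).1 s.2
  let τ₀ : L →+* B := IsLocalization.lift hu
  have hτ₀ : ∀ x : S, τ₀ (algebraMap S L x) = ν x := fun x => IsLocalization.lift_eq hu x
  let τ : L →ₐ[A] B :=
    { τ₀ with
      commutes' := fun a => by
        change τ₀ (algebraMap A L a) = _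
        rw [IsScalarTower.algebraMap_apply A S L, hτ₀, ν.commutes] }
  have hτ : ∀ x : S, τ (algebraMap S L x) = ν x := hτ₀
  have hspec : ∀ (x : S) (s : m.primeCompl), τ (IsLocalization.mk' L x s) * ν s = ν x := by
    intro x s
    rw [← hτ s, ← map_mul, IsLocalization.mk'_spec, hτ]
  have hτu : ∀ y, IsUnit (τ y) → IsUnit y := by
    intro y hy
    obtain ⟨x, s, rfl⟩ := IsLocalization.exists_mk'_eq m.primeCompl y
    rw [IsLocalization.AtPrime.isUnit_mk'_iff _ m]
    refine (hm x).2 ?_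
    rw [← hspec x s]
    exact hy.mul ((hm s).1 s.2)
  have hτi : Function.Injective τ := by
    rw [injective_iff_map_eq_zero]
    intro y hy
    obtain ⟨x, s, rfl⟩ := IsLocalization.exists_mk'_eq m.primeCompl y
    have h1 := hspec x s
    rw [hy, zero_mul] at h1
    rw [show x = 0 from hν (h1.symm.trans (map_zero ν).symm), IsLocalization.mk'_zero]
  have hζ : P.HasMap (algebraMap S L z₀) := by
    constructor
    · apply hτi
      rw [← aeval_algHom_apply, hτ, hz₀, map_zero]
      exact hz.1
    · apply hτu
      rw [← aeval_algHom_apply, hτ, hz₀]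
      exact hz.2
  set χ := P.lift _ hζ with hχ
  have hτχ : ∀ e, τ (χ e) = P.lift z hz e := by
    intro e
    have : τ.comp χ = P.lift z hz := StandardEtalePair.hom_ext (by simp [hχ, hτ, hz₀])
    exact DFunLike.congr_fun this e
  have hχa : ∀ p : A[X], χ (aeval P.X p) = aeval (algebraMap S L z₀) p := fun p => by
    rw [← aeval_algHom_apply, P.lift_X]
  have hτa : ∀ p : A[X], τ (aeval (algebraMap S L z₀) p) = aeval z p := fun p => by
    rw [← aeval_algHom_apply, hτ, hz₀]
  let _ : Algebra P.Ring L := χ.toRingHom.toAlgebra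
  have hmap : ∀ e, algebraMap P.Ring L e = χ e := fun _ => rfl
  have : IsScalarTower A P.Ring L := .of_algebraMap_eq fun a => (χ.commutes a).symm
  -- The elements that become units in `B`.
  let M : Submonoid P.Ring := (IsUnit.submonoid B).comap (P.lift z hz)
  have hloc : IsLocalization M L := by
    refine ⟨fun e => ?_, fun y => ?_, fun {e e'} hee => ?_⟩
    · exact hτu _ (by rw [hmap, hτχ]; exact e.2)
    · obtain ⟨x, s, rfl⟩ := IsLocalization.exists_mk'_eq m.primeCompl y
      obtain ⟨T, a, hT, hTa⟩ := hS x
      obtain ⟨T', a', hT', hTa'⟩ := hS s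
      have ha' : IsUnit (aeval z a') := hTa' ▸ hT'.mul ((hm s).1 s.2)
      have hMm : aeval P.X (T * a') ∈ M := by
        change IsUnit (P.lift z hz _)
        rw [← hτχ, hχa, hτa, map_mul]
        exact hT.mul ha'
      refine ⟨(aeval P.X (a * T'), ⟨_, hMm⟩), hτi ?_⟩
      rw [hmap, hmap, map_mul, hχa, hχa, hτa, hτa, map_mul, map_mul, ← hTa, ← hTa', ← hspec x s]
      ring
    · have h1 : P.lift z hz (e - e') = 0 := by
        rw [← hτχ, map_sub, ← hmap, ← hmap, hee, sub_self, map_zero]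
      -- An element that vanishes in `B` is annihilated by some element of `M`, because the zero
      -- ideal is contracted.
      obtain ⟨s, hs, hsx⟩ := hflat.exists_isUnit_mul_mem ⊥ (x := e - e') (by
        change P.lift z hz (e - e') ∈ _
        rw [h1]
        exact zero_mem _)
      refine ⟨⟨s, hs⟩, ?_⟩
      rw [Ideal.mem_bot, mul_sub, sub_eq_zero] at hsx
      exact hsx
  have h1 : Algebra.FormallyEtale P.Ring L := Algebra.FormallyEtale.of_isLocalization M
  exact Algebra.FormallyEtale.comp A P.Ring L

end Etale

/-! ### Elements of `B` in the adjoined field -/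

section Field

variable {A B : Type*} [CommRing A] [CommRing B] [IsDomain B] [Algebra A B]

theorem algebraMap_mem_adjoinedField (Γ : Set B) (a : A) :
    algebraMap B (FractionRing B) (algebraMap A B a) ∈ adjoinedField A Γ :=
  Subfield.subset_closure (Set.mem_image_of_mem _ (Or.inl ⟨a, rfl⟩))

theorem mem_adjoinedField {Γ : Set B} {γ : B} (h : γ ∈ Γ) :
    algebraMap B (FractionRing B) γ ∈ adjoinedField A Γ :=
  Subfield.subset_closure (Set.mem_image_of_mem _ (Or.inr h))

theorem adjoinedField_le {Γ : Set B} {K : Subfield (FractionRing B)}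
    (h : ∀ a, algebraMap B (FractionRing B) (algebraMap A B a) ∈ K)
    (h' : ∀ γ ∈ Γ, algebraMap B (FractionRing B) γ ∈ K) : adjoinedField A Γ ≤ K := by
  refine Subfield.closure_le.2 ?_
  rintro _ ⟨x, ⟨p, rfl⟩ | hx, rfl⟩
  exacts [h p, h' x hx]

theorem adjoinedField_mono {Γ Γ' : Set B} (h : Γ ⊆ Γ') :
    adjoinedField A Γ ≤ adjoinedField A Γ' :=
  adjoinedField_le (algebraMap_mem_adjoinedField Γ') fun _ hγ => mem_adjoinedField (h hγ)

theorem mem_normalizationIn {Γ : Set B} {x : B} : x ∈ normalizationIn A Γ ↔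
    IsIntegral A x ∧ algebraMap B (FractionRing B) x ∈ adjoinedField A Γ := Iff.rfl

theorem exists_div_of_mem_adjoinedField {z : B} {x : FractionRing B}
    (h : x ∈ adjoinedField A {z}) : ∃ y c : A[X],
      algebraMap B (FractionRing B) (aeval z y) /
        algebraMap B (FractionRing B) (aeval z c) = x := by
  rw [adjoinedField, Subfield.mem_closure_iff] at h
  obtain ⟨y, hy, c, hc, rfl⟩ := h
  rw [← RingHom.map_closure] at hy hc
  obtain ⟨y, hy, rfl⟩ := hy
  obtain ⟨c, hc, rfl⟩ := hc
  have hle : Subring.closure (Set.range (algebraMap A B) ∪ {z}) ≤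
      (aeval (R := A) z).toRingHom.range := by
    rw [Subring.closure_le]
    rintro _ (⟨a, rfl⟩ | rfl)
    · exact ⟨C a, aeval_C _ a⟩
    · exact ⟨X, aeval_X _⟩
  obtain ⟨y, rfl⟩ := hle hy
  obtain ⟨c, rfl⟩ := hle hc
  exact ⟨y, c, rfl⟩

/-- The elements of the field generated by a point of a flat standard étale algebra that lie in a
local ring `B` are fractions with invertible denominators. -/
theorem exists_aeval_mul_eq_aeval [IsLocalRing B] {P : StandardEtalePair A} {z : B}
    (hz : P.HasMap z) (hflat : (P.lift z hz).toRingHom.Flat) {x : B}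
    (hx : algebraMap B (FractionRing B) x ∈ adjoinedField A {z}) :
    ∃ T a : A[X], IsUnit (aeval z T) ∧ aeval z T * x = aeval z a := by
  obtain ⟨y, c, hyc⟩ := exists_div_of_mem_adjoinedField hx
  have hinj := IsFractionRing.injective B (FractionRing B)
  rcases eq_or_ne (aeval z c) 0 with h0 | h0
  · rw [h0, map_zero, div_zero, eq_comm, map_eq_zero_iff _ hinj] at hyc
    exact ⟨1, 0, by simp, by simp [hyc]⟩
  have hyx : aeval z c * x = aeval z y := by
    apply hinj
    rw [map_mul, ← hyc, mul_div_cancel₀]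
    rwa [Ne, map_eq_zero_iff _ hinj]
  have hρ : ∀ p : A[X], P.lift z hz (aeval P.X p) = aeval z p := fun p => by
    rw [← aeval_algHom_apply, P.lift_X]
  -- Since `y = c x` lies in `c B`, contraction gives `s y = d c` in the étale algebra with `s` a
  -- unit of `B`. Hence `x = d / s`.
  obtain ⟨s, hs, hsx⟩ := hflat.exists_isUnit_mul_mem
    (Ideal.span {aeval P.X c}) (x := aeval P.X y) (by
    rw [Ideal.map_span, Set.image_singleton, Ideal.mem_span_singleton]
    change P.lift z hz _ ∣ P.lift z hz _
    rw [hρ, hρ, ← hyx]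
    exact dvd_mul_right _ _)
  obtain ⟨d, hd⟩ := Ideal.mem_span_singleton'.1 hsx
  obtain ⟨T, n, hT⟩ := P.exists_mul_pow_eq_aeval s
  obtain ⟨a, m, ha⟩ := P.exists_mul_pow_eq_aeval d
  have hs' : IsUnit (P.lift z hz s) := hs
  -- Powers of `g`, which is a unit at `z`, clear the denominators of `s` and `d`.
  refine ⟨T * P.g ^ m, a * P.g ^ n, ?_, ?_⟩
  · rw [map_mul, map_pow, ← hρ T, ← hT, map_mul, map_pow, hρ]
    exact (hs'.mul (hz.2.pow n)).mul (hz.2.pow m)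
  · refine mul_left_cancel₀ h0 ?_
    have h1 := congrArg (P.lift z hz) hd
    rw [map_mul, map_mul, hρ, hρ, ← hyx] at h1
    rw [map_mul, map_mul, map_pow, map_pow, ← hρ T, ← hρ a, ← hT, ← ha, map_mul, map_mul, map_pow,
      map_pow, hρ]
    linear_combination (-(aeval z P.g ^ n * aeval z P.g ^ m)) * h1

end Field

end MixedNP

namespace MixedNP

open IsLocalRing

/-! ### Comparison of `K(A)(σ(Γ))` with `k(u)(Γ)` -/

section Fields

variable {A B k : Type*} [CommRing A] [CommRing B] [Algebra A B] [Field k]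
  {ψ : k[X] →+* A} {w : A} {u v : B}

/-- The reduction modulo `v` of the map from `k[u]`. -/
noncomputable abbrev reducedPoly (ψ : k[X] →+* A) (v : B) : k[X] →+* B ⧸ Ideal.span {v} :=
  (Ideal.Quotient.mk (Ideal.span {v})).comp ((algebraMap A B).comp ψ)

theorem NodeModel.isLocalRing (h : NodeModel ψ w u v) : IsLocalRing B := by
  have : Nontrivial B := ⟨⟨v, 0, h.prime.ne_zero⟩⟩
  refine .of_nonunits_add fun a b ha hb => ?_
  rw [mem_nonunits_iff, h.isUnit_iff, not_not] at *
  exact add_mem ha hb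

variable {Q : Type*} [Field Q] [Algebra (B ⧸ Ideal.span {v}) Q]

theorem NodeModel.mk_algebraMap_mem_generatedField (h : NodeModel ψ w u v)
    (Γ : Set (B ⧸ Ideal.span {v})) (a : A) :
    algebraMap _ Q (Ideal.Quotient.mk (Ideal.span {v}) (algebraMap A B a)) ∈
      generatedField Q (reducedPoly ψ v) Γ := by
  obtain ⟨p, d, hd, e, he⟩ := h.exists_fraction a
  have h1 : algebraMap _ Q (Ideal.Quotient.mk (Ideal.span {v}) (algebraMap A B a)) *
      algebraMap _ Q (reducedPoly ψ v d) = algebraMap _ Q (reducedPoly ψ v p) := by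
    rw [← map_mul, ← sub_eq_zero, ← map_sub]
    have : Ideal.Quotient.mk (Ideal.span {v}) (algebraMap A B a) * reducedPoly ψ v d -
        reducedPoly ψ v p = Ideal.Quotient.mk (Ideal.span {v}) (algebraMap A B (w * e)) := by
      rw [← he, mul_comm (ψ d), map_sub, map_mul, map_sub, map_mul]
      rfl
    rw [this, mk_eq_zero_iff_dvd.2, map_zero]
    rw [map_mul, h.map_w]
    exact dvd_mul_right _ _
  have h2 : algebraMap _ Q (reducedPoly ψ v d) ≠ 0 :=
    (((h.isUnit_poly d hd).map ((Ideal.Quotient.mk (Ideal.span {v})).comp (algebraMap A B))).map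
      (algebraMap (B ⧸ Ideal.span {v}) Q)).ne_zero
  rw [eq_div_of_mul_eq h2 h1]
  exact div_mem (map_mem_generatedField Γ p) (map_mem_generatedField Γ d)

variable [IsDomain B] [FaithfulSMul (B ⧸ Ideal.span {v}) Q] {σ : B ⧸ Ideal.span {v} →+* B}

theorem IsNodeLift.mem_adjoinedField (hσ : IsNodeLift ψ v σ) {Γ : Set (B ⧸ Ideal.span {v})}
    {x : B ⧸ Ideal.span {v}}
    (hx : algebraMap _ Q x ∈ generatedField Q (reducedPoly ψ v) Γ) :
    algebraMap B (FractionRing B) (σ x) ∈ adjoinedField A (σ '' Γ) := by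
  have hinj := FaithfulSMul.algebraMap_injective (B ⧸ Ideal.span {v}) Q
  have hinjB := IsFractionRing.injective B (FractionRing B)
  have hcl : ∀ y ∈ Subring.closure (Set.range (reducedPoly ψ v) ∪ Γ),
      algebraMap B (FractionRing B) (σ y) ∈ adjoinedField A (σ '' Γ) := by
    intro y hy
    have hle : Subring.closure (Set.range (reducedPoly ψ v) ∪ Γ) ≤
        (adjoinedField A (σ '' Γ)).toSubring.comap ((algebraMap B (FractionRing B)).comp σ) := by
      rw [Subring.closure_le]
      rintro _ (⟨p, rfl⟩ | hγ)
      · change algebraMap B (FractionRing B) (σ (Ideal.Quotient.mk _ _)) ∈ adjoinedField A (σ '' Γ)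
        rw [RingHom.comp_apply, hσ.apply_poly]
        exact algebraMap_mem_adjoinedField _ (ψ p)
      · exact MixedNP.mem_adjoinedField (Set.mem_image_of_mem σ hγ)
    exact hle hy
  obtain ⟨y, hy, c, hc, hyc⟩ := exists_div_of_mem_generatedField hx
  rcases eq_or_ne c 0 with rfl | h0
  · rw [map_zero, div_zero, eq_comm, map_eq_zero_iff _ hinj] at hyc
    rw [hyc, map_zero, map_zero]
    exact zero_mem _
  · have h1 : x * c = y := by
      apply hinj
      rw [map_mul, ← hyc, div_mul_cancel₀]
      rwa [Ne, map_eq_zero_iff _ hinj]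
    have h2 : algebraMap B (FractionRing B) (σ c) ≠ 0 := by
      rw [Ne, map_eq_zero_iff _ hinjB, map_eq_zero_iff _ hσ.injective]
      exact h0
    have h3 : algebraMap B (FractionRing B) (σ x) * algebraMap B (FractionRing B) (σ c) =
        algebraMap B (FractionRing B) (σ y) := by
      rw [← map_mul, ← map_mul, h1]
    rw [eq_div_of_mul_eq h2 h3]
    exact div_mem (hcl y hy) (hcl c hc)

variable [CharZero k]

/-- A simple-root generator `z` of `k(u)(Γ)` lifts to an étale point. As `σ` carries rational
expressions to rational expressions, `σ z` generates the lifted field. -/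
theorem NodeModel.exists_generator (h : NodeModel ψ w u v) (hσ : IsNodeLift ψ v σ)
    {Γ : Set (B ⧸ Ideal.span {v})} (hΓ : Γ.Finite) :
    ∃ (P : StandardEtalePair A) (z : B ⧸ Ideal.span {v}) (hz : P.HasMap (σ z)),
      (P.lift (σ z) hz).toRingHom.Flat ∧
      algebraMap _ Q z ∈ generatedField Q (reducedPoly ψ v) Γ ∧
      adjoinedField A {σ z} = adjoinedField A (σ '' Γ) := by
  have := h.isPrime_span
  obtain ⟨z, f, hzΓ, hf, hfz, hfz'⟩ := h.uniformized.exists_simple_primitive (Q := Q) hΓ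
  rw [h.mk_u] at hfz'
  obtain ⟨P, hz, hflat⟩ := h.exists_standardEtale_lift hσ hf hfz hfz'
  have hzΓ' : algebraMap _ Q z ∈ generatedField Q (reducedPoly ψ v) Γ :=
    hzΓ ▸ mem_generatedField rfl
  refine ⟨P, z, hz, hflat, hzΓ', le_antisymm ?_ ?_⟩
  · refine adjoinedField_le (algebraMap_mem_adjoinedField _) ?_
    rintro _ rfl
    exact hσ.mem_adjoinedField hzΓ'
  · refine adjoinedField_le (algebraMap_mem_adjoinedField _) ?_
    rintro _ ⟨γ, hγ, rfl⟩
    rw [← Set.image_singleton]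
    exact hσ.mem_adjoinedField (Q := Q) (hzΓ ▸ mem_generatedField hγ)

/-- A quotient with denominator a unit of `B` can be reduced modulo `v`, and the generator reduces
to `z`. -/
theorem NodeModel.mk_mem_generatedField (h : NodeModel ψ w u v) (hσ : IsNodeLift ψ v σ)
    {Γ : Set (B ⧸ Ideal.span {v})} (hΓ : Γ.Finite) {x : B}
    (hx : algebraMap B (FractionRing B) x ∈ adjoinedField A (σ '' Γ)) :
    algebraMap _ Q (Ideal.Quotient.mk (Ideal.span {v}) x) ∈
      generatedField Q (reducedPoly ψ v) Γ := by
  have := h.isPrime_span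
  have := h.isLocalRing
  obtain ⟨P, z, hz, hflat, hzΓ, hadj⟩ := h.exists_generator (Q := Q) hσ hΓ
  rw [← hadj] at hx
  obtain ⟨T, a, hT, hTx⟩ := exists_aeval_mul_eq_aeval hz hflat hx
  let g : B →+* Q := (algebraMap _ Q).comp (Ideal.Quotient.mk (Ideal.span {v}))
  have hg : ∀ p : A[X], g (aeval (σ z) p) ∈ generatedField Q (reducedPoly ψ v) Γ := by
    intro p
    rw [aeval_def, hom_eval₂, eval₂_eq_sum_range]
    refine sum_mem fun i _ => mul_mem (h.mk_algebraMap_mem_generatedField Γ _) (pow_mem ?_ i)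
    change algebraMap _ Q (Ideal.Quotient.mk _ (σ z)) ∈ _
    rwa [hσ.mk_apply]
  have h1 : g x * g (aeval (σ z) T) = g (aeval (σ z) a) := by rw [← map_mul, mul_comm, hTx]
  change g x ∈ _
  rw [eq_div_of_mul_eq (hT.map g).ne_zero h1]
  exact div_mem (hg a) (hg T)

end Fields

/-! ### The normalization `A'`, its local rings and residue fields -/

section Normalization

variable {A B k : Type*} [CommRing A] [CommRing B] [IsDomain B] [Algebra A B] [Field k] [CharZero k]
  {ψ : k[X] →+* A} {w : A} {u v : B} {σ : B ⧸ Ideal.span {v} →+* B}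
  {Γ : Set (B ⧸ Ideal.span {v})}

/-- The generator of `NodeModel.exists_generator` lies in the normalization. -/
theorem NodeModel.exists_normalization_generator (h : NodeModel ψ w u v) (hσ : IsNodeLift ψ v σ)
    (hΓ : Γ.Finite) : ∃ (P : StandardEtalePair A) (z : B) (hz : P.HasMap z),
      (P.lift z hz).toRingHom.Flat ∧ z ∈ normalizationIn A (σ '' Γ) ∧
      ∀ x, algebraMap B (FractionRing B) x ∈ adjoinedField A (σ '' Γ) →
        ∃ T a : A[X], IsUnit (aeval z T) ∧ aeval z T * x = aeval z a := by
  have := h.isPrime_span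
  have := h.isLocalRing
  obtain ⟨P, z, hz, hflat, -, hadj⟩ :=
    h.exists_generator (Q := (Ideal.span {v}).ResidueField) hσ hΓ
  refine ⟨P, σ z, hz, hflat, mem_normalizationIn.2 ⟨⟨P.f, P.monic_f, hz.1⟩, ?_⟩, fun x hx => ?_⟩
  · rw [← hadj]
    exact mem_adjoinedField rfl
  · exact exists_aeval_mul_eq_aeval hz hflat (hadj ▸ hx)

theorem NodeModel.isEtaleAt_primeM (h : NodeModel ψ w u v) (hσ : IsNodeLift ψ v σ)
    (hΓ : Γ.Finite) [(Ideal.span {u, v}).IsPrime] :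
    Algebra.IsEtaleAt A (primeM A u v (σ '' Γ)) := by
  have := h.isLocalRing
  obtain ⟨P, z, hz, hflat, hzS, hS⟩ := h.exists_normalization_generator hσ hΓ
  exact isEtaleAt_of_standardEtale hz hflat (ν := (normalizationIn A (σ '' Γ)).val)
    Subtype.val_injective (z₀ := ⟨z, hzS⟩) rfl _ (fun x => h.isUnit_iff.symm) fun x =>
      hS x (mem_normalizationIn.1 x.2).2

theorem NodeModel.exists_mul_mem_normalizationIn (h : NodeModel ψ w u v) (hσ : IsNodeLift ψ v σ)
    (hΓ : Γ.Finite) {x : B}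
    (hx : algebraMap B (FractionRing B) x ∈ adjoinedField A (σ '' Γ)) :
    ∃ t a : normalizationIn A (σ '' Γ), IsUnit (t : B) ∧ (t : B) * x = a := by
  obtain ⟨P, z, hz, hflat, hzS, hS⟩ := h.exists_normalization_generator hσ hΓ
  obtain ⟨T, a, hT, hTx⟩ := hS x hx
  have hmem : ∀ p : A[X], aeval z p ∈ normalizationIn A (σ '' Γ) := fun p => by
    have := aeval_algHom_apply (normalizationIn A (σ '' Γ)).val ⟨z, hzS⟩ p
    exact this ▸ (aeval (⟨z, hzS⟩ : normalizationIn A (σ '' Γ)) p).2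
  exact ⟨⟨_, hmem T⟩, ⟨_, hmem a⟩, hT, hTx⟩

variable [(Ideal.span {v}).IsPrime]

theorem residueMap_algebraMap (Γ : Set B) (a : normalizationIn A Γ) :
    residueMap A v Γ (algebraMap _ _ a) = algebraMap B _ (a : B) :=
  Ideal.ResidueField.map_algebraMap _ _ _ _ _

theorem localMap_algebraMap (Γ : Set B) (a : normalizationIn A Γ) :
    localMap A v Γ (algebraMap _ _ a) = algebraMap B _ (a : B) :=
  Localization.localRingHom_to_map _ _ _ _ _

theorem residueMap_algebraMap_localization (Γ : Set B)
    (y : Localization.AtPrime (primeP A v Γ)) :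
    residueMap A v Γ (algebraMap _ _ y) =
      algebraMap _ (Ideal.span {v}).ResidueField (localMap A v Γ y) := rfl

theorem NodeModel.exists_localMap_eq (h : NodeModel ψ w u v) (hσ : IsNodeLift ψ v σ)
    (hΓ : Γ.Finite) {x : B}
    (hx : algebraMap B (FractionRing B) x ∈ adjoinedField A (σ '' Γ)) :
    ∃ y, localMap A v (σ '' Γ) y = algebraMap B _ x := by
  obtain ⟨t, a, ht, hta⟩ := h.exists_mul_mem_normalizationIn hσ hΓ hx
  have htp : t ∈ (primeP A v (σ '' Γ)).primeCompl := fun hm =>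
    h.isUnit_iff.1 ht (Ideal.span_mono (by simp) (show (t : B) ∈ Ideal.span {v} from hm))
  refine ⟨IsLocalization.mk' _ a ⟨t, htp⟩, ?_⟩
  have h1 := congrArg (localMap A v (σ '' Γ))
    (IsLocalization.mk'_spec (Localization.AtPrime (primeP A v (σ '' Γ))) a ⟨t, htp⟩)
  rw [map_mul, localMap_algebraMap, localMap_algebraMap] at h1
  refine (ht.map (algebraMap B (Localization.AtPrime (Ideal.span {v})))).mul_right_cancel ?_
  rw [h1, ← hta, map_mul, mul_comm]

theorem NodeModel.exists_residueMap_eq (h : NodeModel ψ w u v) (hσ : IsNodeLift ψ v σ)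
    (hΓ : Γ.Finite) {x : B}
    (hx : algebraMap B (FractionRing B) x ∈ adjoinedField A (σ '' Γ)) :
    ∃ y, residueMap A v (σ '' Γ) y = algebraMap B _ x := by
  obtain ⟨y, hy⟩ := h.exists_localMap_eq hσ hΓ hx
  refine ⟨algebraMap _ _ y, ?_⟩
  rw [residueMap_algebraMap_localization, hy]
  rfl

/-- The residue field of `𝔭'` lies in `k(u)(Γ)`, which `σ` carries back into the adjoined field.
Thus the canonical lift of a residual factor has its coefficients in `A'_{𝔭'}`. -/
theorem NodeModel.lift_mem_adjoinedField (h : NodeModel ψ w u v) (hσ : IsNodeLift ψ v σ)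
    (hΓ : Γ.Finite) {c : B ⧸ Ideal.span {v}} {y : (primeP A v (σ '' Γ)).ResidueField}
    (hy : residueMap A v (σ '' Γ) y = algebraMap _ _ c) :
    algebraMap B (FractionRing B) (σ c) ∈ adjoinedField A (σ '' Γ) := by
  refine hσ.mem_adjoinedField (Q := (Ideal.span {v}).ResidueField) ?_
  rw [← hy]
  obtain ⟨a, b, hb, rfl⟩ := IsFractionRing.div_surjective
    (A := normalizationIn A (σ '' Γ) ⧸ primeP A v (σ '' Γ)) y
  obtain ⟨a, rfl⟩ := Ideal.Quotient.mk_surjective a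
  obtain ⟨b, rfl⟩ := Ideal.Quotient.mk_surjective b
  rw [Ideal.algebraMap_quotient_residueField_mk, Ideal.algebraMap_quotient_residueField_mk,
    map_div₀,
    residueMap_algebraMap, residueMap_algebraMap, ← Ideal.algebraMap_quotient_residueField_mk,
    ← Ideal.algebraMap_quotient_residueField_mk]
  exact div_mem (h.mk_mem_generatedField hσ hΓ (mem_normalizationIn.1 a.2).2)
    (h.mk_mem_generatedField hσ hΓ (mem_normalizationIn.1 b.2).2)

end Normalization

end MixedNP

namespace MixedNP

open IsLocalRing

/-! ### The canonical lift as an étale lift -/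

section Etale

theorem isEtaleAt_of_tower {A A' C : Type*} [CommRing A] [CommRing A'] [CommRing C] [Algebra A A']
    [Algebra A' C] [Algebra A C] [IsScalarTower A A' C] (m : Ideal A') [m.IsPrime] (q : Ideal C)
    [q.IsPrime] (hqm : q.under A' = m) (hm : Algebra.IsEtaleAt A m) (hq : Algebra.IsEtaleAt A q) :
    Algebra.IsEtaleAt A' q := by
  let g : Localization.AtPrime m →+* Localization.AtPrime q :=
    Localization.localRingHom m q (algebraMap A' C) hqm.symm
  let _ : Algebra (Localization.AtPrime m) (Localization.AtPrime q) := g.toAlgebra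
  have hg : ∀ x, algebraMap (Localization.AtPrime m) (Localization.AtPrime q)
      (algebraMap A' _ x) = algebraMap C _ (algebraMap A' C x) := fun x =>
    Localization.localRingHom_to_map m q (algebraMap A' C) hqm.symm x
  have h1 : IsScalarTower A' (Localization.AtPrime m) (Localization.AtPrime q) :=
    .of_algebraMap_eq fun x => by rw [hg, ← IsScalarTower.algebraMap_apply]
  have h2 : IsScalarTower A (Localization.AtPrime m) (Localization.AtPrime q) :=
    .of_algebraMap_eq fun x => by
      rw [IsScalarTower.algebraMap_apply A A' (Localization.AtPrime m), hg,
        ← IsScalarTower.algebraMap_apply A A' C, ← IsScalarTower.algebraMap_apply]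
  have h3 : Algebra.FormallyEtale A (Localization.AtPrime m) := hm
  have h4 : Algebra.FormallyEtale A (Localization.AtPrime q) := hq
  have h5 : Algebra.FormallyEtale (Localization.AtPrime m) (Localization.AtPrime q) :=
    Algebra.FormallyEtale.of_restrictScalars (R := A)
  have h6 : Algebra.FormallyEtale A' (Localization.AtPrime m) :=
    Algebra.FormallyEtale.of_isLocalization m.primeCompl
  exact Algebra.FormallyEtale.comp A' (Localization.AtPrime m) (Localization.AtPrime q)

end Etale

section IntegralClosure

/-- The integral closure in a subfield of the fraction field of an integrally closed domain `B` maps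
to `B`. -/
theorem exists_integralClosure_ringHom {S B L Q : Type*} [CommRing S] [CommRing B] [IsDomain B]
    [IsIntegrallyClosed B] [CommRing L] [Field Q] [Algebra B Q] [IsFractionRing B Q] [Algebra S L]
    (ν : S →+* B) (e : L →+* Q)
    (he : ∀ s, e (algebraMap S L s) = algebraMap B Q (ν s)) :
    ∃ Φ : integralClosure S L →+* B, ∀ x, algebraMap B Q (Φ x) = e x := by
  have hinj := IsFractionRing.injective B Q
  have hmem : ∀ x : integralClosure S L, e x ∈ (algebraMap B Q).range := by
    rintro ⟨x, p, hp, hpx⟩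
    refine IsIntegrallyClosed.algebraMap_eq_of_integral (R := B) ⟨p.map ν, hp.map ν, ?_⟩
    rw [eval₂_map, ← (RingHom.ext he : e.comp (algebraMap S L) = (algebraMap B Q).comp ν),
      ← hom_eval₂, hpx, map_zero]
  let ε : B ≃+* (algebraMap B Q).range := RingEquiv.ofBijective (algebraMap B Q).rangeRestrict
    ⟨fun a b h => hinj (congrArg Subtype.val h), (algebraMap B Q).rangeRestrict_surjective⟩
  refine ⟨ε.symm.toRingHom.comp
    ((e.comp (integralClosure S L).val.toRingHom).codRestrict _ hmem), fun x => ?_⟩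
  exact congrArg Subtype.val (ε.apply_symm_apply ⟨e x, hmem x⟩)

variable {A B : Type*} [CommRing A] [CommRing B] [IsDomain B] [Algebra A B]

/-- An element integral over `A'` lands in the normal ring `B`, is integral over `A` by
transitivity, and still lies in the adjoined field. -/
theorem isIntegrallyClosed_normalizationIn [IsIntegrallyClosed B] (Γ : Set B) :
    IsIntegrallyClosed (normalizationIn A Γ) := by
  have hinj : Function.Injective ((algebraMap B (FractionRing B)).comp
      (normalizationIn A Γ).val.toRingHom) :=
    (IsFractionRing.injective B (FractionRing B)).comp Subtype.val_injective
  rw [isIntegrallyClosed_iff (FractionRing (normalizationIn A Γ))]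
  intro x hx
  let j : FractionRing (normalizationIn A Γ) →+* FractionRing B := IsFractionRing.lift hinj
  have hj : ∀ a : normalizationIn A Γ, j (algebraMap _ _ a) = algebraMap B (FractionRing B) a :=
    fun a => IsFractionRing.lift_algebraMap hinj a
  obtain ⟨Φ, hΦ⟩ := exists_integralClosure_ringHom (normalizationIn A Γ).val.toRingHom j hj
  have hint : Algebra.IsIntegral A (normalizationIn A Γ) :=
    ⟨fun a => (isIntegral_algHom_iff (normalizationIn A Γ).val Subtype.val_injective).1
      (mem_normalizationIn.1 a.2).1⟩
  have hΦa : ∀ a : normalizationIn A Γ, Φ (algebraMap _ _ a) = a := fun a =>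
    IsFractionRing.injective B (FractionRing B) ((hΦ _).trans (hj a))
  have hmem : Φ ⟨x, hx⟩ ∈ normalizationIn A Γ := by
    refine mem_normalizationIn.2 ⟨?_, ?_⟩
    · refine isIntegral_trans (A := normalizationIn A Γ) _ ?_
      refine (integralClosure.isIntegral (⟨x, hx⟩ : integralClosure _ _)).map_of_comp_eq
        (RingHom.id _) Φ ?_
      exact RingHom.ext fun a => (hΦa a).symm
    · rw [hΦ]
      obtain ⟨a, b, -, rfl⟩ := IsFractionRing.div_surjective (A := normalizationIn A Γ) x
      rw [map_div₀, hj, hj]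
      exact div_mem (mem_normalizationIn.1 a.2).2 (mem_normalizationIn.1 b.2).2
  refine ⟨⟨_, hmem⟩, j.injective ?_⟩
  rw [hj]
  exact hΦ ⟨x, hx⟩

end IntegralClosure

section Lift

/-- The fraction field of the localized ring and the localization of `B` are placed compatibly
inside the fraction field of `B`, where `γ` can serve as a root of the lift. -/
theorem exists_fractionRing_ringHom {S S' F B B' : Type*} [CommRing S] [CommRing B]
    [IsDomain B] [CommRing S'] [Field F] [Algebra S S'] [Algebra S' F] [IsFractionRing S' F]
    [Algebra S F] (hF : ∀ s, algebraMap S F s = algebraMap S' F (algebraMap S S' s)) [CommRing B']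
    [Algebra B B'] {ν : S →+* B}
    (M : Submonoid S) [IsLocalization M S']
    (N : Submonoid B) (hN : N ≤ nonZeroDivisors B) [IsLocalization N B'] {μ : S' →+* B'}
    (hμi : Function.Injective μ) (hμ : ∀ s, μ (algebraMap S S' s) = algebraMap B B' (ν s)) :
    ∃ (θ : F →+* FractionRing B) (lam : B' →+* FractionRing B),
      (∀ b, lam (algebraMap B _ b) = algebraMap B _ b) ∧
      (∀ y, θ (algebraMap _ _ y) = lam (μ y)) ∧
      (∀ K : Subfield (FractionRing B), (∀ s, algebraMap B _ (ν s) ∈ K) → ∀ x, θ x ∈ K) ∧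
      ∀ s, θ (algebraMap S F s) = algebraMap B _ (ν s) := by
  have hinjB := IsFractionRing.injective B (FractionRing B)
  have hu : ∀ s : N, IsUnit (algebraMap B (FractionRing B) s) := by
    intro s
    rw [isUnit_iff_ne_zero, Ne, map_eq_zero_iff _ hinjB]
    exact nonZeroDivisors.ne_zero (hN s.2)
  have hlam : Function.Injective (IsLocalization.lift hu : B' →+* FractionRing B) := by
    rw [IsLocalization.lift_injective_iff]
    intro x y
    rw [(IsLocalization.injective B' hN).eq_iff, hinjB.eq_iff]
  have hinj : Function.Injective ((IsLocalization.lift hu : B' →+* FractionRing B).comp μ) :=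
    hlam.comp hμi
  have hθ := fun a => IsFractionRing.lift_algebraMap (K := F) hinj a
  have hθS : ∀ s, IsFractionRing.lift (K := F) hinj (algebraMap S F s) =
      algebraMap B _ (ν s) := fun s => by
    rw [hF, hθ, RingHom.comp_apply, hμ, IsLocalization.lift_eq]
  have hK : ∀ K : Subfield (FractionRing B), (∀ s, algebraMap B _ (ν s) ∈ K) →
      ∀ y : S', IsFractionRing.lift (K := F) hinj (algebraMap S' F y) ∈ K := by
    intro K hK y
    obtain ⟨x, s, rfl⟩ := IsLocalization.exists_mk'_eq M y
    have hs : algebraMap S' F (algebraMap S S' s) ≠ 0 :=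
      ((IsLocalization.map_units S' s).map (algebraMap S' F)).ne_zero
    have h1 : algebraMap S' F (IsLocalization.mk' S' x s) * algebraMap S' F (algebraMap S S' s) =
        algebraMap S' F (algebraMap S S' x) := by
      rw [← map_mul, IsLocalization.mk'_spec]
    rw [eq_div_of_mul_eq hs h1, ← hF, ← hF, map_div₀, hθS, hθS]
    exact div_mem (hK x) (hK s)
  refine ⟨IsFractionRing.lift hinj, IsLocalization.lift hu, IsLocalization.lift_eq hu, hθ,
    fun K hK' x => ?_, hθS⟩
  obtain ⟨a, b, -, rfl⟩ := IsFractionRing.div_surjective (A := S') x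
  rw [map_div₀]
  exact div_mem (hK K hK' a) (hK K hK' b)

/-- An algebra structure over a localization is determined by its values on `S`, so the property
passes between two structures that agree there. -/
theorem isFractionRing_of_forall {S S' F : Type*} [CommRing S] [CommRing S'] [CommRing F]
    [Algebra S S'] (M : Submonoid S) [IsLocalization M S'] (a a' : Algebra S' F)
    (h : letI := a; IsFractionRing S' F)
    (heq : ∀ s, a.algebraMap (algebraMap S S' s) = a'.algebraMap (algebraMap S S' s)) :
    letI := a'; IsFractionRing S' F := by
  have : a = a' := by
    refine Algebra.algebra_ext _ _ fun r => ?_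
    exact congrArg (fun f => f r)
      (IsLocalization.ringHom_ext M (RingHom.ext heq) : a.algebraMap = a'.algebraMap)
  exact this ▸ h

theorem algebraMap_fractionRing_atPrime {S : Type*} [CommRing S] [IsDomain S] (p : Ideal S)
    [p.IsPrime] (s : S) : algebraMap S (FractionRing (Localization.AtPrime p)) s =
      algebraMap (Localization.AtPrime p) _ (algebraMap S (Localization.AtPrime p) s) :=
  (IsLocalization.lift_eq (M := p.primeCompl) _ s).symm

theorem isFractionRing_atPrime {S : Type*} [CommRing S] [IsDomain S] (p : Ideal S) [p.IsPrime] :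
    IsFractionRing (Localization.AtPrime p) (FractionRing (Localization.AtPrime p)) :=
  isFractionRing_of_forall p.primeCompl OreLocalization.instAlgebra _
    (Localization.isLocalization (M := nonZeroDivisors (Localization.AtPrime p)))
    fun s => algebraMap_fractionRing_atPrime p s

/-- A monic polynomial that is irreducible over the residue field is irreducible, and Gauss's lemma
over a normal ring passes to the fraction field. -/
theorem irreducible_map_of_irreducible_map_residue {S S' F κ : Type*} [CommRing S] [IsDomain S]
    [IsIntegrallyClosed S] [CommRing S'] [IsDomain S'] [Field F] [Algebra S S'] [Algebra S' F]
    [IsFractionRing S' F] [Field κ] (M : Submonoid S) (hM : M ≤ nonZeroDivisors S)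
    [IsLocalization M S'] (ρ : S' →+* κ) {g : S'[X]} (hg : g.Monic)
    (hirr : Irreducible (g.map ρ)) : Irreducible (g.map (algebraMap S' F)) := by
  have hint : IsIntegrallyClosed S' := isIntegrallyClosed_of_isLocalization (R := S) _ M hM
  exact hg.irreducible_iff_irreducible_map_fraction_map.1
    (hg.irreducible_of_irreducible_map _ _ hirr)

/-- The root `γ` embeds `F[y]/(G)` into the fraction field of `B`. By normality the integral closure
goes into `B`, and `q` is the preimage of the maximal ideal. It is étale over `A` by the point `z`,
hence over `S` by cancellation along the étale local ring at `m`. -/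
theorem exists_isEtaleAt_of_root {A S F B : Type*} [CommRing A] [CommRing S] [CommRing B] [Field F]
    [IsDomain B] [IsIntegrallyClosed B] [IsLocalRing B] [Algebra S F]
    [Algebra A S] [Algebra A B] {ν : S →ₐ[A] B} (m : Ideal S)
    [m.IsPrime] (hm : ∀ x, x ∉ m ↔ IsUnit (ν x)) (hem : Algebra.IsEtaleAt A m)
    {G : F[X]} (hirr : Irreducible G) {θ : F →+* FractionRing B}
    (hθ : ∀ s, θ (algebraMap S F s) = algebraMap B _ (ν s)) {γ : B}
    (hγ : G.eval₂ θ (algebraMap B _ γ) = 0)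
    {K : Subfield (FractionRing B)} (hK : ∀ x, θ x ∈ K) (hγK : algebraMap B _ γ ∈ K)
    {P : StandardEtalePair A} {z : B} (hz : P.HasMap z)
    (hflat : (P.lift z hz).toRingHom.Flat)
    (hzK : ∀ L : Subfield (FractionRing B), (∀ x, θ x ∈ L) → algebraMap B _ γ ∈ L →
      algebraMap B _ z ∈ L)
    (hT : ∀ x : B, algebraMap B _ x ∈ K →
      ∃ T a : A[X], IsUnit (aeval z T) ∧ aeval z T * x = aeval z a) :
    ∃ (q : Ideal (integralClosure S (AdjoinRoot G))) (_ : q.IsPrime),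
      q.under S = m ∧ Algebra.IsEtaleAt S q ∧
      ∃ a t : integralClosure S (AdjoinRoot G), t ∉ q ∧ t.1 * AdjoinRoot.root _ = a.1 := by
  have hinjB := IsFractionRing.injective B (FractionRing B)
  have hfact := Fact.mk hirr
  let e : AdjoinRoot G →+* FractionRing B := AdjoinRoot.lift θ (algebraMap B _ γ) hγ
  have hei : Function.Injective e := e.injective
  have heK : ∀ x, e x ∈ K := by
    intro x
    obtain ⟨q, rfl⟩ := AdjoinRoot.mk_surjective x
    rw [AdjoinRoot.lift_mk, eval₂_eq_sum_range]
    exact sum_mem fun i _ => mul_mem (hK _) (pow_mem hγK i)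
  have heS : ∀ s, e (algebraMap S _ s) = algebraMap B _ (ν s) := by
    intro s
    rw [IsScalarTower.algebraMap_apply S F (AdjoinRoot G),
      AdjoinRoot.algebraMap_eq, AdjoinRoot.lift_of, hθ]
  obtain ⟨Φ, hΦ⟩ := exists_integralClosure_ringHom (ν : S →+* B) e heS
  have hΦi : Function.Injective Φ := fun a b hab => Subtype.ext (hei (by rw [← hΦ, ← hΦ, hab]))
  have hΦS : ∀ s, Φ (algebraMap S _ s) = ν s := fun s => hinjB ((hΦ _).trans (heS s))
  let _ : Algebra A (integralClosure S (AdjoinRoot G)) :=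
    ((algebraMap S _).comp (algebraMap A S)).toAlgebra
  have htower : IsScalarTower A S (integralClosure S (AdjoinRoot G)) :=
    .of_algebraMap_eq fun _ => rfl
  let Φ' : integralClosure S (AdjoinRoot G) →ₐ[A] B :=
    { Φ with commutes' := fun a => (hΦS _).trans (ν.commutes a) }
  -- The image of `F[y]/(G)` is a field containing `F` and `γ`, hence `z`; and `z` is a root of the
  -- monic polynomial of the pair.
  obtain ⟨z₀, hz₀⟩ : ∃ z₀, Φ' z₀ = z := by
    obtain ⟨x, hx⟩ : algebraMap B _ z ∈ e.fieldRange := by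
      refine hzK _ (fun x => ⟨AdjoinRoot.of G x, AdjoinRoot.lift_of hγ⟩)
        ⟨AdjoinRoot.root G, AdjoinRoot.lift_root hγ⟩
    refine ⟨⟨x, P.f.map (algebraMap A S), P.monic_f.map _, hei ?_⟩, hinjB ((hΦ _).trans hx)⟩
    rw [hom_eval₂, hx, map_zero, eval₂_map,
      (RingHom.ext heS : e.comp (algebraMap S _) = (algebraMap B _).comp (ν : S →+* B)),
      RingHom.comp_assoc, (RingHom.ext ν.commutes : (ν : S →+* B).comp (algebraMap A S) = _),
      ← hom_eval₂, ← aeval_def, hz.1, map_zero]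
  have hT' : ∀ x, ∃ T a : A[X], IsUnit (aeval z T) ∧ aeval z T * Φ' x = aeval z a := fun x =>
    hT _ ((hΦ x).symm ▸ heK x)
  let q : Ideal (integralClosure S (AdjoinRoot G)) := (maximalIdeal B).comap Φ
  have hq : ∀ x, x ∉ q ↔ IsUnit (Φ' x) := fun x => by
    rw [Ideal.mem_comap, mem_maximalIdeal, mem_nonunits_iff, not_not]
    rfl
  have hqm : q.under S = m := by
    ext s
    rw [← not_iff_not, hm, Ideal.mem_comap, hq]
    exact (congrArg IsUnit (hΦS s)).to_iff
  refine ⟨q, inferInstance, hqm, ?_, ?_⟩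
  · exact isEtaleAt_of_tower m q hqm hem
      (isEtaleAt_of_standardEtale hz hflat (ν := Φ') hΦi hz₀ q hq hT')
  · obtain ⟨T, a, hTu, hTa⟩ := hT γ hγK
    have hae : ∀ r : A[X], Φ' (aeval z₀ r) = aeval z r := fun r => by
      rw [← aeval_algHom_apply, hz₀]
    refine ⟨aeval z₀ a, aeval z₀ T, (hq _).2 ((hae T).symm ▸ hTu), hei ?_⟩
    have h1 : ∀ r : A[X], e (aeval z₀ r).1 = algebraMap B _ (aeval z r) := fun r => by
      rw [← hΦ, ← hae]
      rfl
    rw [map_mul, h1, h1, ← hTa, map_mul]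
    exact congrArg _ (AdjoinRoot.lift_root hγ)

variable {A B k : Type*} [CommRing A] [CommRing B] [IsDomain B] [Algebra A B]

theorem localMap_injective {v : B} [(Ideal.span {v}).IsPrime] (Γ : Set B) :
    Function.Injective (localMap A v Γ) := by
  rw [injective_iff_map_eq_zero]
  intro y hy
  obtain ⟨x, s, rfl⟩ := IsLocalization.exists_mk'_eq (primeP A v Γ).primeCompl y
  have h1 := congrArg (localMap A v Γ) (IsLocalization.mk'_spec
    (Localization.AtPrime (primeP A v Γ)) x s)
  rw [map_mul, hy, zero_mul, localMap_algebraMap, eq_comm,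
    map_eq_zero_iff _ (IsLocalization.injective _
      (Ideal.span {v}).primeCompl_le_nonZeroDivisors)] at h1
  rw [show x = 0 from Subtype.ext h1, IsLocalization.mk'_zero]

variable [Field k] [CharZero k] {ψ : k[X] →+* A} {w : A} {u v : B} {σ : B ⧸ Ideal.span {v} →+* B}
  {Γ : Set (B ⧸ Ideal.span {v})}

theorem IsCanonicalLift.map_eq (hσ : ∀ c, Ideal.Quotient.mk (Ideal.span {v}) (σ c) = c)
    [(Ideal.span {v}).IsPrime] {Γ : Set B} {gbar : (primeP A v Γ).ResidueField[X]}
    {gv : (B ⧸ Ideal.span {v})[X]} {g : (Localization.AtPrime (primeP A v Γ))[X]}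
    (hcan : IsCanonicalLift A v σ Γ gbar gv g) :
    g.map (algebraMap (Localization.AtPrime (primeP A v Γ)) (primeP A v Γ).ResidueField) =
      gbar := by
  apply map_injective _ (residueMap A v Γ).injective
  have h1 : (residueMap A v Γ).comp (algebraMap (Localization.AtPrime (primeP A v Γ)) _) =
      (algebraMap (Localization.AtPrime (Ideal.span {v})) _).comp (localMap A v Γ) := rfl
  rw [← hcan.1, map_map, h1, ← map_map, hcan.2, map_map, map_map]
  congr 1
  refine RingHom.ext fun c => ?_
  simp only [RingHom.comp_apply]
  rw [← IsScalarTower.algebraMap_apply, ← Ideal.algebraMap_quotient_residueField_mk, hσ]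

theorem IsCanonicalLift.eval₂_eq_zero [(Ideal.span {v}).IsPrime] {Γ : Set B} {F L : Type*}
    [CommRing F] [CommRing L] {gbar : (primeP A v Γ).ResidueField[X]}
    {gv : (B ⧸ Ideal.span {v})[X]} {g : (Localization.AtPrime (primeP A v Γ))[X]}
    (hcan : IsCanonicalLift A v σ Γ gbar gv g) {β : B ⧸ Ideal.span {v}} (hβ : gv.IsRoot β)
    {j : Localization.AtPrime (primeP A v Γ) →+* F} {θ : F →+* L}
    {lam : Localization.AtPrime (Ideal.span {v}) →+* L}
    (hθ : ∀ y, θ (j y) = lam (localMap A v Γ y)) :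
    (g.map j).eval₂ θ (lam (algebraMap B _ (σ β))) = 0 := by
  have h1 : θ.comp j = lam.comp (localMap A v Γ) := RingHom.ext hθ
  rw [eval₂_map, h1, ← eval₂_map, hcan.2, ← eval_map, eval_map_apply, eval_map_apply,
    eval_map_apply, hβ, map_zero, map_zero, map_zero]

/-- The étale point is a generator of the field with `σ β` adjoined as well, obtained from the
finite set `Γ ∪ {β}`. -/
theorem NodeModel.isIntegralEtaleLift (h : NodeModel ψ w u v) (hσ : IsNodeLift ψ v σ)
    (hΓ : Γ.Finite) [(Ideal.span {v}).IsPrime] [(Ideal.span {u, v}).IsPrime]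
    {gbar : (primeP A v (σ '' Γ)).ResidueField[X]} {gv : (B ⧸ Ideal.span {v})[X]}
    {g : (Localization.AtPrime (primeP A v (σ '' Γ)))[X]} (hirr : Irreducible gbar)
    (hmonic : gbar.Monic) (hcan : IsCanonicalLift A v σ (σ '' Γ) gbar gv g)
    {β : B ⧸ Ideal.span {v}} (hβ : gv.IsRoot β) :
    IsIntegralEtaleLift (primeP A v (σ '' Γ)) (primeM A u v (σ '' Γ)) gbar g := by
  have := h.isLocalRing
  have := h.isIntegrallyClosed
  have := isIntegrallyClosed_normalizationIn (A := A) (σ '' Γ)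
  have hinjR := IsFractionRing.injective (B ⧸ Ideal.span {v}) (Ideal.span {v}).ResidueField
  have hgv : gv.Monic := monic_of_injective hinjR (hcan.1 ▸ hmonic.map _)
  have hg : g.Monic := monic_of_injective (localMap_injective _)
    (hcan.2 ▸ (hgv.map _).map _)
  have hgbar := hcan.map_eq hσ.mk_apply
  have hfrac := isFractionRing_atPrime (primeP A v (σ '' Γ))
  obtain ⟨θ, lam, hlam, hθl, hθK, hθ⟩ := exists_fractionRing_ringHom
    (ν := (normalizationIn A (σ '' Γ)).val.toRingHom)
    (F := FractionRing (Localization.AtPrime (primeP A v (σ '' Γ))))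
    (algebraMap_fractionRing_atPrime _) (primeP A v (σ '' Γ)).primeCompl
    (Ideal.span {v}).primeCompl (Ideal.primeCompl_le_nonZeroDivisors _)
    (localMap_injective (A := A) (v := v) (σ '' Γ)) (localMap_algebraMap _)
  obtain ⟨P, z, hz, hflat, hzS, hT⟩ := h.exists_normalization_generator hσ (hΓ.insert β)
  rw [Set.image_insert_eq] at hzS hT
  have hγK : algebraMap B (FractionRing B) (σ β) ∈ adjoinedField A (insert (σ β) (σ '' Γ)) :=
    mem_adjoinedField (Set.mem_insert _ _)
  have hirr' := irreducible_map_of_irreducible_map_residue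
    (F := FractionRing (Localization.AtPrime (primeP A v (σ '' Γ))))
    (primeP A v (σ '' Γ)).primeCompl
    (Ideal.primeCompl_le_nonZeroDivisors _) (algebraMap _ _) hg (hgbar.symm ▸ hirr)
  have hroot := hcan.eval₂_eq_zero hβ hθl
  rw [hlam] at hroot
  have hK : ∀ x, θ x ∈ adjoinedField A (insert (σ β) (σ '' Γ)) := fun x =>
    hθK _ (fun s => adjoinedField_mono (Set.subset_insert _ _) (mem_normalizationIn.1 s.2).2) x
  -- Every adjoined element is a quotient of elements of `A'`, so the images of the fraction field
  -- of `A'` and of `γ` generate everything.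
  have hzK : ∀ L : Subfield (FractionRing B), (∀ x, θ x ∈ L) → algebraMap B _ (σ β) ∈ L →
      algebraMap B _ z ∈ L := by
    intro L hL hγL
    have hS : ∀ s : normalizationIn A (σ '' Γ), algebraMap B (FractionRing B) s ∈ L := fun s =>
      (hθ s) ▸ hL _
    refine adjoinedField_le (fun a => ?_) ?_ (mem_normalizationIn.1 hzS).2
    · exact hS (algebraMap A (normalizationIn A (σ '' Γ)) a)
    · rintro γ (rfl | hγ)
      · exact hγL
      · obtain ⟨t, a, ht, hta⟩ := h.exists_mul_mem_normalizationIn hσ hΓ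
          (mem_adjoinedField (A := A) hγ)
        have h1 : algebraMap B (FractionRing B) γ * algebraMap B _ (t : B) =
            algebraMap B _ (a : B) := by rw [← map_mul, mul_comm, hta]
        rw [eq_div_of_mul_eq (ht.map (algebraMap B (FractionRing B))).ne_zero h1]
        exact div_mem (hS a) (hS t)
  refine ⟨hgbar, by rw [← hgbar, hg.natDegree_map], hirr', ?_⟩
  exact exists_isEtaleAt_of_root (ν := (normalizationIn A (σ '' Γ)).val) _
    (fun x => h.isUnit_iff.symm) (h.isEtaleAt_primeM hσ hΓ) hirr' hθ hroot hK hγK hz hflat hzK hT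

end Lift

end MixedNP

namespace MixedNP

/-! ### Residual factors and their roots -/

section Residual

variable {B : Type*} [CommRing B]

theorem coeff_comp_mem {S : Subring B} {f q : B[X]} (hf : ∀ i, f.coeff i ∈ S)
    (hq : ∀ i, q.coeff i ∈ S) (i : ℕ) : (f.comp q).coeff i ∈ S := by
  have key : ∀ p : B[X], (∀ i, p.coeff i ∈ S) → ∃ p' : S[X], p'.map S.subtype = p := fun p hp =>
    (mem_lifts p).1 ((lifts_iff_coeff_lifts p).2 fun n => ⟨⟨_, hp n⟩, rfl⟩)
  obtain ⟨f, rfl⟩ := key f hf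
  obtain ⟨q, rfl⟩ := key q hq
  rw [← map_comp, coeff_map]
  exact ((f.comp q).coeff i).2

theorem isRoot_map_prod_iff [IsDomain B] {v : B} {t : Multiset B} (σ : B ⧸ Ideal.span {v} →+* B)
    {γ : B} :
    (((t.map fun c => X - C (Ideal.Quotient.mk (Ideal.span {v}) c)).prod).map σ).IsRoot γ ↔
      ∃ c ∈ t, γ = σ (Ideal.Quotient.mk _ c) := by
  simp [IsRoot, Polynomial.map_multiset_prod, Multiset.map_map, eval_multiset_prod,
    Multiset.prod_eq_zero_iff, sub_eq_zero]

theorem algebraMap_residueField_eq_zero_iff {v : B} [(Ideal.span {v}).IsPrime] {b : B} :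
    algebraMap B (Ideal.span {v}).ResidueField b = 0 ↔ v ∣ b := by
  rw [Ideal.algebraMap_residueField_eq_zero, Ideal.mem_span_singleton]

theorem NewtonFactored.map_residueField {v : B} [(Ideal.span {v}).IsPrime] {s : Multiset B}
    {f₁ : B[X]} (hs : NewtonFactored v s f₁) :
    ∃ g₀ : (Ideal.span {v}).ResidueField, g₀ ≠ 0 ∧
      f₁.map (algebraMap B (Ideal.span {v}).ResidueField) =
        (s.map fun b => X - C (algebraMap B (Ideal.span {v}).ResidueField b)).prod * C g₀ := by
  obtain ⟨g₀, H, hg, rfl⟩ := hs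
  refine ⟨_, fun h => hg (algebraMap_residueField_eq_zero_iff.1 h), ?_⟩
  have hv : algebraMap B (Ideal.span {v}).ResidueField v = 0 :=
    algebraMap_residueField_eq_zero_iff.2 dvd_rfl
  simp [Polynomial.map_multiset_prod, Multiset.map_map, hv]

variable {A : Type*} [CommRing A] [IsDomain B] [Algebra A B]

theorem coeff_comp_X_add_C_mem_adjoinedField {Γ : Set B} {f : B[X]} {γ : B}
    (hf : ∀ i, algebraMap B (FractionRing B) (f.coeff i) ∈ adjoinedField A Γ) (i : ℕ) :
    algebraMap B (FractionRing B) ((f.comp (X + C γ)).coeff i) ∈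
      adjoinedField A (insert γ Γ) := by
  refine coeff_comp_mem
    (S := (adjoinedField A (insert γ Γ)).toSubring.comap (algebraMap B (FractionRing B)))
    (fun j => adjoinedField_mono (Set.subset_insert _ _) (hf j)) (fun j => ?_) i
  rw [coeff_add, coeff_X, coeff_C]
  refine add_mem ?_ ?_ <;> split_ifs
  · exact one_mem _
  · exact zero_mem _
  · exact mem_adjoinedField (Set.mem_insert _ _)
  · exact zero_mem _

theorem IsRescaling.coeff_mem_adjoinedField {Γ : Set B} {f f₁ : B[X]} {v : B} {e : ℕ}
    (hv : v ≠ 0) (hvK : algebraMap B (FractionRing B) v ∈ adjoinedField A Γ)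
    (hr : IsRescaling v e f f₁)
    (hf : ∀ i, algebraMap B (FractionRing B) (f.coeff i) ∈ adjoinedField A Γ) (i : ℕ) :
    algebraMap B (FractionRing B) (f₁.coeff i) ∈ adjoinedField A Γ := by
  obtain ⟨m, hm, -⟩ := hr
  have h1 : v ^ m * f₁.coeff i = f.coeff i * (v ^ e) ^ i := by
    simpa only [coeff_C_mul, comp_C_mul_X_coeff] using congrArg (fun p => p.coeff i) hm
  have h1 := congrArg (algebraMap B (FractionRing B)) h1
  simp only [map_mul, map_pow] at h1
  have h0 : algebraMap B (FractionRing B) v ^ m ≠ 0 := pow_ne_zero _ (by simpa using hv)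
  rw [eq_div_of_mul_eq h0 ((mul_comm _ _).trans h1)]
  exact div_mem (mul_mem (hf i) (pow_mem (pow_mem hvK _) _)) (pow_mem hvK _)

theorem exists_multiset_of_dvd_prod {K : Type*} [Field K] (ρ : B →+* K) {s : Multiset B} {p : K[X]}
    (hp : p.Monic) (h : p ∣ (s.map fun b => X - C (ρ b)).prod) :
    ∃ t : Multiset B, (∀ b ∈ t, b ∈ s) ∧ p = (t.map fun b => X - C (ρ b)).prod := by
  have hmap : (s.map fun b => X - C (ρ b)) = (s.map ρ).map fun a => X - C a := by
    rw [Multiset.map_map]; rfl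
  rw [hmap] at h
  have hne : ((s.map ρ).map fun a => X - C a).prod ≠ 0 :=
    (monic_multisetProd_X_sub_C _).ne_zero
  have hroots := roots.le_of_dvd hne h
  rw [roots_multiset_prod_X_sub_C] at hroots
  have hex : ∀ x ∈ p.roots, ∃ b, b ∈ s ∧ ρ b = x := fun x hx =>
    Multiset.mem_map.1 (Multiset.mem_of_le hroots hx)
  choose! g hg using hex
  refine ⟨p.roots.map g, fun b hb => ?_, ?_⟩
  · obtain ⟨x, hx, rfl⟩ := Multiset.mem_map.1 hb
    exact (hg x hx).1
  · have hsplit : p.Splits := Splits.of_dvd (Splits.multisetProd (by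
      intro q hq
      obtain ⟨a, -, rfl⟩ := Multiset.mem_map.1 hq
      exact Splits.X_sub_C a)) hne h
    conv_lhs => rw [hsplit.eq_prod_roots_of_monic hp]
    rw [Multiset.map_map]
    refine congrArg _ (Multiset.map_congr rfl fun x hx => ?_)
    rw [Function.comp_apply, (hg x hx).2]

variable {v : B} [(Ideal.span {v}).IsPrime] {Γ : Set B} {s : Multiset B} {f₁ : B[X]}

/-- The reduction of `f₁` splits over the residue field of `(v)`, up to a constant, into factors
given by the roots of `f₁`; a divisor selects some of them, and at least one because its degree is
positive. -/
theorem IsResidualFactor.exists_multiset {gbar : (primeP A v Γ).ResidueField[X]}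
    (hs : NewtonFactored v s f₁) (hg : IsResidualFactor A v Γ f₁ gbar) :
    ∃ t : Multiset B, (∀ c ∈ t, c ∈ s) ∧ t ≠ 0 ∧ gbar.map (residueMap A v Γ) =
      ((t.map fun c => X - C (Ideal.Quotient.mk (Ideal.span {v}) c)).prod).map
        (algebraMap _ (Ideal.span {v}).ResidueField) := by
  obtain ⟨fbar, hfbar, hmonic, hirr, hdvd⟩ := hg
  obtain ⟨g₀, hg₀, hf⟩ := hs.map_residueField
  have h1 := Polynomial.map_dvd (residueMap A v Γ) hdvd
  rw [hfbar, hf, (isUnit_C.2 hg₀.isUnit).dvd_mul_right] at h1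
  obtain ⟨t, hts, ht⟩ := exists_multiset_of_dvd_prod _ (hmonic.map _) h1
  refine ⟨t, hts, ?_, ?_⟩
  · rintro rfl
    have := hirr.natDegree_pos
    rw [← hmonic.natDegree_map (residueMap A v Γ), ht] at this
    simp at this
  · rw [ht, Polynomial.map_multiset_prod, Multiset.map_map]
    simp

/-- The factor is the minimal polynomial of the reduction of `c`. This shows that a factor exists,
and that any prescribed root can be followed. -/
theorem exists_isResidualFactor_of_mem (hs : NewtonFactored v s f₁)
    (hf : ∀ i, ∃ y, residueMap A v Γ y = algebraMap B _ (f₁.coeff i)) {c : B} (hc : c ∈ s) :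
    ∃ gbar, IsResidualFactor A v Γ f₁ gbar ∧
      (gbar.map (residueMap A v Γ)).IsRoot (algebraMap B _ c) := by
  obtain ⟨fbar, hfbar⟩ := (mem_lifts _).1 ((lifts_iff_coeff_lifts
    (f := residueMap A v Γ) (f₁.map (algebraMap B _))).2 fun n => by
      obtain ⟨y, hy⟩ := hf n
      exact ⟨y, by rw [hy, coeff_map]⟩)
  obtain ⟨g₀, hg₀, hg⟩ := hs.map_residueField
  have hne : fbar ≠ 0 := by
    rintro rfl
    rw [Polynomial.map_zero, hg, eq_comm] at hfbar
    refine mul_ne_zero ?_ (C_ne_zero.2 hg₀) hfbar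
    have := (monic_multisetProd_X_sub_C
      (s.map (algebraMap B (Ideal.span {v}).ResidueField))).ne_zero
    rwa [Multiset.map_map] at this
  let _ : Algebra (primeP A v Γ).ResidueField (Ideal.span {v}).ResidueField :=
    (residueMap A v Γ).toAlgebra
  have hroot : aeval (algebraMap B (Ideal.span {v}).ResidueField c) fbar = 0 := by
    change fbar.eval₂ (residueMap A v Γ) _ = 0
    rw [← eval_map, hfbar, eval_map_apply, hs.eval_eq_zero hc, map_zero]
  have hint : IsIntegral (primeP A v Γ).ResidueField
      (algebraMap B (Ideal.span {v}).ResidueField c) :=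
    (show IsAlgebraic _ _ from ⟨fbar, hne, hroot⟩).isIntegral
  refine ⟨minpoly _ _, ⟨fbar, hfbar, minpoly.monic hint, minpoly.irreducible hint,
    minpoly.dvd _ _ hroot⟩, ?_⟩
  rw [IsRoot, eval_map]
  exact minpoly.aeval _ _

variable {σ : B ⧸ Ideal.span {v} →+* B} {gbar : (primeP A v Γ).ResidueField[X]}
  {gv : (B ⧸ Ideal.span {v})[X]} {g : (Localization.AtPrime (primeP A v Γ))[X]} {t : Multiset B}

theorem IsCanonicalLift.eq_prod (hcan : IsCanonicalLift A v σ Γ gbar gv g)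
    (ht : gbar.map (residueMap A v Γ) =
      ((t.map fun c => X - C (Ideal.Quotient.mk (Ideal.span {v}) c)).prod).map
        (algebraMap _ (Ideal.span {v}).ResidueField)) :
    gv = (t.map fun c => X - C (Ideal.Quotient.mk (Ideal.span {v}) c)).prod :=
  map_injective _ (IsFractionRing.injective (B ⧸ Ideal.span {v}) (Ideal.span {v}).ResidueField)
    (hcan.1.trans ht)

theorem IsCanonicalLift.isRoot_iff (hcan : IsCanonicalLift A v σ Γ gbar gv g) {γ : B} :
    (g.map (localMap A v Γ)).IsRoot (algebraMap B _ γ) ↔ (gv.map σ).IsRoot γ := by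
  have hinj := IsLocalization.injective (Localization.AtPrime (Ideal.span {v}))
    (Ideal.span {v}).primeCompl_le_nonZeroDivisors
  rw [hcan.2, IsRoot, eval_map_apply, map_eq_zero_iff _ hinj]
  rfl

end Residual

end MixedNP

namespace MixedNP

/-! ### The invariant of the mixed algorithm and its correctness -/

section Invariant

variable {A B k : Type*} [CommRing A] [CommRing B] [Algebra A B] [Field k]
  {ψ : k[X] →+* A} {w : A} {u v : B} {σ : B ⧸ Ideal.span {v} →+* B}

theorem IsNodeLift.dvd_sub (hσ : IsNodeLift ψ v σ) (c : B) :
    v ∣ c - σ (Ideal.Quotient.mk (Ideal.span {v}) c) := by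
  rw [← Ideal.mem_span_singleton, ← Ideal.Quotient.eq, hσ.mk_apply]

theorem IsNodeLift.map_mk_u (hσ : IsNodeLift ψ v σ) (h : NodeModel ψ w u v) :
    σ (Ideal.Quotient.mk (Ideal.span {v}) u) = u := by
  rw [← h.map_X, hσ.apply_poly]

/-- The roots of the canonical lifts that have been adjoined are lifts of elements of `B/(v)`. -/
def IsLiftedFinite (σ : B ⧸ Ideal.span {v} →+* B) (Γ : Set B) : Prop :=
  ∃ Γ₀ : Set (B ⧸ Ideal.span {v}), Γ₀.Finite ∧ σ '' Γ₀ = Γ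

variable [IsDomain B]

theorem NodeModel.exists_emultiplicity_eq (h : NodeModel ψ w u v) {b : B} (hb : b ≠ 0) :
    ∃ (n : ℕ) (c : B), emultiplicity v b = n ∧ b = v ^ n * c := by
  obtain ⟨n, c, rfl, hc⟩ := h.exists_eq_pow_mul hb
  refine ⟨n, c, emultiplicity_eq_of_dvd_of_not_dvd (dvd_mul_right _ _) ?_, rfl⟩
  rwa [pow_succ, mul_dvd_mul_iff_left (pow_ne_zero n h.prime.ne_zero)]

/-- The properties that are preserved by the passes of the mixed algorithm for the polynomial
`f`. -/
structure MixedInvariant (A : Type*) [CommRing A] [Algebra A B] (u : B)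
    (σ : B ⧸ Ideal.span {v} →+* B) (hm : ℕ) (f : B[X]) (S : MixedState B) : Prop where
  adjoined : IsLiftedFinite σ S.adjoined
  coeff : ∀ i, algebraMap B (FractionRing B) (S.f.coeff i) ∈ adjoinedField A S.adjoined
  factored : ∃ s, NewtonFactored v s S.f ∧ (S.first = false → ∃ b ∈ s, v ∣ b) ∧
    (S.first = true → s.card = f.natDegree)
  eval_eq_zero : ∀ β, S.f.eval β = 0 → f.eval (S.rp + v ^ S.prec * β) = 0
  dvd_sub : u ^ hm ∣ S.rp - S.rm

theorem MixedInvariant.init (hm : ℕ) {f : A[X]}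
    (hlead : IsUnit (algebraMap A B f.leadingCoeff)) (hv : ¬ IsUnit v)
    (hsplit : (f.map (algebraMap A B)).Splits) :
    MixedInvariant A u σ hm (f.map (algebraMap A B)) (.init (f.map (algebraMap A B))) := by
  refine ⟨⟨∅, Set.finite_empty, Set.image_empty _⟩, fun i => ?_, ⟨(f.map (algebraMap A B)).roots,
    ⟨algebraMap A B f.leadingCoeff, 0, fun h => hv (isUnit_of_dvd_unit h hlead), ?_⟩,
    fun h => absurd h (by simp [MixedState.init]), fun _ => ?_⟩, ?_, ?_⟩
  · simpa [MixedState.init] using algebraMap_mem_adjoinedField _ _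
  · have h1 := hsplit.eq_prod_roots
    rw [leadingCoeff_map_of_leadingCoeff_ne_zero _ hlead.ne_zero, mul_comm] at h1
    simpa [MixedState.init] using h1
  · exact hsplit.natDegree_eq_card_roots.symm
  · simp [MixedState.init]
  · simp [MixedState.init]

variable {hm hp : ℕ} {f : B[X]} {S T : MixedState B}

theorem MixedInvariant.rescaling_coeff (h : NodeModel ψ w u v)
    (hS : MixedInvariant A u σ hm f S) {e : ℕ} {f₁ : B[X]} (hr : IsRescaling v e S.f f₁) (i : ℕ) :
    algebraMap B (FractionRing B) (f₁.coeff i) ∈ adjoinedField A S.adjoined :=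
  hr.coeff_mem_adjoinedField h.prime.ne_zero
    (h.map_w ▸ algebraMap_mem_adjoinedField S.adjoined w) hS.coeff i

theorem MixedInvariant.exists_eval_eq_zero (h : NodeModel ψ w u v)
    (hS : MixedInvariant A u σ hm f S) (hT : MixedHalts v hp S) :
    ∃ β, S.f.eval β = 0 ∧ v ^ hp ∣ v ^ S.prec * β := by
  rcases hT with h0 | ⟨e, hadm, hslope, hle⟩
  · exact ⟨0, by rwa [← coeff_zero_eq_eval_zero], by simp⟩
  · obtain ⟨s, hs, -, -⟩ := hS.factored
    have he : 0 ≤ e := hadm.elim (fun h => h.le) fun h => h.2.ge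
    obtain ⟨b, hb, n, hn, rfl⟩ := (hs.hasSlope_iff h.prime he).1 hslope
    refine ⟨b, hs.eval_eq_zero hb, ?_⟩
    have hle' : hp ≤ S.prec + n := by exact_mod_cast hle
    refine (pow_dvd_pow v hle').trans ?_
    rw [pow_add]
    exact mul_dvd_mul_left _ (pow_dvd_of_le_emultiplicity hn.ge)

/-- Since `r_𝔪` and `r_𝔭` agree modulo `u^{h_𝔪}`, the `v`-adic congruence alone suffices. -/
theorem MixedInvariant.isApproximation (hS : MixedInvariant A u σ hm f S) {α : B}
    (hα : v ^ hp ∣ α - S.rp) : IsApproximation u v hm hp α S.rm S.rp := by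
  refine ⟨Ideal.mem_span_singleton.2 hα, ?_⟩
  have h1 : S.rp - S.rm ∈ Ideal.span {u ^ hm, v ^ hp} :=
    Ideal.span_mono (by simp) (Ideal.mem_span_singleton.2 hS.dvd_sub)
  have h2 : α - S.rp ∈ Ideal.span {u ^ hm, v ^ hp} :=
    Ideal.span_mono (by simp) (Ideal.mem_span_singleton.2 hα)
  convert add_mem h1 h2 using 1
  ring

theorem MixedInvariant.slope_integral (h : NodeModel ψ w u v) (hS : MixedInvariant A u σ hm f S)
    {e : ℚ} (hadm : Admissible S.first e) (hslope : HasSlope v S.f e) : ∃ n : ℕ, e = n := by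
  obtain ⟨s, hs, -, -⟩ := hS.factored
  have he : 0 ≤ e := hadm.elim (fun h => h.le) fun h => h.2.ge
  obtain ⟨-, -, n, -, rfl⟩ := (hs.hasSlope_iff h.prime he).1 hslope
  exact ⟨n, rfl⟩

theorem MixedInvariant.exists_slope (h : NodeModel ψ w u v) (hS : MixedInvariant A u σ hm f S)
    (hdeg : S.first = false ∨ 0 < f.natDegree) :
    HasInfiniteSlope S.f ∨ ∃ e : ℚ, Admissible S.first e ∧ HasSlope v S.f e := by
  obtain ⟨s, hs, hfalse, htrue⟩ := hS.factored
  obtain ⟨b, hb, hvb⟩ : ∃ b ∈ s, S.first = false → v ∣ b := by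
    cases hS1 : S.first with
    | false =>
      obtain ⟨b, hb, hvb⟩ := hfalse hS1
      exact ⟨b, hb, fun _ => hvb⟩
    | true =>
      rw [hS1] at hdeg
      obtain ⟨b, hb⟩ := Multiset.card_pos_iff_exists_mem.1
        ((htrue hS1).symm ▸ hdeg.resolve_left (by simp))
      exact ⟨b, hb, by simp⟩
  rcases eq_or_ne b 0 with rfl | hb0
  · left
    rw [HasInfiniteSlope, coeff_zero_eq_eval_zero]
    exact hs.eval_eq_zero hb
  · obtain ⟨n, c, hn, rfl⟩ := h.exists_emultiplicity_eq hb0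
    exact Or.inr ⟨n, admissible_of_dvd hn hvb,
      (hs.hasSlope_iff h.prime n.cast_nonneg).2 ⟨_, hb, n, hn, rfl⟩⟩

theorem NodeModel.isEtaleAt_primeM_of_isLiftedFinite [CharZero k] (h : NodeModel ψ w u v)
    (hσ : IsNodeLift ψ v σ) [(Ideal.span {u, v}).IsPrime] {Γ : Set B} (hΓ : IsLiftedFinite σ Γ) :
    Algebra.IsEtaleAt A (primeM A u v Γ) := by
  obtain ⟨Γ₀, hΓ₀, rfl⟩ := hΓ
  exact h.isEtaleAt_primeM hσ hΓ₀

variable [(Ideal.span {v}).IsPrime]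

theorem MixedInvariant.exists_multiset (h : NodeModel ψ w u v) (hS : MixedInvariant A u σ hm f S)
    {e : ℕ} {f₁ : B[X]} {gbar : (primeP A v S.adjoined).ResidueField[X]}
    (hc : MixedChoice A v hp S e f₁ gbar) :
    ∃ t : Multiset B, (∀ c ∈ t, S.f.eval (v ^ e * c) = 0) ∧ t ≠ 0 ∧
      gbar.map (residueMap A v S.adjoined) =
        ((t.map fun c => X - C (Ideal.Quotient.mk (Ideal.span {v}) c)).prod).map
          (algebraMap _ (Ideal.span {v}).ResidueField) := by
  obtain ⟨s, hs, -, -⟩ := hS.factored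
  obtain ⟨s₁, hs₁, hmem⟩ := hs.of_isRescaling h.prime hc.2.2.2.1
  obtain ⟨t, hts, ht, hg⟩ := hc.2.2.2.2.exists_multiset hs₁
  exact ⟨t, fun c hc => hs.eval_eq_zero ((hmem c).1 (hts c hc)), ht, hg⟩

/-- The canonical lift is the product of the factors `y - σ(c mod v)`, so its roots are tied to
actual roots of the current polynomial. -/
theorem MixedInvariant.exists_eq_lift (h : NodeModel ψ w u v) (hS : MixedInvariant A u σ hm f S)
    {e : ℕ} {f₁ : B[X]} {gbar : (primeP A v S.adjoined).ResidueField[X]}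
    (hc : MixedChoice A v hp S e f₁ gbar) {gv : (B ⧸ Ideal.span {v})[X]}
    {g : (Localization.AtPrime (primeP A v S.adjoined))[X]}
    (hcan : IsCanonicalLift A v σ S.adjoined gbar gv g) {γ : B}
    (hγ : (g.map (localMap A v S.adjoined)).IsRoot (algebraMap B _ γ)) :
    ∃ c, S.f.eval (v ^ e * c) = 0 ∧ γ = σ (Ideal.Quotient.mk _ c) := by
  obtain ⟨t, ht, -, hg⟩ := hS.exists_multiset h hc
  rw [hcan.isRoot_iff, hcan.eq_prod hg, isRoot_map_prod_iff] at hγ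
  obtain ⟨c, hct, hγ⟩ := hγ
  exact ⟨c, ht c hct, hγ⟩

theorem MixedInvariant.exists_isRoot (h : NodeModel ψ w u v) (hS : MixedInvariant A u σ hm f S)
    {e : ℕ} {f₁ : B[X]} {gbar : (primeP A v S.adjoined).ResidueField[X]}
    (hc : MixedChoice A v hp S e f₁ gbar) {gv : (B ⧸ Ideal.span {v})[X]}
    {g : (Localization.AtPrime (primeP A v S.adjoined))[X]}
    (hcan : IsCanonicalLift A v σ S.adjoined gbar gv g) :
    ∃ β, gv.IsRoot β ∧
      (g.map (localMap A v S.adjoined)).IsRoot (algebraMap B _ (σ β)) := by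
  obtain ⟨t, -, ht, hg⟩ := hS.exists_multiset h hc
  obtain ⟨c, hct⟩ := Multiset.exists_mem_of_ne_zero ht
  refine ⟨Ideal.Quotient.mk _ c, ?_, ?_⟩
  · obtain ⟨t, rfl⟩ := Multiset.exists_cons_of_mem hct
    simp [hcan.eq_prod hg]
  · rw [hcan.isRoot_iff, hcan.eq_prod hg, isRoot_map_prod_iff]
    exact ⟨c, hct, rfl⟩

/-- The residual factor splits over `B/(v)`, where `u` is a uniformizer, so the discrete algorithm
can follow the chosen root. -/
theorem MixedInvariant.exists_isResidualExpansion (h : NodeModel ψ w u v) (hσ : IsNodeLift ψ v σ)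
    (hS : MixedInvariant A u σ hm f S) {ι : k →+* B} (hι : ∀ c, algebraMap A B (ψ (C c)) = ι c)
    {e : ℕ} {f₁ : B[X]} {gbar : (primeP A v S.adjoined).ResidueField[X]}
    (hc : MixedChoice A v hp S e f₁ gbar) {gv : (B ⧸ Ideal.span {v})[X]}
    {g : (Localization.AtPrime (primeP A v S.adjoined))[X]}
    (hcan : IsCanonicalLift A v σ S.adjoined gbar gv g) {γ : B}
    (hγ : (g.map (localMap A v S.adjoined)).IsRoot (algebraMap B _ γ)) :
    ∃ r', IsResidualExpansion u v ι hm gv γ r' := by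
  obtain ⟨t, -, -, hg⟩ := hS.exists_multiset h hc
  have hgv := hcan.eq_prod hg
  rw [hcan.isRoot_iff, hgv, isRoot_map_prod_iff] at hγ
  obtain ⟨c, hct, rfl⟩ := hγ
  have hu := h.mk_u
  have hprime := hu ▸ h.uniformized.prime
  have hs : NewtonFactored (Ideal.Quotient.mk (Ideal.span {v}) u)
      (t.map (Ideal.Quotient.mk (Ideal.span {v}))) gv := by
    refine ⟨1, 0, fun hd => hprime.not_isUnit (isUnit_of_dvd_one hd), ?_⟩
    rw [hgv, Multiset.map_map]
    simp
  obtain ⟨r, hr, hd⟩ := exists_discreteOutput (ι := (Ideal.Quotient.mk (Ideal.span {v})).comp ι)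
    hprime (hu ▸ h.uniformized.finiteMultiplicity)
    (fun b => by
      obtain ⟨c, hc⟩ := h.uniformized.residue b
      refine ⟨c, ?_⟩
      rw [← hu, RingHom.comp_apply (Ideal.Quotient.mk (Ideal.span {v})) ι, ← hι]
      exact hc) hm hs (Multiset.mem_map_of_mem _ hct)
  refine ⟨r, hr, ?_⟩
  rw [Ideal.mem_span_singleton, hσ.mk_apply]
  exact hd

theorem MixedInvariant.step (h : NodeModel ψ w u v) (hσ : IsNodeLift ψ v σ) {ι : k →+* B}
    (hS : MixedInvariant A u σ hm f S) (hST : MixedStep A u v ι σ hm hp S T) :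
    MixedInvariant A u σ hm f T := by
  obtain ⟨e, f₁, gbar, gv, g, γ, r', hc, hcan, hγ, hr', rfl⟩ := hST
  obtain ⟨c, hc0, rfl⟩ := hS.exists_eq_lift h hc hcan hγ
  have hr := hc.2.2.2.1
  obtain ⟨s, hs, -, -⟩ := hS.factored
  obtain ⟨s₁, hs₁, hmem⟩ := hs.of_isRescaling h.prime hr
  -- The translated polynomial has the root `c - σ(c mod v)`, divisible by `v`; this provides a
  -- positive or infinite slope for the next pass.
  refine ⟨?_, coeff_comp_X_add_C_mem_adjoinedField (hS.rescaling_coeff h hr),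
    ⟨_, hs₁.translate _, fun _ => ⟨_, Multiset.mem_map_of_mem _
      ((hmem c).2 (hs.mem_of_eval_eq_zero hc0)), hσ.dvd_sub c⟩, by simp⟩, fun β hβ => ?_, ?_⟩
  · obtain ⟨Γ₀, hΓ₀, hΓ⟩ := hS.adjoined
    exact ⟨_, hΓ₀.insert _, by rw [Set.image_insert_eq, hΓ]⟩
  · obtain ⟨m, hm, -⟩ := hr
    have h1 := congrArg (eval (β + σ (Ideal.Quotient.mk _ c))) hm
    simp only [eval_comp, eval_add, eval_X, eval_C, eval_mul] at h1 hβ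
    rw [hβ, mul_zero] at h1
    rw [← hS.eval_eq_zero _ h1.symm]
    congr 1
    ring
  · have h2 := hr'.2
    rw [Ideal.mem_span_singleton] at h2
    -- Because `σ` fixes `u`, a congruence modulo `u^hm` in `B/(v)` lifts to one in `B`.
    have h3 := _root_.map_dvd σ h2
    rw [map_pow, hσ.map_mk_u h, map_sub, hσ.mk_apply] at h3
    have h4 := dvd_add hS.dvd_sub (h3.mul_right (v ^ (S.prec + e)))
    convert h4 using 1
    ring

theorem MixedInvariant.reachable (h : NodeModel ψ w u v) (hσ : IsNodeLift ψ v σ) {ι : k →+* B}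
    (hS : MixedInvariant A u σ hm f S)
    (hST : Relation.ReflTransGen (MixedStep A u v ι σ hm hp) S T) :
    MixedInvariant A u σ hm f T := by
  induction hST with
  | refl => exact hS
  | tail _ hstep ih => exact ih.step h hσ hstep

theorem mixedStep_measure_lt {ι : k →+* B} (hST : MixedStep A u v ι σ hm hp S T) :
    T.first.toNat + (hp - T.prec) < S.first.toNat + (hp - S.prec) := by
  obtain ⟨e, f₁, gbar, gv, g, γ, r', ⟨hadm, -, hlt, -, -⟩, -, -, -, rfl⟩ := hST
  rcases hadm with he | ⟨hf, -⟩
  · have : 0 < e := by exact_mod_cast he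
    simp only [Bool.toNat_false]
    omega
  · simp only [Bool.toNat_false, hf, Bool.toNat_true]
    omega

theorem acc_mixedStep (A : Type*) [CommRing A] [Algebra A B] (u : B)
    (σ : B ⧸ Ideal.span {v} →+* B) (ι : k →+* B) (hm hp : ℕ) (S : MixedState B) :
    Acc (fun T S => MixedStep A u v ι σ hm hp S T) S :=
  (Subrelation.wf (fun hST => mixedStep_measure_lt hST)
    (measure fun S : MixedState B => S.first.toNat + (hp - S.prec)).wf).apply S

/-- A pass is determined by the slope `e < hp` and a root `v^e c` of the current polynomial: the
rescaling is unique, and so is the expansion of the root of the lift. -/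
theorem MixedInvariant.finite_setOf_mixedStep (h : NodeModel ψ w u v) {ι : k →+* B}
    (hS : MixedInvariant A u σ hm f S) :
    {T | MixedStep A u v ι σ hm hp S T}.Finite := by
  have hu := h.mk_u
  have hprime := hu ▸ h.uniformized.prime
  have hS0 : S.f ≠ 0 := by
    obtain ⟨s, hs, -, -⟩ := hS.factored
    intro h0
    exact hs.not_dvd h.prime (h0 ▸ dvd_zero _)
  have hfin : ∀ e : ℕ, {c | S.f.eval (v ^ e * c) = 0}.Finite := fun e =>
    (finite_setOfPred_isRoot hS0).preimage
      (mul_right_injective₀ (pow_ne_zero e h.prime.ne_zero)).injOn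
  refine ((Set.finite_lt_nat hp).biUnion (fun e _ => (hfin e).biUnion (t := fun c =>
    {T | ∃ (f₁ : B[X]) (gv : (B ⧸ Ideal.span {v})[X]) (r' : B ⧸ Ideal.span {v}),
      IsRescaling v e S.f f₁ ∧
      IsResidualExpansion u v ι hm gv (σ (Ideal.Quotient.mk _ c)) r' ∧
      T = ({ first := false
             adjoined := insert (σ (Ideal.Quotient.mk _ c)) S.adjoined
             f := f₁.comp (X + C (σ (Ideal.Quotient.mk _ c)))
             prec := S.prec + e
             rp := S.rp + σ (Ideal.Quotient.mk _ c) * v ^ (S.prec + e)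
             rm := S.rm + σ r' * v ^ (S.prec + e) } : MixedState B)}) fun c _ => ?_)).subset ?_
  · refine Set.Subsingleton.finite ?_
    rintro _ ⟨f₁, gv, r, hf₁, hr, rfl⟩ _ ⟨f₂, gv', r', hf₂, hr', rfl⟩
    obtain rfl := hf₁.unique h.prime hf₂
    have hd : Ideal.Quotient.mk (Ideal.span {v}) u ^ hm ∣ r - r' := by
      rw [← Ideal.mem_span_singleton]
      convert sub_mem hr'.2 hr.2 using 1
      ring
    rw [hr.1.eq_of_pow_dvd_sub hprime hr'.1 hd]
  · rintro T ⟨e, f₁, gbar, gv, g, γ, r', hc, hcan, hγ, hr', rfl⟩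
    obtain ⟨c, hc0, rfl⟩ := hS.exists_eq_lift h hc hcan hγ
    simp only [Set.mem_iUnion]
    exact ⟨e, lt_of_le_of_lt (Nat.le_add_left _ _) hc.2.2.1, c, hc0, f₁, gv, r', hc.2.2.2.1, hr',
      rfl⟩

variable [CharZero k]

theorem NodeModel.exists_residueMap_eq_of_isLiftedFinite (h : NodeModel ψ w u v)
    (hσ : IsNodeLift ψ v σ) {Γ : Set B} (hΓ : IsLiftedFinite σ Γ) {x : B}
    (hx : algebraMap B (FractionRing B) x ∈ adjoinedField A Γ) :
    ∃ y, residueMap A v Γ y = algebraMap B _ x := by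
  obtain ⟨Γ₀, hΓ₀, rfl⟩ := hΓ
  exact h.exists_residueMap_eq hσ hΓ₀ hx

theorem NodeModel.isIntegralEtaleLift_of_isLiftedFinite (h : NodeModel ψ w u v)
    (hσ : IsNodeLift ψ v σ) [(Ideal.span {u, v}).IsPrime] {Γ : Set B} (hΓ : IsLiftedFinite σ Γ)
    {gbar : (primeP A v Γ).ResidueField[X]} {gv : (B ⧸ Ideal.span {v})[X]}
    {g : (Localization.AtPrime (primeP A v Γ))[X]} (hirr : Irreducible gbar)
    (hmonic : gbar.Monic) (hcan : IsCanonicalLift A v σ Γ gbar gv g)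
    {β : B ⧸ Ideal.span {v}} (hβ : gv.IsRoot β) :
    IsIntegralEtaleLift (primeP A v Γ) (primeM A u v Γ) gbar g := by
  obtain ⟨Γ₀, hΓ₀, rfl⟩ := hΓ
  exact h.isIntegralEtaleLift hσ hΓ₀ hirr hmonic hcan hβ

theorem NodeModel.exists_isCanonicalLift (h : NodeModel ψ w u v)
    (hσ : IsNodeLift ψ v σ) {Γ : Set B} (hΓ : IsLiftedFinite σ Γ)
    {gbar : (primeP A v Γ).ResidueField[X]} {gv : (B ⧸ Ideal.span {v})[X]}
    (hg : gbar.map (residueMap A v Γ) = gv.map (algebraMap _ (Ideal.span {v}).ResidueField)) :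
    ∃ g, IsCanonicalLift A v σ Γ gbar gv g := by
  obtain ⟨Γ₀, hΓ₀, rfl⟩ := hΓ
  obtain ⟨g, hg'⟩ := (mem_lifts _).1 ((lifts_iff_coeff_lifts (f := localMap A v (σ '' Γ₀))
    ((gv.map σ).map (algebraMap B (Localization.AtPrime (Ideal.span {v}))))).2 fun n => by
      have h1 := congrArg (fun p => p.coeff n) hg
      simp only [coeff_map] at h1
      obtain ⟨y, hy⟩ := h.exists_localMap_eq hσ hΓ₀ (h.lift_mem_adjoinedField hσ hΓ₀ h1)
      exact ⟨y, by rw [hy, coeff_map, coeff_map]⟩)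
  exact ⟨g, hg.symm, hg'⟩

theorem MixedInvariant.exists_isResidualFactor (h : NodeModel ψ w u v) (hσ : IsNodeLift ψ v σ)
    (hS : MixedInvariant A u σ hm f S) {e : ℕ} {f₁ : B[X]} (hr : IsRescaling v e S.f f₁) {c : B}
    (hc : S.f.eval (v ^ e * c) = 0) :
    ∃ gbar, IsResidualFactor A v S.adjoined f₁ gbar ∧
      (gbar.map (residueMap A v S.adjoined)).IsRoot (algebraMap B _ c) := by
  obtain ⟨s, hs, -, -⟩ := hS.factored
  obtain ⟨s₁, hs₁, hmem⟩ := hs.of_isRescaling h.prime hr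
  exact exists_isResidualFactor_of_mem hs₁
    (fun i => h.exists_residueMap_eq_of_isLiftedFinite hσ hS.adjoined (hS.rescaling_coeff h hr i))
    ((hmem c).2 (hs.mem_of_eval_eq_zero hc))

/-- For a root `v^n c` the factor is the minimal polynomial of `c mod v`, and the root adjoined is
`σ(c mod v)`. The approximated root of the input does not change. -/
theorem MixedInvariant.exists_step (h : NodeModel ψ w u v) (hσ : IsNodeLift ψ v σ) {ι : k →+* B}
    (hι : ∀ c, algebraMap A B (ψ (C c)) = ι c) (hS : MixedInvariant A u σ hm f S) {n : ℕ} {c : B}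
    (hc : S.f.eval (v ^ n * c) = 0) (hadm : Admissible S.first n) (hslope : HasSlope v S.f n)
    (hlt : S.prec + n < hp) :
    ∃ T β, MixedStep A u v ι σ hm hp S T ∧ T.f.eval β = 0 ∧ v ∣ β ∧
      T.rp + v ^ T.prec * β = S.rp + v ^ S.prec * (v ^ n * c) := by
  obtain ⟨s, hs, -, -⟩ := hS.factored
  obtain ⟨f₁, s₁, hr, hs₁, hmem⟩ := hs.exists_rescaling h.prime n
  obtain ⟨gbar, hgbar, hroot⟩ := hS.exists_isResidualFactor h hσ hr hc
  have hchoice : MixedChoice A v hp S n f₁ gbar := ⟨hadm, hslope, hlt, hr, hgbar⟩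
  obtain ⟨t, -, -, hg⟩ := hS.exists_multiset h hchoice
  obtain ⟨g, hcan⟩ := h.exists_isCanonicalLift hσ hS.adjoined hg
  have hγ : (g.map (localMap A v S.adjoined)).IsRoot
      (algebraMap B _ (σ (Ideal.Quotient.mk _ c))) := by
    rw [hcan.isRoot_iff, IsRoot, eval_map_apply]
    have hinj := IsFractionRing.injective (B ⧸ Ideal.span {v}) (Ideal.span {v}).ResidueField
    rw [hg, IsRoot, IsScalarTower.algebraMap_apply B (B ⧸ Ideal.span {v}), eval_map_apply,
      map_eq_zero_iff _ hinj] at hroot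
    exact (congrArg σ hroot).trans (map_zero σ)
  obtain ⟨r', hr'⟩ := hS.exists_isResidualExpansion h hσ hι hchoice hcan hγ
  refine ⟨_, c - σ (Ideal.Quotient.mk _ c),
    ⟨n, f₁, gbar, _, g, _, r', hchoice, hcan, hγ, hr', rfl⟩, ?_, hσ.dvd_sub c, ?_⟩
  · simp [eval_comp, hs₁.eval_eq_zero ((hmem c).2 (hs.mem_of_eval_eq_zero hc))]
  · ring

theorem MixedInvariant.exists_mixedHalts (h : NodeModel ψ w u v) (hσ : IsNodeLift ψ v σ)
    {ι : k →+* B} (hι : ∀ c, algebraMap A B (ψ (C c)) = ι c) (hS : MixedInvariant A u σ hm f S)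
    {β : B} (hβ : S.f.eval β = 0) (hvβ : S.first = false → v ∣ β) :
    ∃ T, Relation.ReflTransGen (MixedStep A u v ι σ hm hp) S T ∧ MixedHalts v hp T ∧
      v ^ hp ∣ S.rp + v ^ S.prec * β - T.rp := by
  -- Induction along the terminating relation: the pass that follows `β` leads to a smaller state
  -- with a root divisible by `v`.
  induction acc_mixedStep A u σ ι hm hp S generalizing β with
  | intro S _ ih =>
    rcases eq_or_ne β 0 with rfl | hβ0
    · exact ⟨S, .refl, Or.inl (by rwa [HasInfiniteSlope, coeff_zero_eq_eval_zero]), by simp⟩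
    obtain ⟨n, c, hn, rfl⟩ := h.exists_emultiplicity_eq hβ0
    have hadm := admissible_of_dvd hn hvβ
    obtain ⟨s, hs, -, -⟩ := hS.factored
    have hslope : HasSlope v S.f n :=
      (hs.hasSlope_iff h.prime n.cast_nonneg).2 ⟨_, hs.mem_of_eval_eq_zero hβ, n, hn, rfl⟩
    rcases lt_or_ge (S.prec + n) hp with hlt | hge
    · obtain ⟨T, β, hT, hTβ, hvβ, heq⟩ := hS.exists_step h hσ hι hβ hadm hslope hlt
      obtain ⟨T', hT', hhalt, hd⟩ := ih T hT (hS.step h hσ hT) hTβ fun _ => hvβ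
      exact ⟨T', hT'.head hT, hhalt, heq ▸ hd⟩
    · refine ⟨S, .refl, Or.inr ⟨n, hadm, hslope, by exact_mod_cast hge⟩, ?_⟩
      rw [add_sub_cancel_left, ← mul_assoc, ← pow_add]
      exact (pow_dvd_pow v hge).mul_right c

theorem NodeModel.mixedCorrect (h : NodeModel ψ w u v) (hσ : IsNodeLift ψ v σ)
    [(Ideal.span {u, v}).IsPrime] {ι : k →+* B} (hι : ∀ c, algebraMap A B (ψ (C c)) = ι c)
    {f : A[X]} (hlead : IsUnit (algebraMap A B f.leadingCoeff))
    (hsplit : (f.map (algebraMap A B)).Splits) (hm hp : ℕ) :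
    MixedCorrect A u v ι σ hm hp f := by
  have hinit : MixedInvariant A u σ hm (f.map (algebraMap A B)) (.init (f.map (algebraMap A B))) :=
    .init hm hlead h.prime.not_isUnit hsplit
  have hinv : ∀ {S}, MixedReachable A u v ι σ hm hp (f.map (algebraMap A B)) S →
    MixedInvariant A u σ hm (f.map (algebraMap A B)) S := fun hS => hinit.reachable h hσ hS
  have hroot : ∀ α : B, aeval α f = (f.map (algebraMap A B)).eval α := fun α => by
    rw [eval_map, aeval_def]
  constructor
  case sound =>
    rintro _ _ ⟨S, hS, hhalt, rfl, rfl⟩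
    obtain ⟨β, hβ, hd⟩ := (hinv hS).exists_eval_eq_zero h hhalt
    refine ⟨S.rp + v ^ S.prec * β, (hroot _).trans ((hinv hS).eval_eq_zero β hβ),
      (hinv hS).isApproximation ?_⟩
    rwa [add_sub_cancel_left]
  case complete =>
    intro α hα
    rw [hroot] at hα
    obtain ⟨T, hT, hhalt, hd⟩ := hinit.exists_mixedHalts (hp := hp) h hσ hι hα
      (by simp [MixedState.init])
    refine ⟨T.rm, T.rp, ⟨T, hT, hhalt, rfl, rfl⟩, (hinv hT).isApproximation ?_⟩
    simpa [MixedState.init] using hd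
  case terminates => exact acc_mixedStep A u σ ι hm hp _
  case finite_choices => exact fun S hS => (hinv hS).finite_setOf_mixedStep h
  case exists_slope =>
    intro S hS hdeg
    refine (hinv hS).exists_slope h ?_
    rwa [natDegree_map_of_leadingCoeff_ne_zero _ hlead.ne_zero]
  case slope_integral => exact fun S hS e hadm hslope => (hinv hS).slope_integral h hadm hslope
  case exists_rescaling =>
    intro S hS e _ _
    obtain ⟨s, hs, -, -⟩ := (hinv hS).factored
    obtain ⟨f₁, -, hr, -⟩ := hs.exists_rescaling h.prime e
    exact ⟨f₁, hr⟩
  case exists_factor =>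
    intro S hS e f₁ _ hslope hr
    obtain ⟨s, hs, -, -⟩ := (hinv hS).factored
    obtain ⟨b, hb, n, hn, hen⟩ := (hs.hasSlope_iff h.prime e.cast_nonneg).1 hslope
    obtain rfl : e = n := by exact_mod_cast hen
    obtain ⟨c, rfl⟩ := pow_dvd_of_le_emultiplicity hn.ge
    obtain ⟨gbar, hg, -⟩ := (hinv hS).exists_isResidualFactor h hσ hr (hs.eval_eq_zero hb)
    exact ⟨gbar, hg⟩
  case exists_lift =>
    intro S hS e f₁ gbar hc
    obtain ⟨t, -, -, hg⟩ := (hinv hS).exists_multiset h hc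
    exact ⟨_, h.exists_isCanonicalLift hσ (hinv hS).adjoined hg⟩
  case etale_lift =>
    intro S hS e f₁ gbar hc gv g hcan
    obtain ⟨β, hβ, -⟩ := (hinv hS).exists_isRoot h hc hcan
    obtain ⟨fbar, -, hmonic, hirr, -⟩ := hc.2.2.2.2
    exact h.isIntegralEtaleLift_of_isLiftedFinite hσ (hinv hS).adjoined hirr hmonic hcan hβ
  case exists_root =>
    intro S hS e f₁ gbar hc gv g hcan
    obtain ⟨β, -, hβ⟩ := (hinv hS).exists_isRoot h hc hcan
    exact ⟨_, hβ⟩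
  case exists_expansion =>
    intro S hS e f₁ gbar hc gv g hcan γ hγ
    exact (hinv hS).exists_isResidualExpansion h hσ hι hc hcan hγ
  case etale => exact fun S hS => h.isEtaleAt_primeM_of_isLiftedFinite hσ (hinv hS).adjoined

end Invariant

end MixedNP

theorem mainTheorem11 {R : Type*} [CommRing R] [IsDomain R] [IsDiscreteValuationRing R]
    [IsAdicComplete (IsLocalRing.maximalIdeal R) R]
    [IsAlgClosed (IsLocalRing.ResidueField R)] [CharZero (IsLocalRing.ResidueField R)]
    (π : R) [Fact (Irreducible π)]
    {B : Type*} [CommRing B] [Algebra (MixedNP.NodeLocal π) B]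
    (hB : MixedNP.IsStrictHenselization (MixedNP.NodeLocal π) B)
    (u v : B)
    (hu : u = algebraMap (MixedNP.NodeLocal π) B
      (algebraMap (MixedNP.Node π) (MixedNP.NodeLocal π) (MixedNP.nodeU π)))
    (hv : v = algebraMap (MixedNP.NodeLocal π) B
      (algebraMap (MixedNP.Node π) (MixedNP.NodeLocal π) (MixedNP.nodeV π)))
    (f : (MixedNP.NodeLocal π)[X])
    (hlead : IsUnit (algebraMap (MixedNP.NodeLocal π) B f.leadingCoeff))
    (hsplit : (f.map (algebraMap (MixedNP.NodeLocal π) B)).Splits)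
    (hm hp : ℕ) :
    ∃ (_ : IsDomain B) (_ : (Ideal.span {v}).IsPrime) (_ : (Ideal.span {u, v}).IsPrime),
      -- the residue map of `R` has a section `s`, and for each such `s` there is a lifting map `σ`
      (∃ s : IsLocalRing.ResidueField R →+* R, ∀ x, IsLocalRing.residue R (s x) = x) ∧
      ∀ s : IsLocalRing.ResidueField R →+* R, (∀ x, IsLocalRing.residue R (s x) = x) →
      ∀ ι : IsLocalRing.ResidueField R →+* B,
        ι = ((algebraMap (MixedNP.NodeLocal π) B).comp
          (algebraMap R (MixedNP.NodeLocal π))).comp s →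
      (∃ σ, MixedNP.IsLiftingMap u v ι σ) ∧
      ∀ σ, MixedNP.IsLiftingMap u v ι σ →
        MixedNP.MixedCorrect (MixedNP.NodeLocal π) u v ι σ hm hp f := by
  have main : ∀ s : IsLocalRing.ResidueField R →+* R, (∀ x, IsLocalRing.residue R (s x) = x) →
      IsDomain B ∧ MixedNP.NodeModel (MixedNP.localPoly π s) (MixedNP.localV π) u v := by
    intro s hs
    rw [hu, hv]
    exact hB.nodeModel_localPoly π hs
  -- The model depends on the section. One section suffices for the statements about `B` alone; for
  -- each given `s` the model is built anew.
  obtain ⟨s₀, hs₀⟩ := MixedNP.exists_section_residue R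
  obtain ⟨hdom, h₀⟩ := main s₀ hs₀
  have hprime := h₀.isPrime_span
  have hprime' := h₀.isPrime_span_pair
  refine ⟨hdom, hprime, hprime', ⟨s₀, hs₀⟩, ?_⟩
  intro s hs ι hι
  obtain ⟨-, h⟩ := main s hs
  have hc : ∀ c, algebraMap (MixedNP.NodeLocal π) B (MixedNP.localPoly π s (C c)) = ι c := by
    intro c
    rw [MixedNP.localPoly_C, hι]
    rfl
  refine ⟨?_, fun σ hσ => h.mixedCorrect (hσ.isNodeLift h.map_X hc) hc hlead hsplit hm hp⟩
  obtain ⟨σ, hσ⟩ := h.exists_isNodeLift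
  exact ⟨σ, hσ.isLiftingMap h.map_X hc⟩
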